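/- **Setting.** Let $N\ge 2$ be an even integer and $h=1/N$. For $(a,b)\in\mathbb R^2$ let $\widehat T^h_{(a,b)}u(x)=e^{-\frac{i\pi}{h}ab}e^{\frac{2i\pi}{h}bx}u(x-a)$. Let $\mathcal H^h$ be the space of tempered distributions on $\mathbb R$ invariant under $\widehat T^h_{(1,0)}$ and $\widehat T^h_{(0,1)}$. For $\varphi\in\mathcal S(\mathbb R)$ put $\Sigma^h(\varphi)=\sum_{k\in\mathbb Z^2}\widehat T^h_k\varphi\in\mathcal H^h$, and equip $\mathcal H^h$ with the Hermitian product $\langle\Sigma^h\varphi_1,\Sigma^h\varphi_2\rangle=\sum_{k\in\mathbb Z^2}\langle\widehat T^h_k\varphi_1,\varphi_2\rangle_{L^2(\mathbb R)}$ (linear in the first variable). Let $M=\begin{pmatrix}2&1\\1&1\end{pmatrix}$, $\lambda=\frac{3+\sqrt5}{2}$ its eigenvalue larger than $1$, and $\theta\in(0,\pi/2)$ the angle of the unstable line, $\tan\theta=\frac{\sqrt5-1}{2}$. The quantum cat map acts on $\mathcal S(\mathbb R)$ by $$\widehat M^hf(x)=\frac1{\sqrt2}\int_{\mathbb R}e^{\frac{2i\pi}{h}\cdot\frac14(x^2-\xi^2+2x\xi)}\hat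 f^h(\xi)\,d\xi,\qquad \hat f^h(\xi)=\frac1h\int_{\mathbb R}e^{-\frac{2i\pi x\xi}{h}}f(x)\,dx,$$ and on $\mathcal H^h$ by $\widehat M^h\Sigma^h(\varphi)=\Sigma^h(\widehat M^h\varphi)$. The wave packet at position $q$ and momentum $p$ is $\Phi^h_{(q,p)}(x)=(2/h)^{1/4}e^{\frac{2i\pi}{h}p(x-q)}e^{-\frac{\pi}{h}(x-q)^2}$ (of unit $L^2$ norm); it is viewed in $\mathcal H^h$ as $\Sigma^h(\Phi^h_{(q,p)})$. On $\mathbb T^2=(\mathbb R/\mathbb Z)^2$ let $T_h(x,y)=(x+\tan\theta,\;y+Nx+\beta)$ with $\beta=\frac{N\tan\theta}{2}$, and for $\chi:\mathbb R\to\mathbb C$, $f:\mathbb T^2\to\mathbb C$, $m>0$ let $$S^\chi_m(f)(x,y)=\sum_{k\in\mathbb Z}\chi(k/m)\,f(T_h^k(x,y)).$$ Let $d(x,x')\in(-\frac12,\frac12]$ be the signed distance on $\mathbb R/\mathbb Z$ (the representative of $x-x'$ in this interval), $s_0=p_0-q_0\tan\theta$, and $$f_{q_0,p_0}(x,y)=F_0\Big(\frac{d(x,s_0)}{\sqrt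 h}\Big)e^{\frac{2i\pi}{h}q_0d(x,s_0)}e^{2i\pi y},\quad F_0(u)=e^{-\pi\cos^2\theta\,(1+i\tan\theta)u^2},\quad \chi(u)=e^{-\gamma u^2},\ \ \gamma=\frac{\pi}{h\cos^2\theta}.$$ **Theorem.** There are a constant $C$ and constants $D_k$ ($k\in\mathbb N$) such that, for every even $N\ge2$ with $h=1/N$, every integer $n\ge0$ with $n\ge\frac{\ln(1/h)}{\ln\lambda}$, every $(a,b)\in\mathbb R^2$, every $(q_0,p_0)\in[0,1)^2$ and every $k\in\mathbb N$, $$\Big|\big\langle(\widehat M^h)^n\Phi^h_{(a,b)},\Phi^h_{(q_0,p_0)}\big\rangle_{\mathcal H^h}-\frac{D}{\sqrt{\lambda^n}}\,S^\chi_{\lambda^n}(f_{q_0,p_0})\big(s(a',b'),0\big)\Big|\le D_kh^k+C\sqrt h\,\lambda^{-n/2}.$$ Here $(a',b')\in[0,1)^2$ and $(l_1,l_2)\in\mathbb Z^2$ are the fractional and integer parts of $M^n(a,b)$ (componentwise), $s(a',b')=b'-a'\tan\theta$, and $D$ is the complex number of constant modulus $\sqrt2$ $$D=\sqrt2\,\exp\Big(i\pi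 N\big(l_1b'-l_2a'-ab-a'b'+a'^2\tan\theta+2q_0p_0-q_0^2\tan\theta\big)\Big).$$ -/

import Mathlib

open scoped SchwartzMap FourierTransform ComplexConjugate ContDiff
open MeasureTheory

noncomputable section

namespace QuantumCat

/-! ### Gaussian functions with a complex parameter -/

/-- The function `x ↦ exp (-π z x²)`. -/
def gauss (z : ℂ) (x : ℝ) : ℂ := Complex.exp (-(Real.pi * z * (x : ℂ) ^ 2))

theorem gauss_contDiff (z : ℂ) {m : WithTop ℕ∞} : ContDiff ℝ m (gauss z) := by
  unfold gauss
  have h : ContDiff ℝ m (fun x : ℝ => (x : ℂ)) := Complex.ofRealCLM.contDiff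
  exact (contDiff_const.mul (h.pow 2)).neg.cexp

theorem gauss_hasDerivAt (z : ℂ) (x : ℝ) :
    HasDerivAt (gauss z) (-(2 * Real.pi * z * x) * gauss z x) x := by
  have h1 : HasDerivAt (fun x : ℝ => (x : ℂ)) 1 x := Complex.ofRealCLM.hasDerivAt
  have h2 := ((h1.pow 2).const_mul ((Real.pi : ℂ) * z)).neg.cexp
  refine h2.congr_deriv ?_
  unfold gauss
  push_cast
  simp
  ring

/-- Every derivative of a Gaussian is a polynomial times the Gaussian. -/
theorem gauss_iteratedDeriv (z : ℂ) (n : ℕ) :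
    ∃ P : Polynomial ℂ, iteratedDeriv n (gauss z) = fun x : ℝ => P.eval (x : ℂ) * gauss z x := by
  induction n with
  | zero => exact ⟨1, by ext x; simp⟩
  | succ n ih =>
    obtain ⟨P, hP⟩ := ih
    refine ⟨P.derivative + P * (Polynomial.C (-(2 * Real.pi * z)) * Polynomial.X), ?_⟩
    ext x
    rw [iteratedDeriv_succ, hP]
    have hp : HasDerivAt (fun x : ℝ => P.eval (x : ℂ)) (P.derivative.eval (x : ℂ)) x := by
      simpa using (P.hasDerivAt (x : ℂ)).comp_ofReal
    refine (hp.mul (gauss_hasDerivAt z x)).deriv.trans ?_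
    simp
    ring

theorem gauss_norm (z : ℂ) (x : ℝ) : ‖gauss z x‖ = Real.exp (-(Real.pi * z.re * x ^ 2)) := by
  unfold gauss
  rw [Complex.norm_exp]
  congr 1
  simp [← Complex.ofReal_pow, Complex.mul_re]

theorem polynomial_bound (P : Polynomial ℂ) :
    ∃ (k : ℕ) (C : ℝ), 0 ≤ C ∧ ∀ x : ℝ, ‖P.eval (x : ℂ)‖ ≤ C * (1 + ‖x‖) ^ k := by
  refine ⟨P.natDegree, ∑ i ∈ Finset.range (P.natDegree + 1), ‖P.coeff i‖,
    Finset.sum_nonneg fun _ _ => norm_nonneg _, fun x => ?_⟩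
  rw [Polynomial.eval_eq_sum_range, Finset.sum_mul]
  refine (norm_sum_le _ _).trans (Finset.sum_le_sum fun i hi => ?_)
  rw [norm_mul, norm_pow, Complex.norm_real]
  refine mul_le_mul_of_nonneg_left ?_ (norm_nonneg _)
  have h0 : (0 : ℝ) ≤ ‖x‖ := norm_nonneg x
  calc ‖x‖ ^ i ≤ (1 + ‖x‖) ^ i := by gcongr; linarith
    _ ≤ (1 + ‖x‖) ^ P.natDegree :=
      pow_le_pow_right₀ (by linarith) (by simpa [Nat.lt_succ_iff] using hi)

theorem gauss_hasTemperateGrowth {z : ℂ} (hz : 0 ≤ z.re) :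
    Function.HasTemperateGrowth (gauss z) := by
  refine ⟨gauss_contDiff z, fun n => ?_⟩
  obtain ⟨P, hP⟩ := gauss_iteratedDeriv z n
  obtain ⟨k, C, hC, h⟩ := polynomial_bound P
  refine ⟨k, C, fun x => ?_⟩
  rw [norm_iteratedFDeriv_eq_norm_iteratedDeriv, hP, norm_mul, gauss_norm]
  have h1 : Real.exp (-(Real.pi * z.re * x ^ 2)) ≤ 1 := by
    rw [Real.exp_le_one_iff]
    have := Real.pi_pos
    have : 0 ≤ Real.pi * z.re * x ^ 2 := by positivity
    linarith
  calc _ ≤ ‖P.eval (x : ℂ)‖ * 1 := by gcongr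
    _ ≤ _ := by simpa using h x

theorem pow_mul_exp_bound {r : ℝ} (hr : 0 < r) (j : ℕ) :
    ∃ C : ℝ, ∀ x : ℝ, (1 + ‖x‖) ^ j * Real.exp (-(r * x ^ 2)) ≤ C := by
  refine ⟨2 ^ j * (1 + j.factorial / r ^ j), fun x => ?_⟩
  have hE : Real.exp (-(r * x ^ 2)) ≤ 1 := by
    rw [Real.exp_le_one_iff]; have : 0 ≤ r * x ^ 2 := by positivity
    linarith
  have h0 : 0 ≤ ‖x‖ := norm_nonneg x
  have h1 : (1 + ‖x‖) ^ j ≤ 2 ^ j * (1 + (x ^ 2) ^ j) := by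
    rcases le_total ‖x‖ 1 with h | h
    · calc (1 + ‖x‖) ^ j ≤ 2 ^ j := by gcongr; linarith
        _ ≤ _ := le_mul_of_one_le_right (by positivity) (by have : 0 ≤ (x ^ 2) ^ j := by positivity
                                                            linarith)
    · have h2 : ‖x‖ ≤ x ^ 2 := by
        rw [← sq_abs x]; rw [Real.norm_eq_abs] at *; nlinarith
      calc (1 + ‖x‖) ^ j ≤ (2 * x ^ 2) ^ j := by gcongr; linarith
        _ = 2 ^ j * (x ^ 2) ^ j := mul_pow _ _ _
        _ ≤ _ := by gcongr; linarith
  have h3 : (x ^ 2) ^ j * Real.exp (-(r * x ^ 2)) ≤ j.factorial / r ^ j := by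
    have := Real.pow_div_factorial_le_exp (r * x ^ 2) (by positivity) j
    rw [Real.exp_neg, ← div_eq_mul_inv, div_le_div_iff₀ (Real.exp_pos _) (by positivity)]
    rw [div_le_iff₀ (by positivity), mul_pow] at this
    linarith
  calc _ ≤ 2 ^ j * (1 + (x ^ 2) ^ j) * Real.exp (-(r * x ^ 2)) := by gcongr
    _ = 2 ^ j * (Real.exp (-(r * x ^ 2)) + (x ^ 2) ^ j * Real.exp (-(r * x ^ 2))) := by ring
    _ ≤ _ := by gcongr

/-- A Gaussian whose parameter has positive real part, as a Schwartz function. -/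
def gaussSchwartz (z : ℂ) (hz : 0 < z.re) : 𝓢(ℝ, ℂ) where
  toFun := gauss z
  smooth' := gauss_contDiff z
  decay' := by
    intro k n
    obtain ⟨P, hP⟩ := gauss_iteratedDeriv z n
    obtain ⟨l, C, hC, h⟩ := polynomial_bound P
    obtain ⟨B, hB⟩ := pow_mul_exp_bound (mul_pos Real.pi_pos hz) (k + l)
    refine ⟨C * B, fun x => ?_⟩
    rw [norm_iteratedFDeriv_eq_norm_iteratedDeriv, hP, norm_mul, gauss_norm]
    have h0 : 0 ≤ ‖x‖ := norm_nonneg x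
    calc ‖x‖ ^ k * (‖P.eval (x : ℂ)‖ * Real.exp (-(Real.pi * z.re * x ^ 2)))
        ≤ (1 + ‖x‖) ^ k * ((C * (1 + ‖x‖) ^ l) * Real.exp (-(Real.pi * z.re * x ^ 2))) := by
          gcongr
          · linarith
          · exact h x
      _ = C * ((1 + ‖x‖) ^ (k + l) * Real.exp (-(Real.pi * z.re * x ^ 2))) := by ring
      _ ≤ C * B := by gcongr; exact hB x

/-- The plane wave `x ↦ exp (2 i π w x)`. -/
def planeWave (w : ℝ) (x : ℝ) : ℂ := Complex.exp (2 * Real.pi * Complex.I * w * x)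

theorem planeWave_hasTemperateGrowth (w : ℝ) : Function.HasTemperateGrowth (planeWave w) := by
  have hd : ∀ n : ℕ, iteratedDeriv n (planeWave w) =
      fun x : ℝ => (2 * Real.pi * Complex.I * w) ^ n * planeWave w x := by
    intro n
    induction n with
    | zero => ext x; simp
    | succ n ih =>
      ext x
      have h1 : HasDerivAt (fun x : ℝ => (x : ℂ)) 1 x := Complex.ofRealCLM.hasDerivAt
      have h2 := (h1.const_mul (2 * Real.pi * Complex.I * w)).cexp
      rw [iteratedDeriv_succ, ih]
      refine (h2.const_mul ((2 * Real.pi * Complex.I * w : ℂ) ^ n)).deriv.trans ?_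
      unfold planeWave
      ring
  refine ⟨?_, fun n => ⟨0, ‖(2 * Real.pi * Complex.I * w : ℂ) ^ n‖, fun x => ?_⟩⟩
  · have h : ContDiff ℝ ∞ (fun x : ℝ => (x : ℂ)) := Complex.ofRealCLM.contDiff
    exact (contDiff_const.mul h).cexp
  · rw [norm_iteratedFDeriv_eq_norm_iteratedDeriv, hd, norm_mul]
    have : ‖planeWave w x‖ = 1 := by
      unfold planeWave
      rw [Complex.norm_exp]
      simp
    simp [this]

/-! ### Operators on Schwartz functions -/

open scoped Classical in
/-- Dilation `f ↦ f (s ·)`, for `s ≠ 0`. -/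
def dilation (s : ℝ) : 𝓢(ℝ, ℂ) →L[ℂ] 𝓢(ℝ, ℂ) :=
  if hs : s ≠ 0 then
    SchwartzMap.compCLMOfContinuousLinearEquiv ℂ
      (ContinuousLinearEquiv.unitsEquivAut ℝ (Units.mk0 s hs))
  else 0

theorem dilation_apply {s : ℝ} (hs : s ≠ 0) (f : 𝓢(ℝ, ℂ)) (x : ℝ) :
    dilation s f x = f (s * x) := by
  simp [dilation, hs, mul_comm]

/-- Multiplication by the chirp `x ↦ exp (i π s x²)`. -/
def chirp (s : ℝ) : 𝓢(ℝ, ℂ) →L[ℂ] 𝓢(ℝ, ℂ) :=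
  SchwartzMap.smulLeftCLM ℂ (gauss (-(Complex.I * s)))

theorem chirp_apply (s : ℝ) (f : 𝓢(ℝ, ℂ)) (x : ℝ) :
    chirp s f x = Complex.exp (Complex.I * Real.pi * s * (x : ℂ) ^ 2) * f x := by
  unfold chirp
  rw [SchwartzMap.smulLeftCLM_apply_apply (gauss_hasTemperateGrowth (by simp)), smul_eq_mul]
  unfold gauss
  congr 2
  ring

/-- The quantum translation `T̂_{(a,b)}` with parameter `h`. -/
def translation (h a b : ℝ) : 𝓢(ℝ, ℂ) →L[ℂ] 𝓢(ℝ, ℂ) :=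
  Complex.exp (-(Complex.I * Real.pi / h * (a * b))) •
    (SchwartzMap.smulLeftCLM ℂ (planeWave (b / h)) ∘L SchwartzMap.compSubConstCLM ℂ a)

theorem translation_apply (h a b : ℝ) (u : 𝓢(ℝ, ℂ)) (x : ℝ) :
    translation h a b u x =
      Complex.exp (-(Complex.I * Real.pi / h * (a * b))) *
        Complex.exp (2 * Complex.I * Real.pi / h * (b * x)) * u (x - a) := by
  simp only [translation, smul_apply, ContinuousLinearMap.comp_apply,
    SchwartzMap.smulLeftCLM_apply_apply (planeWave_hasTemperateGrowth _),
    SchwartzMap.compSubConstCLM_apply, smul_eq_mul, planeWave]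
  rw [← mul_assoc]
  congr 3
  push_cast
  ring

/-- The `h`-Fourier transform. -/
def hFourier (h : ℝ) : 𝓢(ℝ, ℂ) →L[ℂ] 𝓢(ℝ, ℂ) :=
  ((1 / h : ℝ) : ℂ) • (dilation (1 / h) ∘L FourierTransform.fourierCLM ℂ 𝓢(ℝ, ℂ))

theorem hFourier_apply {h : ℝ} (hh : h ≠ 0) (f : 𝓢(ℝ, ℂ)) (ξ : ℝ) :
    hFourier h f ξ =
      1 / h * ∫ x : ℝ, Complex.exp (-(2 * Complex.I * Real.pi * (x * ξ) / h)) * f x := by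
  have h1 : (1 / h) ≠ 0 := one_div_ne_zero hh
  simp only [hFourier, smul_apply, ContinuousLinearMap.comp_apply,
    smul_apply, dilation_apply h1, smul_eq_mul, FourierTransform.fourierCLM_apply]
  rw [SchwartzMap.fourier_coe, Real.fourier_real_eq_integral_exp_smul]
  push_cast
  congr 1
  refine integral_congr_ae (Filter.Eventually.of_forall fun x => ?_)
  simp only [smul_eq_mul]
  congr 2
  ring

/-- The metaplectic operator `M̂` with parameter `h` of a matrix `M = !![a, b; c, d]` of
determinant `1` with `a > 0`, on the Schwartz space; see `metaplectic_apply`. -/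
def metaplectic (h : ℝ) (M : Matrix (Fin 2) (Fin 2) ℝ) : 𝓢(ℝ, ℂ) →L[ℂ] 𝓢(ℝ, ℂ) :=
  ((1 / Real.sqrt (M 0 0) : ℝ) : ℂ) •
    (chirp (M 1 0 / (M 0 0 * h)) ∘L dilation (1 / (M 0 0 * h)) ∘L
      FourierTransform.fourierInvCLM ℂ 𝓢(ℝ, ℂ) ∘L chirp (-(M 0 1 / (M 0 0 * h))) ∘L hFourier h)

/-- The action `S(x, ξ) = (c x² - b ξ² + 2 x ξ) / (2 a)` of the matrix `!![a, b; c, d]`. -/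
def action (M : Matrix (Fin 2) (Fin 2) ℝ) (x ξ : ℝ) : ℝ :=
  1 / (2 * M 0 0) * (M 1 0 * x ^ 2 - M 0 1 * ξ ^ 2 + 2 * x * ξ)

theorem metaplectic_apply {h : ℝ} (hh : h ≠ 0) {M : Matrix (Fin 2) (Fin 2) ℝ} (hM : M 0 0 ≠ 0)
    (f : 𝓢(ℝ, ℂ)) (x : ℝ) :
    metaplectic h M f x = ((1 / Real.sqrt (M 0 0) : ℝ) : ℂ) *
      ∫ ξ : ℝ, Complex.exp (2 * Real.pi * Complex.I * action M x ξ / h) * hFourier h f ξ := by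
  have h1 : 1 / (M 0 0 * h) ≠ 0 := one_div_ne_zero (mul_ne_zero hM hh)
  simp only [metaplectic, smul_apply, ContinuousLinearMap.comp_apply,
    smul_apply, chirp_apply, dilation_apply h1, smul_eq_mul,
    FourierTransform.fourierInvCLM_apply]
  rw [SchwartzMap.fourierInv_coe, Real.fourierInv_eq', ← integral_const_mul]
  congr 1
  refine integral_congr_ae (Filter.Eventually.of_forall fun ξ => ?_)
  simp only [smul_eq_mul, chirp_apply]
  rw [← mul_assoc, ← mul_assoc, ← Complex.exp_add, ← Complex.exp_add]
  congr 2
  have hM' : (M 0 0 : ℂ) ≠ 0 := by exact_mod_cast hM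
  have hh' : (h : ℂ) ≠ 0 := by exact_mod_cast hh
  unfold action
  simp only [RCLike.inner_apply, conj_trivial]
  push_cast
  field_simp
  ring

/-- The wave packet centred at position `q` and momentum `p`; see `wavePacket_apply`. -/
def wavePacket (h : ℝ) (hh : 0 < h) (q p : ℝ) : 𝓢(ℝ, ℂ) :=
  (((2 / h) ^ (1 / 4 : ℝ) : ℝ) : ℂ) •
    SchwartzMap.compSubConstCLM ℂ q (SchwartzMap.smulLeftCLM ℂ (planeWave (p / h))
      (gaussSchwartz ((1 / h : ℝ) : ℂ) (by simpa using hh)))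

theorem wavePacket_apply {h : ℝ} (hh : 0 < h) (q p x : ℝ) :
    wavePacket h hh q p x = (((2 / h) ^ (1 / 4 : ℝ) : ℝ) : ℂ) *
      Complex.exp (2 * Complex.I * Real.pi * p * (x - q) / h) *
        Complex.exp (-(Real.pi * (x - q) ^ 2 / h)) := by
  simp only [wavePacket, smul_apply, SchwartzMap.compSubConstCLM_apply,
    SchwartzMap.smulLeftCLM_apply_apply (planeWave_hasTemperateGrowth _), smul_eq_mul]
  rw [mul_assoc]
  congr 1
  change planeWave _ _ * gauss _ _ = _
  unfold planeWave gauss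
  push_cast
  congr 2 <;> ring

/-- The wave packets have unit norm in `L²(ℝ)`. -/
theorem wavePacket_norm {h : ℝ} (hh : 0 < h) (q p : ℝ) :
    ∫ x : ℝ, ‖wavePacket h hh q p x‖ ^ 2 = 1 := by
  have h1 : ∀ x : ℝ, ‖wavePacket h hh q p x‖ ^ 2 =
      Real.sqrt (2 / h) * Real.exp (-(2 * Real.pi / h) * (x - q) ^ 2) := by
    intro x
    rw [wavePacket_apply, norm_mul, norm_mul, Complex.norm_real, Complex.norm_exp,
      Complex.norm_exp, Real.norm_of_nonneg (by positivity), mul_pow, mul_pow, ← Real.exp_nat_mul,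
      ← Real.exp_nat_mul, ← Real.rpow_mul_natCast (by positivity), Real.sqrt_eq_rpow, mul_assoc,
      ← Real.exp_add]
    congr 2
    · norm_num
    · simp [← Complex.ofReal_sub, ← Complex.ofReal_pow, ← Complex.ofReal_mul,
        ← Complex.ofReal_div]
      ring
  simp_rw [h1]
  rw [integral_const_mul, integral_sub_right_eq_self (fun x => Real.exp (-(2 * Real.pi / h) * x ^ 2)),
    integral_gaussian, ← Real.sqrt_mul (by positivity)]
  rw [Real.sqrt_eq_one]
  have := Real.pi_pos
  field_simp

/-! ### Convergence of the symmetrization -/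

theorem seminorm_mul_shift (φ : 𝓢(ℝ, ℂ)) (k n : ℕ) :
    ∃ C : ℝ, 0 ≤ C ∧ ∀ (f : 𝓢(ℝ, ℂ)) (a : ℝ),
      SchwartzMap.seminorm ℂ k n
        (SchwartzMap.pairing (ContinuousLinearMap.mul ℂ ℂ) (SchwartzMap.compSubConstCLM ℂ a φ) f) ≤
      C * ((1 + |a|) ^ 2)⁻¹ *
        ((Finset.Iic (k + 2, n)).sup (schwartzSeminormFamily ℂ ℝ ℂ)) f := by
  set A : ℝ := 2 ^ 2 * ((Finset.Iic (2, n)).sup fun m => SchwartzMap.seminorm ℂ m.1 m.2) φ with hA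
  have hA0 : 0 ≤ A := by positivity
  refine ⟨2 ^ n * A * 2 ^ (k + 2), by positivity, fun f a => ?_⟩
  set B : ℝ := ((Finset.Iic (k + 2, n)).sup (schwartzSeminormFamily ℂ ℝ ℂ)) f with hB
  have hB0 : 0 ≤ B := apply_nonneg _ _
  refine SchwartzMap.seminorm_le_bound ℂ k n _ (by positivity) fun x => ?_
  have hg : (⇑(SchwartzMap.pairing (ContinuousLinearMap.mul ℂ ℂ)
      (SchwartzMap.compSubConstCLM ℂ a φ) f) : ℝ → ℂ) = fun x => φ (x - a) * f x := rfl
  rw [hg]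
  have hφ : ContDiff ℝ n (fun x : ℝ => φ (x - a)) :=
    (φ.smooth n).comp (contDiff_id.sub contDiff_const)
  have hL := norm_iteratedFDeriv_mul_le hφ (f.smooth n) x (le_refl _)
  have ha : 0 ≤ |a| := abs_nonneg a
  have hx : 0 ≤ ‖x‖ := norm_nonneg x
  have hxa : 0 ≤ ‖x - a‖ := norm_nonneg _
  have key : ∀ i ∈ Finset.range (n + 1),
      ‖x‖ ^ k * ((n.choose i : ℝ) * ‖iteratedFDeriv ℝ i (fun x : ℝ => φ (x - a)) x‖ *
        ‖iteratedFDeriv ℝ (n - i) f x‖) ≤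
      (n.choose i : ℝ) * (A * 2 ^ (k + 2) * ((1 + |a|) ^ 2)⁻¹ * B) := by
    intro i hi
    have hi' : i ≤ n := by simpa [Nat.lt_succ_iff] using hi
    rw [iteratedFDeriv_comp_sub]
    have h1 := SchwartzMap.one_add_le_sup_seminorm_apply (𝕜 := ℂ) (m := (2, n)) (k := 2) (n := i)
      le_rfl hi' φ (x - a)
    have h2 := SchwartzMap.one_add_le_sup_seminorm_apply (𝕜 := ℂ) (m := (k + 2, n)) (k := k + 2)
      (n := n - i) le_rfl (Nat.sub_le _ _) f x
    set u := ‖iteratedFDeriv ℝ i φ (x - a)‖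
    set v := ‖iteratedFDeriv ℝ (n - i) f x‖
    have hu : 0 ≤ u := norm_nonneg _
    have hv : 0 ≤ v := norm_nonneg _
    have h3 : (1 + |a|) ≤ (1 + ‖x - a‖) * (1 + ‖x‖) := by
      have : |a| ≤ ‖x - a‖ + ‖x‖ := by
        have := norm_sub_le x (x - a)
        rw [sub_sub_cancel] at this
        rw [← Real.norm_eq_abs]; linarith
      nlinarith
    have h4 : (1 + |a|) ^ 2 * (‖x‖ ^ k * (u * v)) ≤ A * (2 ^ (k + 2) * B) := by
      calc (1 + |a|) ^ 2 * (‖x‖ ^ k * (u * v))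
          ≤ ((1 + ‖x - a‖) * (1 + ‖x‖)) ^ 2 * ((1 + ‖x‖) ^ k * (u * v)) := by
            gcongr; linarith
        _ = ((1 + ‖x - a‖) ^ 2 * u) * ((1 + ‖x‖) ^ (k + 2) * v) := by ring
        _ ≤ A * (2 ^ (k + 2) * B) := by
            exact mul_le_mul h1 h2 (by positivity) hA0
    calc _ = (n.choose i : ℝ) * (((1 + |a|) ^ 2)⁻¹ * ((1 + |a|) ^ 2 * (‖x‖ ^ k * (u * v)))) := by
          field_simp
      _ ≤ (n.choose i : ℝ) * (((1 + |a|) ^ 2)⁻¹ * (A * (2 ^ (k + 2) * B))) := by gcongr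
      _ = _ := by ring
  calc _ ≤ ‖x‖ ^ k * ∑ i ∈ Finset.range (n + 1), (n.choose i : ℝ) *
        ‖iteratedFDeriv ℝ i (fun x : ℝ => φ (x - a)) x‖ * ‖iteratedFDeriv ℝ (n - i) f x‖ := by
        gcongr
    _ ≤ ∑ i ∈ Finset.range (n + 1),
        (n.choose i : ℝ) * (A * 2 ^ (k + 2) * ((1 + |a|) ^ 2)⁻¹ * B) := by
        rw [Finset.mul_sum]; exact Finset.sum_le_sum key
    _ = _ := by
        rw [← Finset.sum_mul]
        have : (∑ i ∈ Finset.range (n + 1), (n.choose i : ℝ)) = 2 ^ n := by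
          exact_mod_cast Nat.sum_range_choose n
        rw [this]; ring

theorem fourier_decay :
    ∃ (s : Finset (ℕ × ℕ)) (C : ℝ), 0 ≤ C ∧ ∀ (g : 𝓢(ℝ, ℂ)) (ξ : ℝ),
      (1 + |ξ|) ^ 2 * ‖𝓕 (g : ℝ → ℂ) ξ‖ ≤ C * (s.sup (schwartzSeminormFamily ℂ ℝ ℂ)) g := by
  have hq : Continuous ((((Finset.Iic ((2, 0) : ℕ × ℕ)).sup
      (schwartzSeminormFamily ℂ ℝ ℂ)).comp
        (FourierTransform.fourierCLM ℂ 𝓢(ℝ, ℂ)).toLinearMap : Seminorm ℂ 𝓢(ℝ, ℂ))) := by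
    have h1 : Continuous ((Finset.Iic ((2, 0) : ℕ × ℕ)).sup (schwartzSeminormFamily ℂ ℝ ℂ) :
        Seminorm ℂ 𝓢(ℝ, ℂ)) := by
      exact Seminorm.continuous_finsetSup fun i _ =>
        (schwartz_withSeminorms ℂ ℝ ℂ).continuous_seminorm i
    exact h1.comp (FourierTransform.fourierCLM ℂ 𝓢(ℝ, ℂ)).continuous
  obtain ⟨s, C, -, hC⟩ := Seminorm.bound_of_continuous (schwartz_withSeminorms ℂ ℝ ℂ) _ hq
  refine ⟨s, 4 * C, by positivity, fun g ξ => ?_⟩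
  have h2 := SchwartzMap.one_add_le_sup_seminorm_apply (𝕜 := ℂ) (m := (2, 0)) (k := 2) (n := 0)
      le_rfl le_rfl (𝓕 g) ξ
  have h3 := hC g
  simp only [Seminorm.comp_apply, smul_apply] at h3
  rw [norm_iteratedFDeriv_zero, SchwartzMap.fourier_coe] at h2
  calc _ ≤ _ := h2
    _ ≤ 2 ^ 2 * ((C • (s.sup (schwartzSeminormFamily ℂ ℝ ℂ))) g) := by gcongr; exact h3
    _ = _ := by
      change (2 : ℝ) ^ 2 * (C * _) = _
      ring

/-- The bilinear pairing `∫ T̂_{(k₁,k₂)} φ · f` of an integer translate of `φ` with `f`. -/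
def translatePairing (h : ℝ) (φ f : 𝓢(ℝ, ℂ)) (k : ℤ × ℤ) : ℂ :=
  ∫ x : ℝ, translation h k.1 k.2 φ x * f x

theorem translatePairing_bound {h : ℝ} (h0 : 0 < h) (h1 : h ≤ 1) (φ : 𝓢(ℝ, ℂ)) :
    ∃ (s : Finset (ℕ × ℕ)) (C : ℝ), 0 ≤ C ∧ ∀ (f : 𝓢(ℝ, ℂ)) (k : ℤ × ℤ),
      ‖translatePairing h φ f k‖ ≤ C * (s.sup (schwartzSeminormFamily ℂ ℝ ℂ)) f *
        (((1 + |(k.1 : ℝ)|) ^ 2)⁻¹ * ((1 + |(k.2 : ℝ)|) ^ 2)⁻¹) := by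
  obtain ⟨s, C, hC, hF⟩ := fourier_decay
  choose D hD0 hD using seminorm_mul_shift φ
  set t : Finset (ℕ × ℕ) := s.biUnion fun m => Finset.Iic (m.1 + 2, m.2) with ht
  set E : ℝ := ∑ m ∈ s, D m.1 m.2 with hE
  have hE0 : 0 ≤ E := Finset.sum_nonneg fun m _ => hD0 _ _
  refine ⟨t, C * E, by positivity, fun f k => ?_⟩
  set g : 𝓢(ℝ, ℂ) := SchwartzMap.pairing (ContinuousLinearMap.mul ℂ ℂ)
    (SchwartzMap.compSubConstCLM ℂ (k.1 : ℝ) φ) f with hg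
  have e1 : translatePairing h φ f k =
      Complex.exp (-(Complex.I * Real.pi / h * ((k.1 : ℝ) * (k.2 : ℝ)))) *
        𝓕 (g : ℝ → ℂ) (-(k.2 / h)) := by
    unfold translatePairing
    rw [Real.fourier_real_eq_integral_exp_smul, ← integral_const_mul]
    refine integral_congr_ae (Filter.Eventually.of_forall fun x => ?_)
    have hgx : g x = φ (x - k.1) * f x := rfl
    simp only [translation_apply, hgx, smul_eq_mul]
    rw [mul_assoc, mul_assoc]
    congr 3
    push_cast
    ring
  have e2 : ‖translatePairing h φ f k‖ = ‖𝓕 (g : ℝ → ℂ) (-(k.2 / h))‖ := by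
    rw [e1, norm_mul]
    have : ‖Complex.exp (-(Complex.I * Real.pi / h * ((k.1 : ℝ) * (k.2 : ℝ))))‖ = 1 := by
      have : -(Complex.I * Real.pi / h * ((k.1 : ℝ) * (k.2 : ℝ))) =
          ((-(Real.pi / h * (k.1 * k.2)) : ℝ) : ℂ) * Complex.I := by push_cast; ring
      rw [this, Complex.norm_exp_ofReal_mul_I]
    rw [this, one_mul]
  set P : ℝ := (t.sup (schwartzSeminormFamily ℂ ℝ ℂ)) f with hP
  have hP0 : 0 ≤ P := apply_nonneg _ _
  have h3 : (s.sup (schwartzSeminormFamily ℂ ℝ ℂ)) g ≤ E * ((1 + |(k.1 : ℝ)|) ^ 2)⁻¹ * P := by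
    refine Seminorm.finset_sup_apply_le (by positivity) fun m hm => ?_
    refine (hD m.1 m.2 f k.1).trans ?_
    have a1 : D m.1 m.2 ≤ E :=
      Finset.single_le_sum (f := fun m : ℕ × ℕ => D m.1 m.2) (fun m _ => hD0 _ _) hm
    have a2 : ((Finset.Iic (m.1 + 2, m.2)).sup (schwartzSeminormFamily ℂ ℝ ℂ)) f ≤ P := by
      have : Finset.Iic (m.1 + 2, m.2) ⊆ t :=
        Finset.subset_biUnion_of_mem (fun m : ℕ × ℕ => Finset.Iic (m.1 + 2, m.2)) hm
      exact Finset.sup_mono (f := schwartzSeminormFamily ℂ ℝ ℂ) this f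
    gcongr
  have h4 : (1 + |(k.2 : ℝ)|) ^ 2 ≤ (1 + |(-(k.2 / h) : ℝ)|) ^ 2 := by
    have : |(k.2 : ℝ)| ≤ |(-(k.2 / h) : ℝ)| := by
      rw [abs_neg, abs_div, abs_of_pos h0]
      rw [le_div_iff₀ h0]
      exact mul_le_of_le_one_right (abs_nonneg _) h1
    gcongr
  have h5 := hF g (-(k.2 / h))
  rw [e2]
  have hk : 0 < (1 + |(k.2 : ℝ)|) ^ 2 := by positivity
  calc _ = ((1 + |(k.2 : ℝ)|) ^ 2)⁻¹ * ((1 + |(k.2 : ℝ)|) ^ 2 *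
        ‖𝓕 (g : ℝ → ℂ) (-(k.2 / h))‖) := by field_simp
    _ ≤ ((1 + |(k.2 : ℝ)|) ^ 2)⁻¹ * (C * (E * ((1 + |(k.1 : ℝ)|) ^ 2)⁻¹ * P)) := by
        refine mul_le_mul_of_nonneg_left ?_ (by positivity)
        calc _ ≤ (1 + |(-(k.2 / h) : ℝ)|) ^ 2 * ‖𝓕 (g : ℝ → ℂ) (-(k.2 / h))‖ := by gcongr
          _ ≤ _ := h5
          _ ≤ _ := by gcongr
    _ = _ := by ring

theorem summable_weight : Summable fun k : ℤ × ℤ =>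
    (((1 + |(k.1 : ℝ)|) ^ 2)⁻¹ * ((1 + |(k.2 : ℝ)|) ^ 2)⁻¹) := by
  have h1 : Summable fun k : ℤ => ((1 + |(k : ℝ)|) ^ 2)⁻¹ := by
    have h2 : Summable fun n : ℕ => ((1 + (n : ℝ)) ^ 2)⁻¹ := by
      have := (summable_nat_add_iff 1).mpr (Real.summable_nat_pow_inv.mpr (one_lt_two))
      refine this.congr fun n => ?_
      push_cast; ring
    refine Summable.of_nat_of_neg ?_ ?_
    · simpa using h2
    · simpa using h2
  exact h1.mul_of_nonneg h1 (fun _ => by positivity) (fun _ => by positivity)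

theorem translatePairing_summable {h : ℝ} (h0 : 0 < h) (h1 : h ≤ 1) (φ f : 𝓢(ℝ, ℂ)) :
    Summable (translatePairing h φ f) := by
  obtain ⟨s, C, -, hC⟩ := translatePairing_bound h0 h1 φ
  exact Summable.of_norm_bounded (summable_weight.mul_left _) (hC f)

/-! ### The quantum torus space -/

/-- The semiclassical parameter `h = 1 / N`. -/
def planck (N : ℕ) : ℝ := 1 / N

theorem planck_pos (N : ℕ) [NeZero N] : 0 < planck N := by
  have : 0 < N := Nat.pos_of_ne_zero (NeZero.ne N)
  unfold planck
  positivity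

theorem planck_le_one (N : ℕ) [NeZero N] : planck N ≤ 1 := by
  have : 1 ≤ N := Nat.pos_of_ne_zero (NeZero.ne N)
  unfold planck
  rw [div_le_one (by positivity)]
  exact_mod_cast this

/-- The space `ℋ^h`, `h = 1 / N`, of tempered distributions that are invariant under the quantum
translations `T̂_{(1,0)}` and `T̂_{(0,1)}`. -/
def torusSpace (N : ℕ) : Submodule ℂ 𝓢'(ℝ, ℂ) where
  carrier := {D | (∀ f, D (translation (planck N) 1 0 f) = D f) ∧
    ∀ f, D (translation (planck N) 0 1 f) = D f}
  add_mem' := by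
    rintro D E ⟨h1, h2⟩ ⟨h3, h4⟩
    exact ⟨fun f => congrArg₂ (· + ·) (h1 f) (h3 f), fun f => congrArg₂ (· + ·) (h2 f) (h4 f)⟩
  zero_mem' := ⟨fun _ => rfl, fun _ => rfl⟩
  smul_mem' := by
    rintro c D ⟨h1, h2⟩
    exact ⟨fun f => congrArg (c * ·) (h1 f), fun f => congrArg (c * ·) (h2 f)⟩

/-- The symmetrization `f ↦ ∑ k, ∫ T̂_k φ · f`, as a continuous functional. -/
def symmCLM (N : ℕ) [NeZero N] (φ : 𝓢(ℝ, ℂ)) : 𝓢(ℝ, ℂ) →L[ℂ] ℂ :=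
  SchwartzMap.mkCLMtoNormedSpace (σ := RingHom.id ℂ)
    (fun f => ∑' k : ℤ × ℤ, translatePairing (planck N) φ f k)
    (by
      intro f g
      rw [← (translatePairing_summable (planck_pos N) (planck_le_one N) φ f).tsum_add
        (translatePairing_summable (planck_pos N) (planck_le_one N) φ g)]
      congr 1
      ext k
      unfold translatePairing
      rw [← integral_add]
      · simp [mul_add]
      · exact (SchwartzMap.pairing (ContinuousLinearMap.mul ℂ ℂ)
          (translation (planck N) k.1 k.2 φ) f).integrable
      · exact (SchwartzMap.pairing (ContinuousLinearMap.mul ℂ ℂ)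
          (translation (planck N) k.1 k.2 φ) g).integrable)
    (by
      intro c f
      rw [RingHom.id_apply, smul_eq_mul, ← tsum_mul_left]
      congr 1
      ext k
      unfold translatePairing
      rw [← integral_const_mul]
      congr 1
      ext x
      simp
      ring)
    (by
      obtain ⟨s, C, hC, h⟩ := translatePairing_bound (planck_pos N) (planck_le_one N) φ
      refine ⟨s, C * ∑' k : ℤ × ℤ, (((1 + |(k.1 : ℝ)|) ^ 2)⁻¹ * ((1 + |(k.2 : ℝ)|) ^ 2)⁻¹),
        mul_nonneg hC (tsum_nonneg fun _ => by positivity), fun f => ?_⟩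
      refine (tsum_of_norm_bounded (summable_weight.mul_left _).hasSum (h f)).trans ?_
      rw [tsum_mul_left]
      exact le_of_eq (by ring))

theorem symmCLM_apply (N : ℕ) [NeZero N] (φ f : 𝓢(ℝ, ℂ)) :
    symmCLM N φ f = ∑' k : ℤ × ℤ, translatePairing (planck N) φ f k := rfl

theorem exp_even (N : ℕ) [Fact (Even N)] (k : ℤ) :
    Complex.exp (Complex.I * Real.pi * N * k) = 1 := by
  obtain ⟨m, hm⟩ := (Fact.out : Even N)
  rw [Complex.exp_eq_one_iff]
  refine ⟨m * k, ?_⟩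
  rw [hm]
  push_cast
  ring

/-- For integer translations the phase factor is trivial, since `1 / h` is even. -/
theorem translation_int (N : ℕ) [Fact (Even N)] (k l : ℤ) (u : 𝓢(ℝ, ℂ)) (x : ℝ) :
    translation (planck N) k l u x =
      Complex.exp (2 * Complex.I * Real.pi * N * (l * x)) * u (x - k) := by
  rw [translation_apply]
  have h1 : Complex.exp (-(Complex.I * Real.pi / (planck N : ℝ) * ((k : ℝ) * (l : ℝ)))) = 1 := by
    rw [← exp_even N (-(k * l))]
    unfold planck
    push_cast
    congr 1
    rw [div_div_eq_mul_div]
    ring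
  rw [h1, one_mul]
  congr 2
  unfold planck
  push_cast
  rw [div_div_eq_mul_div]
  ring

/-- The symmetrization `Σ^h φ = ∑_{k ∈ ℤ²} T̂_k φ` of a Schwartz function, an element of `ℋ^h`. -/
def symm (N : ℕ) [NeZero N] [Fact (Even N)] (φ : 𝓢(ℝ, ℂ)) : torusSpace N :=
  ⟨(symmCLM N φ).toPointwiseConvergenceCLM _ _ _ _, by
    constructor
    · intro f
      change symmCLM N φ _ = symmCLM N φ _
      rw [symmCLM_apply, symmCLM_apply,
        ← (Equiv.addRight ((1, 0) : ℤ × ℤ)).tsum_eq (translatePairing (planck N) φ _)]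
      congr 1
      ext k
      unfold translatePairing
      rw [← integral_add_right_eq_self _ (1 : ℝ)]
      congr 1
      ext x
      have e1 := translation_int N 1 0 f (x + 1)
      simp only [Int.cast_one, Int.cast_zero] at e1
      rw [e1]
      simp only [Equiv.coe_addRight, translation_int, Prod.fst_add, Prod.snd_add, add_zero]
      have e2 : Complex.exp (2 * Complex.I * Real.pi * N * (k.2 * ((x + 1 : ℝ) : ℂ))) =
          Complex.exp (2 * Complex.I * Real.pi * N * (k.2 * x)) := by
        have e3 : 2 * Complex.I * Real.pi * N * (k.2 * ((x + 1 : ℝ) : ℂ)) =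
            2 * Complex.I * Real.pi * N * (k.2 * x) +
              Complex.I * Real.pi * N * ((2 * k.2 : ℤ) : ℂ) := by
          push_cast
          ring
        rw [e3, Complex.exp_add, exp_even, mul_one]
      rw [e2]
      push_cast
      simp
    · intro f
      change symmCLM N φ _ = symmCLM N φ _
      rw [symmCLM_apply, symmCLM_apply,
        ← (Equiv.addRight ((0, 1) : ℤ × ℤ)).tsum_eq (translatePairing (planck N) φ f)]
      congr 1
      ext k
      unfold translatePairing
      congr 1
      ext x
      have e1 := translation_int N 0 1 f x
      simp only [Int.cast_one, Int.cast_zero] at e1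
      rw [e1]
      simp only [Equiv.coe_addRight, translation_int, Prod.fst_add, Prod.snd_add, add_zero]
      have e2 : Complex.exp (2 * Complex.I * Real.pi * N * (((k.2 + 1 : ℤ) : ℂ) * x)) =
          Complex.exp (2 * Complex.I * Real.pi * N * (k.2 * x)) *
            Complex.exp (2 * Complex.I * Real.pi * N * (1 * x)) := by
        rw [← Complex.exp_add]
        congr 1
        push_cast
        ring
      rw [e2]
      simp
      ring⟩

theorem symm_apply (N : ℕ) [NeZero N] [Fact (Even N)] (φ f : 𝓢(ℝ, ℂ)) :
    (symm N φ : 𝓢'(ℝ, ℂ)) f = ∑' k : ℤ × ℤ, ∫ x : ℝ, translation (planck N) k.1 k.2 φ x * f x :=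
  rfl

/-- A Schwartz function `φ` with `Σ^h φ = D`. -/
def representative (N : ℕ) [NeZero N] [Fact (Even N)] (D : torusSpace N) : 𝓢(ℝ, ℂ) :=
  Classical.epsilon fun φ => symm N φ = D

theorem symm_representative (N : ℕ) [NeZero N] [Fact (Even N)] (φ : 𝓢(ℝ, ℂ)) :
    symm N (representative N (symm N φ)) = symm N φ :=
  Classical.epsilon_spec (p := fun ψ => symm N ψ = symm N φ) ⟨φ, rfl⟩

/-- The Hermitian product of `L²(ℝ)`, linear in the first variable. -/
def inner2 (f g : 𝓢(ℝ, ℂ)) : ℂ := ∫ x : ℝ, f x * conj (g x)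

/-- The Hermitian product of `ℋ^h`: if `D₁ = Σ^h φ₁` and `D₂ = Σ^h φ₂`, it is
`∑_{k ∈ ℤ²} ⟨T̂_k φ₁, φ₂⟩`. By `torusInner_symm` it does not depend on `φ₁` and `φ₂`. -/
def torusInner (N : ℕ) [NeZero N] [Fact (Even N)] (D₁ D₂ : torusSpace N) : ℂ :=
  ∑' k : ℤ × ℤ,
    inner2 (translation (planck N) k.1 k.2 (representative N D₁)) (representative N D₂)

/-- Complex conjugation of Schwartz functions. -/
def conjSchwartz (f : 𝓢(ℝ, ℂ)) : 𝓢(ℝ, ℂ) :=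
  SchwartzMap.postcompCLM (𝕜 := ℝ) (Complex.conjCLE : ℂ →L[ℝ] ℂ) f

theorem conjSchwartz_apply (f : 𝓢(ℝ, ℂ)) (x : ℝ) : conjSchwartz f x = conj (f x) := rfl

theorem tsum_inner2 (N : ℕ) [NeZero N] [Fact (Even N)] (φ ψ : 𝓢(ℝ, ℂ)) :
    ∑' k : ℤ × ℤ, inner2 (translation (planck N) k.1 k.2 φ) ψ =
      (symm N φ : 𝓢'(ℝ, ℂ)) (conjSchwartz ψ) := rfl

theorem tsum_inner2_symm (N : ℕ) [NeZero N] [Fact (Even N)] (φ ψ : 𝓢(ℝ, ℂ)) :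
    (symm N φ : 𝓢'(ℝ, ℂ)) (conjSchwartz ψ) = conj ((symm N ψ : 𝓢'(ℝ, ℂ)) (conjSchwartz φ)) := by
  rw [symm_apply, symm_apply, Complex.conj_tsum, ← (Equiv.neg (ℤ × ℤ)).tsum_eq]
  congr 1
  ext k
  rw [← integral_conj]
  rw [← integral_sub_right_eq_self _ (k.1 : ℝ)]
  congr 1
  ext x
  simp only [Equiv.neg_apply, Prod.fst_neg, Prod.snd_neg, translation_int, conjSchwartz_apply,
    map_mul, Complex.conj_conj, ← Complex.exp_conj]
  have e := exp_even N (2 * (k.1 * k.2))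
  have e2 : Complex.exp (2 * Complex.I * Real.pi * N * (((-k.2 : ℤ) : ℂ) * ((x - k.1 : ℝ) : ℂ))) =
      Complex.exp (conj (2 * Complex.I * Real.pi * N * (k.2 * x))) := by
    rw [← mul_one (Complex.exp (conj _)), ← e, ← Complex.exp_add]
    congr 1
    push_cast
    simp only [map_mul, Complex.conj_I, Complex.conj_ofReal, map_natCast, map_ofNat, map_intCast]
    ring
  rw [e2]
  push_cast
  simp
  ring

theorem torusInner_symm (N : ℕ) [NeZero N] [Fact (Even N)] (φ ψ : 𝓢(ℝ, ℂ)) :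
    torusInner N (symm N φ) (symm N ψ) =
      ∑' k : ℤ × ℤ, inner2 (translation (planck N) k.1 k.2 φ) ψ := by
  unfold torusInner
  rw [tsum_inner2, symm_representative, tsum_inner2_symm, symm_representative, tsum_inner2,
    tsum_inner2_symm N φ ψ]

/-! ### The quantum cat map on the torus space -/

/-- The matrix of the cat map. -/
def catMatrix : Matrix (Fin 2) (Fin 2) ℝ := !![2, 1; 1, 1]

/-- The quantum cat map `M̂^h` on Schwartz functions, `h = 1 / N`. -/
def catOperator (N : ℕ) : 𝓢(ℝ, ℂ) →L[ℂ] 𝓢(ℝ, ℂ) := metaplectic (planck N) catMatrix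

/-- The quantum cat map on `ℋ^h`: if `D = Σ^h φ`, it maps `D` to `Σ^h (M̂^h φ)`. By
`torusOperator_symm` this does not depend on `φ`. -/
def torusOperator (N : ℕ) [NeZero N] [Fact (Even N)] (D : torusSpace N) : torusSpace N :=
  symm N (catOperator N (representative N D))

theorem hFourier_translation {h : ℝ} (hh : h ≠ 0) (u w : ℝ) (f : 𝓢(ℝ, ℂ)) (ξ : ℝ) :
    hFourier h (translation h u w f) ξ =
      Complex.exp (Complex.I * Real.pi / h * (u * w - 2 * u * ξ)) * hFourier h f (ξ - w) := by
  have hh' : (h : ℂ) ≠ 0 := by exact_mod_cast hh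
  rw [hFourier_apply hh, hFourier_apply hh, mul_left_comm]
  congr 1
  rw [← integral_const_mul, ← integral_add_right_eq_self _ u]
  congr 1
  ext x
  rw [translation_apply, add_sub_cancel_right, ← mul_assoc, ← mul_assoc,
    ← mul_assoc (Complex.exp _) (Complex.exp _) (f x), ← Complex.exp_add, ← Complex.exp_add, ← Complex.exp_add]
  congr 2
  push_cast
  field_simp
  ring

/-- The exact intertwining relation `M̂ T̂_v = T̂_{Mv} M̂`. -/
theorem metaplectic_translation {h : ℝ} (hh : h ≠ 0) {M : Matrix (Fin 2) (Fin 2) ℝ}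
    (hM : M 0 0 ≠ 0) (hdet : M 0 0 * M 1 1 - M 0 1 * M 1 0 = 1) (u w : ℝ) (f : 𝓢(ℝ, ℂ)) :
    metaplectic h M (translation h u w f) =
      translation h (M 0 0 * u + M 0 1 * w) (M 1 0 * u + M 1 1 * w) (metaplectic h M f) := by
  have hh' : (h : ℂ) ≠ 0 := by exact_mod_cast hh
  have hM' : (M 0 0 : ℂ) ≠ 0 := by exact_mod_cast hM
  have hd : M 1 1 = (1 + M 0 1 * M 1 0) / M 0 0 := by
    rw [eq_div_iff hM]; linarith
  ext x
  rw [metaplectic_apply hh hM, translation_apply, metaplectic_apply hh hM, mul_left_comm]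
  congr 1
  rw [← integral_const_mul, ← integral_add_right_eq_self _ w]
  congr 1
  ext ξ
  rw [hFourier_translation hh, add_sub_cancel_right, ← mul_assoc, ← mul_assoc,
    ← Complex.exp_add, ← Complex.exp_add, ← Complex.exp_add]
  congr 2
  unfold action
  rw [hd]
  push_cast
  field_simp
  ring

/-- `B` is a transpose of `A` for the bilinear pairing of Schwartz functions. -/
def HasTranspose (A : 𝓢(ℝ, ℂ) → 𝓢(ℝ, ℂ)) : Prop :=
  ∃ B : 𝓢(ℝ, ℂ) → 𝓢(ℝ, ℂ), ∀ φ f : 𝓢(ℝ, ℂ), ∫ x : ℝ, A φ x * f x = ∫ x : ℝ, φ x * B f x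

theorem HasTranspose.comp {A₁ A₂ : 𝓢(ℝ, ℂ) → 𝓢(ℝ, ℂ)} (h₁ : HasTranspose A₁)
    (h₂ : HasTranspose A₂) : HasTranspose (fun φ => A₁ (A₂ φ)) := by
  obtain ⟨B₁, h₁⟩ := h₁
  obtain ⟨B₂, h₂⟩ := h₂
  exact ⟨fun f => B₂ (B₁ f), fun φ f => by rw [h₁, h₂]⟩

theorem hasTranspose_smul (c : ℂ) : HasTranspose (fun φ => c • φ) :=
  ⟨fun f => c • f, fun φ f => by
    congr 1
    ext x
    simp
    ring⟩

theorem hasTranspose_chirp (s : ℝ) : HasTranspose (chirp s) :=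
  ⟨chirp s, fun φ f => by
    congr 1
    ext x
    rw [chirp_apply, chirp_apply]
    ring⟩

theorem hasTranspose_dilation {s : ℝ} (hs : s ≠ 0) : HasTranspose (dilation s) :=
  ⟨fun f => ((|s⁻¹| : ℝ) : ℂ) • dilation s⁻¹ f, fun φ f => by
    have h1 := Measure.integral_comp_mul_left (fun y : ℝ => φ y * f (s⁻¹ * y)) s
    have h2 : ∀ x : ℝ, dilation s φ x * f x = φ (s * x) * f (s⁻¹ * (s * x)) := fun x => by
      rw [dilation_apply hs, inv_mul_cancel_left₀ hs]
    simp_rw [h2]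
    rw [h1, ← integral_smul]
    congr 1
    ext x
    simp only [smul_apply, dilation_apply (inv_ne_zero hs), Complex.real_smul, smul_eq_mul]
    ring⟩

theorem hasTranspose_fourier : HasTranspose (FourierTransform.fourierCLM ℂ 𝓢(ℝ, ℂ)) :=
  ⟨fun f => 𝓕 f, fun φ f => SchwartzMap.integral_fourier_mul_eq φ f⟩

theorem hasTranspose_fourierInv : HasTranspose (FourierTransform.fourierInvCLM ℂ 𝓢(ℝ, ℂ)) :=
  ⟨fun f => 𝓕⁻ f, fun φ f => SchwartzMap.integral_fourierInv_mul_eq φ f⟩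

theorem hasTranspose_metaplectic {h : ℝ} (hh : h ≠ 0) {M : Matrix (Fin 2) (Fin 2) ℝ}
    (hM : M 0 0 ≠ 0) : HasTranspose (metaplectic h M) :=
  (hasTranspose_smul _).comp ((hasTranspose_chirp _).comp
    ((hasTranspose_dilation (one_div_ne_zero (mul_ne_zero hM hh))).comp
      (hasTranspose_fourierInv.comp ((hasTranspose_chirp _).comp
        ((hasTranspose_smul _).comp
          ((hasTranspose_dilation (one_div_ne_zero hh)).comp hasTranspose_fourier))))))

/-- The action of the cat map on the lattice `ℤ²`. -/
def latticeCat : ℤ × ℤ ≃ ℤ × ℤ where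
  toFun k := (2 * k.1 + k.2, k.1 + k.2)
  invFun k := (k.1 - k.2, 2 * k.2 - k.1)
  left_inv k := by ext <;> simp <;> ring
  right_inv k := by ext <;> simp <;> ring

theorem torusOperator_symm (N : ℕ) [NeZero N] [Fact (Even N)] (φ : 𝓢(ℝ, ℂ)) :
    torusOperator N (symm N φ) = symm N (catOperator N φ) := by
  have hh : planck N ≠ 0 := (planck_pos N).ne'
  have hM : catMatrix 0 0 ≠ 0 := by simp [catMatrix]
  obtain ⟨B, hB⟩ := hasTranspose_metaplectic hh hM
  have key : ∀ ψ f : 𝓢(ℝ, ℂ), (symm N (catOperator N ψ) : 𝓢'(ℝ, ℂ)) f =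
      (symm N ψ : 𝓢'(ℝ, ℂ)) (B f) := by
    intro ψ f
    rw [symm_apply, symm_apply, ← latticeCat.tsum_eq]
    congr 1
    ext k
    rw [← hB]
    congr 1
    ext x
    rw [metaplectic_translation hh hM (by simp [catMatrix]; norm_num)]
    simp [catMatrix, latticeCat, catOperator]
  unfold torusOperator
  ext f
  rw [key, key, symm_representative]

/-- The wave packet centred at `(q, p)`, as an element of `ℋ^h`. -/
def torusPacket (N : ℕ) [NeZero N] [Fact (Even N)] (q p : ℝ) : torusSpace N :=
  symm N (wavePacket (planck N) (planck_pos N) q p)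

/-! ### The classical cat map and the parabolic dynamical system -/

/-- The eigenvalue `λ > 1` of the cat map. -/
def lam : ℝ := (3 + Real.sqrt 5) / 2

/-- The angle `θ` between the horizontal axis and the unstable line of the cat map. -/
def theta : ℝ := Real.arctan ((Real.sqrt 5 - 1) / 2)

theorem one_lt_lam : 1 < lam := by
  have := Real.sqrt_nonneg 5
  unfold lam
  linarith

theorem catMatrix_eigenvector :
    catMatrix.mulVec ![1, Real.tan theta] = lam • ![1, Real.tan theta] := by
  have h5 : Real.sqrt 5 ^ 2 = 5 := Real.sq_sqrt (by norm_num)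
  unfold theta lam catMatrix
  rw [Real.tan_arctan]
  ext i
  fin_cases i
  · simp
    ring
  · simp
    linarith

/-- The skew rotation `T_h (x, y) = (x + α, y + N x + β)` of the torus `𝕋²`, with `α = tan θ`,
`β = α N / 2` and `h = 1 / N`. -/
def skewRotation (N : ℕ) : Equiv.Perm (UnitAddCircle × UnitAddCircle) where
  toFun z := (z.1 + (Real.tan theta : UnitAddCircle),
    z.2 + N • z.1 + (Real.tan theta * N / 2 : ℝ))
  invFun z := (z.1 - (Real.tan theta : UnitAddCircle),
    z.2 - (Real.tan theta * N / 2 : ℝ) - N • (z.1 - (Real.tan theta : UnitAddCircle)))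
  left_inv z := by ext <;> simp
  right_inv z := by ext <;> simp

/-- The damped Birkhoff sum `S^χ_m(f)(z) = ∑_{k ∈ ℤ} χ(k / m) f(T^k z)`. -/
def birkhoffSum {X : Type*} (T : Equiv.Perm X) (χ : ℝ → ℂ) (m : ℝ) (f : X → ℂ) (z : X) : ℂ :=
  ∑' k : ℤ, χ (k / m) * f ((T ^ k) z)

/-- The signed distance on the circle `ℝ / ℤ`: the representative of `x - y` in
`(-1/2, 1/2]`. -/
def signedDist (x y : UnitAddCircle) : ℝ := (AddCircle.equivIoc (1 : ℝ) (-(1 / 2)) (x - y) : ℝ)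

/-- The Gaussian profile `F₀(u) = exp (-π cos² θ (1 + i tan θ) u²)`. -/
def profile (u : ℝ) : ℂ :=
  Complex.exp (-(Real.pi * Real.cos theta ^ 2 * (1 + Complex.I * Real.tan theta) * u ^ 2 : ℂ))

/-- The observable
`f_{q₀,p₀}(x, y) = F₀(d(x, s₀) / √h) exp (2 i π q₀ d(x, s₀) / h) exp (2 i π y)`, with
`s₀ = p₀ - q₀ tan θ`. -/
def observable (N : ℕ) (q₀ p₀ : ℝ) (z : UnitAddCircle × UnitAddCircle) : ℂ :=
  profile (signedDist z.1 (p₀ - q₀ * Real.tan theta : ℝ) / Real.sqrt (planck N)) *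
    Complex.exp (2 * Complex.I * Real.pi / planck N * q₀ *
      signedDist z.1 (p₀ - q₀ * Real.tan theta : ℝ)) *
    (AddCircle.toCircle z.2 : ℂ)

/-- The damping function `χ(u) = exp (-γ u²)` with `γ = π / (h cos² θ)`. -/
def damping (N : ℕ) (u : ℝ) : ℂ :=
  Complex.exp (-(Real.pi / (planck N * Real.cos theta ^ 2) * u ^ 2 : ℂ))

/-- The point `Mⁿ (a, b)` of `ℝ²`. -/
def catOrbit (n : ℕ) (a b : ℝ) : Fin 2 → ℝ := (catMatrix ^ n).mulVec ![a, b]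

/-- The phase of the coefficient of the Birkhoff sum. Here `(a', b') ∈ [0, 1)²` is the fractional
part of `Mⁿ (a, b)` and `(l₁, l₂) ∈ ℤ²` its integer part. -/
def phase (N n : ℕ) (a b q₀ p₀ : ℝ) : ℂ :=
  let l₁ : ℝ := ⌊catOrbit n a b 0⌋
  let l₂ : ℝ := ⌊catOrbit n a b 1⌋
  let a' : ℝ := Int.fract (catOrbit n a b 0)
  let b' : ℝ := Int.fract (catOrbit n a b 1)
  Complex.exp (Complex.I * Real.pi * N *
    ((l₁ * b' - l₂ * a' - a * b - a' * b' + Real.tan theta * a' ^ 2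
      + 2 * q₀ * p₀ - Real.tan theta * q₀ ^ 2 : ℝ) : ℂ))

/-- The main term `(D / √(λⁿ)) S^χ_{λⁿ}(f_{q₀,p₀})(s(a', b'), 0)`, where `s(a', b') = b' - a' tan θ`
and `D` is `√2` times `phase`. -/
def mainTerm (N n : ℕ) (a b q₀ p₀ : ℝ) : ℂ :=
  (Real.sqrt 2 * phase N n a b q₀ p₀) / Real.sqrt (lam ^ n) *
    birkhoffSum (skewRotation N) (damping N) (lam ^ n) (observable N q₀ p₀)
      (((Int.fract (catOrbit n a b 1) - Int.fract (catOrbit n a b 0) * Real.tan theta : ℝ) :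
        UnitAddCircle), 0)

end QuantumCat

end

/-!
Write `m = λⁿ` and `t = tan θ`. Quantization is exact for the linear map `M`. The coherent state
at the origin stays Gaussian, its complex width moving by Möbius transformations
(`catOperator_gauss`, `catOperator_iterate_wavePacket_zero`), and phase space translations are
intertwined exactly (`catOperator_iterate_translation`). The matrix element is therefore an explicit
Gaussian sum over `ℤ²` (`torusInner_eq_tsum`). Completing the square along the unstable line
(`overlap_exponent_eq`) writes its general term, up to the global phase, as
`e(N t k² / 2 + k ξ) · P(x₀ + k t + l) · R`, where `P` is the Gaussian profile of the observable seen
on the line (`packetProfile`) and the factor `R` (`overlapFactor`) is nearly the damping `χ(k / m)`.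
Summation over `l` periodizes `P`, and summation over `k` is a Birkhoff sum over the skew rotation,
whose orbit carries exactly this quadratic phase (`skewRotation_zpow_apply`).

Two differences remain. The first is `R - χ(k / m)`, of size `√N / m` on the support of the
Gaussians. The slope `t` is badly approximable, so a Gaussian sum over the lattice is bounded by the
area of the ellipse on which the Gaussian lives (`lattice_gaussian_sum`); since `m ≥ N` there are
`O(m / N)` effective terms, and the total is `O(√h)` (`norm_overlap_sum_sub_le`). With the prefactor
`√2 / √m` this is the term `C √h λ^(-n/2)`.

The second is the difference between the periodization of `P` and `P` of the signed distance. It is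
exponentially small in `N` but jumps at the point antipodal to `s₀`, and the Birkhoff sum is arbitrarily
long for fixed `N`, so a bound by absolute values would lose a factor `√m`. What saves the
estimate is square root cancellation in the quadratic exponential sums, with a loss that is only
polynomial in `N` (`norm_periodization_error_le`); the exponential then beats every power of `h`.

The cancellation for a function that is smooth up to one jump reduces to that for the sawtooth
`Int.fract x - 1 / 2`: a `C¹` function on `[0, 1]` is a superposition of indicators of intervals, and
an indicator is a difference of two sawtooths plus a constant (`norm_tsum_dampedPhase_fract_le`). The
sawtooth is smoothed at the scale `b` for which the sum has length `b⁻²`, which costs `O(b⁻¹)`, the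
number of orbit points near the jump, and is expanded in Fourier modes. The Birkhoff sum of the mode
`j` is the theta function `A(ξ + j t)`, with modulus `N t + i b⁴`. Bounding the modes one by one would
lose a logarithm of the length of the sum, since the coefficients decay like `1 / j`. However,
modes that differ by a multiple of `N` are cohomologous over the skew rotation: `A(ξ + j t)` depends
on `j` modulo `N` only, up to an explicit quadratic phase and a small error
(`norm_theta_add_int_mul_sub_le`). Only `N` theta functions occur, each multiplied by the sum of the
Fourier coefficients of the sawtooth over a residue class, twisted by a quadratic phase; and this sum
is bounded independently of the smoothing (`norm_tsum_sawCoeff_class_le`): `1 / j²` is the integral of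
`π exp (-π j² v)` over `v`, so the sum is an integrated difference of theta functions.

Both uses of theta functions rest on the bound `O(√N v^(-1/4))` at the modulus `α + i v`
(`norm_jacobiTheta₂_le`). The squared modulus of the theta function, summed along diagonals by Poisson
summation, is again a Gaussian sum over a lattice, with `α = ± N t` badly approximable.
-/

namespace QuantumCat

/-! ### Gaussian sums over the lattice -/

theorem hasSum_exp_neg_abs_int {b : ℝ} (hb : 0 < b) :
    HasSum (fun j : ℤ => Real.exp (-(b * |(j : ℝ)|)))
      ((1 - Real.exp (-b))⁻¹ + (1 - Real.exp (-b))⁻¹ - 1) := by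
  have h1 : HasSum (fun n : ℕ => Real.exp (-b) ^ n) (1 - Real.exp (-b))⁻¹ :=
    hasSum_geometric_of_lt_one (Real.exp_nonneg _) (by simpa using hb)
  have h2 : ∀ n : ℕ, Real.exp (-b) ^ n = Real.exp (-(b * |(n : ℝ)|)) := fun n => by
    rw [← Real.exp_nat_mul, Nat.abs_cast]; ring_nf
  simp_rw [h2] at h1
  have := HasSum.of_nat_of_neg (f := fun j : ℤ => Real.exp (-(b * |(j : ℝ)|)))
    (by simpa using h1) (by simpa using h1)
  simpa using this

theorem summable_exp_neg_abs_int {b : ℝ} (hb : 0 < b) :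
    Summable fun j : ℤ => Real.exp (-(b * |(j : ℝ)|)) := (hasSum_exp_neg_abs_int hb).summable

theorem tsum_exp_neg_abs_int_le {b : ℝ} (hb : 0 < b) (hb1 : b ≤ 1) :
    ∑' j : ℤ, Real.exp (-(b * |(j : ℝ)|)) ≤ 3 / b := by
  rw [(hasSum_exp_neg_abs_int hb).tsum_eq]
  have h1 : b / (1 + b) ≤ 1 - Real.exp (-b) := by
    have : Real.exp (-b) ≤ 1 / (1 + b) := by
      rw [Real.exp_neg, ← one_div]
      exact one_div_le_one_div_of_le (by linarith) (by linarith [Real.add_one_le_exp b])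
    have h2 : b / (1 + b) = 1 - 1 / (1 + b) := by field_simp; ring
    linarith
  have h2 : (1 - Real.exp (-b))⁻¹ ≤ (b / (1 + b))⁻¹ := inv_anti₀ (by positivity) h1
  have h3 : (b / (1 + b))⁻¹ = 1 / b + 1 := by field_simp
  have h4 : 3 / b = 2 * (1 / b) + 1 / b := by ring
  have h5 : 1 ≤ 1 / b := by rw [le_div_iff₀ hb]; linarith
  linarith

/-- The number `α` is badly approximable with constant `κ`. -/
def BadlyApproximable (κ α : ℝ) : Prop :=
  ∀ p q : ℤ, p ≠ 0 → κ / |(p : ℝ)| ≤ |α * p + q|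

/-- On an interval of length `1`, a Gaussian is controlled by its exponential envelope. -/
theorem exp_neg_sq_le {b x : ℝ} (hb : 0 < b) (hb1 : b ≤ 1) :
    Real.exp (-(b ^ 2 * x ^ 2)) ≤ Real.exp (5 / 4) * Real.exp (-(b * |(⌊x⌋ : ℝ)|)) := by
  rw [← Real.exp_add, Real.exp_le_exp]
  have h1 : |(⌊x⌋ : ℝ)| ≤ |x| + 1 := by
    have h2 := Int.floor_le x
    have h3 := Int.lt_floor_add_one x
    rw [abs_le]
    constructor
    · linarith [neg_abs_le x]
    · linarith [le_abs_self x]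
  have h4 : b * |(⌊x⌋ : ℝ)| ≤ b * |x| + b := by nlinarith
  have h5 : x ^ 2 = |x| ^ 2 := (sq_abs x).symm
  rw [h5]
  nlinarith [sq_nonneg (b * |x| - 1 / 2)]

/-- A Gaussian sum over the planar lattice `{(k, c + α k + l)}`, when `α` is badly approximable, is
at most a constant times one plus the area of the ellipse on which the Gaussian lives: boxes
of area at most `κ` contain at most one point of the lattice. -/
theorem lattice_gaussian_sum {κ α A B : ℝ} (hκ : 0 < κ) (hα : BadlyApproximable κ α)
    (hA : 0 < A) (hB : 0 < B) (c : ℝ) :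
    Summable (fun k : ℤ × ℤ => Real.exp (-(A * (k.1 : ℝ) ^ 2 + B * (c + α * k.1 + k.2) ^ 2))) ∧
    ∑' k : ℤ × ℤ, Real.exp (-(A * (k.1 : ℝ) ^ 2 + B * (c + α * k.1 + k.2) ^ 2)) ≤
      9 * Real.exp (5 / 2) * (1 + 1 / (κ * Real.sqrt (A * B)) + 1 / Real.sqrt B) := by
  set b : ℝ := min 1 (min (κ * Real.sqrt (A * B)) (Real.sqrt B)) with hbdef
  have hAB : 0 < κ * Real.sqrt (A * B) := by positivity
  have hsB : 0 < Real.sqrt B := by positivity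
  have hb : 0 < b := lt_min one_pos (lt_min hAB hsB)
  have hb1 : b ≤ 1 := min_le_left _ _
  have hb2 : b ≤ κ * Real.sqrt (A * B) := (min_le_right _ _).trans (min_le_left _ _)
  have hb3 : b ≤ Real.sqrt B := (min_le_right _ _).trans (min_le_right _ _)
  have hbinv : 1 / b ≤ 1 + 1 / (κ * Real.sqrt (A * B)) + 1 / Real.sqrt B := by
    have p1 : 0 ≤ 1 / (κ * Real.sqrt (A * B)) := by positivity
    have p2 : 0 ≤ 1 / Real.sqrt B := by positivity
    rcases min_choice 1 (min (κ * Real.sqrt (A * B)) (Real.sqrt B)) with h | h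
    · rw [hbdef, h, one_div_one]; linarith
    · rw [hbdef, h]
      rcases min_choice (κ * Real.sqrt (A * B)) (Real.sqrt B) with h' | h' <;> rw [h'] <;> linarith
  set ι : ℤ × ℤ → ℤ × ℤ := fun k =>
    (⌊Real.sqrt A * k.1⌋, ⌊Real.sqrt B / b * (c + α * k.1 + k.2)⌋) with hι
  -- two points in the same box differ by `(k, α k + l)`, too small for `α` badly approximable
  have hinj : Function.Injective ι := by
    rintro ⟨k, l⟩ ⟨k', l'⟩ h
    simp only [hι, Prod.mk.injEq] at h
    have h1 := Int.abs_sub_lt_one_of_floor_eq_floor h.1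
    have h2 := Int.abs_sub_lt_one_of_floor_eq_floor h.2
    rw [← mul_sub, abs_mul, abs_of_pos (Real.sqrt_pos.2 hA)] at h1
    rw [← mul_sub, abs_mul, abs_of_pos (by positivity)] at h2
    have h3 : c + α * k + l - (c + α * k' + l') = α * ((k - k' : ℤ) : ℝ) + ((l - l' : ℤ) : ℝ) := by
      push_cast; ring
    rw [h3] at h2
    have h1' : Real.sqrt A * |((k - k' : ℤ) : ℝ)| < 1 := by push_cast; exact h1
    by_cases hk : k - k' = 0
    · rw [hk] at h2
      have h4 : |((l - l' : ℤ) : ℝ)| < 1 := by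
        have : 1 ≤ Real.sqrt B / b := by rw [le_div_iff₀ hb]; linarith
        simp only [Int.cast_zero, mul_zero, zero_add] at h2
        nlinarith [abs_nonneg ((l - l' : ℤ) : ℝ)]
      have h5 : l - l' = 0 := by
        rw [← Int.abs_lt_one_iff]; exact_mod_cast h4
      ext
      · exact sub_eq_zero.1 hk
      · exact sub_eq_zero.1 h5
    · exfalso
      have h6 := hα (k - k') (l - l') hk
      have h7 : 0 < |((k - k' : ℤ) : ℝ)| := abs_pos.2 (by exact_mod_cast hk)
      have h8 : Real.sqrt B / b * (κ / |((k - k' : ℤ) : ℝ)|) < 1 :=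
        lt_of_le_of_lt (by gcongr) h2
      rw [div_mul_div_comm, div_lt_one (by positivity)] at h8
      rw [Real.sqrt_mul hA.le] at hb2
      have h9 : Real.sqrt B * κ < κ * (Real.sqrt A * Real.sqrt B) * |((k - k' : ℤ) : ℝ)| :=
        h8.trans_le (by gcongr)
      have h10 : κ * (Real.sqrt A * Real.sqrt B) * |((k - k' : ℤ) : ℝ)| < Real.sqrt B * κ * 1 := by
        calc _ = Real.sqrt B * κ * (Real.sqrt A * |((k - k' : ℤ) : ℝ)|) := by ring
          _ < _ := by gcongr
      linarith
  set g : ℤ × ℤ → ℝ := fun p => Real.exp (5 / 2) *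
    (Real.exp (-(1 * |(p.1 : ℝ)|)) * Real.exp (-(b * |(p.2 : ℝ)|))) with hg
  have s1 := summable_exp_neg_abs_int one_pos
  have s2 := summable_exp_neg_abs_int hb
  have hgs : Summable g :=
    (s1.mul_of_nonneg s2 (fun _ => Real.exp_nonneg _) (fun _ => Real.exp_nonneg _)).mul_left _
  have hle : ∀ k : ℤ × ℤ, Real.exp (-(A * (k.1 : ℝ) ^ 2 + B * (c + α * k.1 + k.2) ^ 2)) ≤
      g (ι k) := by
    intro k
    have e1 := exp_neg_sq_le (x := Real.sqrt A * k.1) one_pos le_rfl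
    have e2 := exp_neg_sq_le (x := Real.sqrt B / b * (c + α * k.1 + k.2)) hb hb1
    have e3 : Real.exp (-(A * (k.1 : ℝ) ^ 2 + B * (c + α * k.1 + k.2) ^ 2)) =
        Real.exp (-(1 ^ 2 * (Real.sqrt A * k.1) ^ 2)) *
          Real.exp (-(b ^ 2 * (Real.sqrt B / b * (c + α * k.1 + k.2)) ^ 2)) := by
      rw [← Real.exp_add]
      congr 1
      rw [mul_pow, mul_pow, div_pow, Real.sq_sqrt hA.le, Real.sq_sqrt hB.le]
      field_simp
      ring
    rw [e3]
    calc _ ≤ _ := mul_le_mul e1 e2 (Real.exp_nonneg _) (by positivity)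
      _ = g (ι k) := by
        simp only [hg, hι]
        rw [show (5 / 2 : ℝ) = 5 / 4 + 5 / 4 by norm_num, Real.exp_add]
        ring
  have hsum := Summable.of_nonneg_of_le (fun _ => Real.exp_nonneg _) hle (hgs.comp_injective hinj)
  refine ⟨hsum, ?_⟩
  calc _ ≤ ∑' k, g (ι k) := hsum.tsum_le_tsum hle (hgs.comp_injective hinj)
    _ ≤ ∑' p, g p := tsum_comp_le_tsum_of_inj hgs (fun _ => by positivity) hinj
    _ = Real.exp (5 / 2) * ((∑' j : ℤ, Real.exp (-(1 * |(j : ℝ)|))) *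
          ∑' j : ℤ, Real.exp (-(b * |(j : ℝ)|))) := by
        rw [tsum_mul_left, s1.tsum_mul_tsum s2
          (s1.mul_of_nonneg s2 (fun _ => Real.exp_nonneg _) (fun _ => Real.exp_nonneg _))]
    _ ≤ Real.exp (5 / 2) * (3 / 1 * (3 / b)) := by
        gcongr
        · exact tsum_exp_neg_abs_int_le one_pos le_rfl
        · exact tsum_exp_neg_abs_int_le hb hb1
    _ = 9 * Real.exp (5 / 2) * (1 / b) := by ring
    _ ≤ _ := by gcongr

/-! ### The slope of the unstable line -/

theorem tan_theta : Real.tan theta = (Real.sqrt 5 - 1) / 2 := by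
  unfold theta; rw [Real.tan_arctan]

theorem tan_theta_sq : Real.tan theta ^ 2 = 1 - Real.tan theta := by
  rw [tan_theta]
  nlinarith [Real.sq_sqrt (show (0 : ℝ) ≤ 5 by norm_num)]

theorem tan_theta_gt : 0.618 < Real.tan theta := by
  rw [tan_theta]
  have : 2.236 < Real.sqrt 5 := by
    rw [Real.lt_sqrt (by norm_num)]; norm_num
  linarith

theorem tan_theta_lt : Real.tan theta < 0.62 := by
  rw [tan_theta]
  have : Real.sqrt 5 < 2.24 := by
    rw [Real.sqrt_lt' (by norm_num)]; norm_num
  linarith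

theorem cos_theta_sq : Real.cos theta ^ 2 = 1 / (1 + Real.tan theta ^ 2) := by
  unfold theta
  rw [Real.cos_sq_arctan, Real.tan_arctan]

theorem cos_theta_pos : 0 < Real.cos theta := Real.cos_arctan_pos _

theorem lam_eq : lam = 2 + Real.tan theta := by
  rw [tan_theta]; unfold lam; ring

/-- The slope is a quadratic irrational, hence badly approximable: the norm form
`(t p + q)(t' p + q) = q² - p q - p²` takes nonzero integer values. -/
theorem tan_theta_badlyApproximable : BadlyApproximable (1 / 3) (Real.tan theta) := by
  intro p q hp
  set t := Real.tan theta with ht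
  have ht2 : t ^ 2 = 1 - t := tan_theta_sq
  have hp0 : 0 < |(p : ℝ)| := abs_pos.2 (by exact_mod_cast hp)
  have hp1 : 1 ≤ |(p : ℝ)| := by exact_mod_cast Int.one_le_abs hp
  have hnorm : (t * p + q) * ((-1 - t) * p + q) = ((q ^ 2 - p * q - p ^ 2 : ℤ) : ℝ) := by
    push_cast
    linear_combination (-(p : ℝ) ^ 2) * ht2
  -- the discriminant `5` of the form is not a square
  have hne : q ^ 2 - p * q - p ^ 2 ≠ 0 := by
    intro h
    have h1 : (2 * q - p) * (2 * q - p) = 5 * (p * p) := by linarith [h]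
    have h2 : Irrational (Real.sqrt 5) := by
      simpa using Nat.Prime.irrational_sqrt (show Nat.Prime 5 by norm_num)
    have h3 : (((2 * q - p : ℤ) : ℝ) / p) ^ 2 = 5 := by
      have hp' : (p : ℝ) ≠ 0 := by exact_mod_cast hp
      rw [div_pow, div_eq_iff (by positivity)]
      have := congrArg (fun z : ℤ => (z : ℝ)) h1
      push_cast at this ⊢
      linarith
    have h4 : Real.sqrt 5 = |((2 * q - p : ℤ) : ℝ) / p| := by rw [← h3, Real.sqrt_sq_eq_abs]
    apply h2
    refine ⟨|((2 * q - p : ℤ) : ℚ) / p|, ?_⟩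
    rw [h4]
    push_cast
    rfl
  have h1 : 1 ≤ |(t * p + q)| * |((-1 - t) * p + q)| := by
    rw [← abs_mul, hnorm]
    exact_mod_cast Int.one_le_abs hne
  have h2 : |(-1 - t) * p + q| ≤ |t * p + q| + 2.24 * |(p : ℝ)| := by
    have e : (-1 - t) * p + q = (t * p + q) + (-(1 + 2 * t)) * p := by ring
    rw [e]
    refine (abs_add_le _ _).trans ?_
    rw [abs_mul (-(1 + 2 * t)), abs_neg, abs_of_pos (by linarith [tan_theta_gt] : 0 < 1 + 2 * t)]
    have := tan_theta_lt
    gcongr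
    linarith
  rw [div_le_iff₀ hp0]
  by_contra hcon
  push Not at hcon
  have h3 : |t * p + q| < 1 / 3 := by nlinarith [abs_nonneg (t * p + q)]
  nlinarith [abs_nonneg (t * p + q)]

theorem BadlyApproximable.nat_mul {κ α : ℝ} (h : BadlyApproximable κ α) {N : ℕ} (hN : N ≠ 0) :
    BadlyApproximable (κ / N) (N * α) := by
  intro p q hp
  have h1 := h (N * p) q (mul_ne_zero (by exact_mod_cast hN) hp)
  have h2 : α * ((N * p : ℤ) : ℝ) + q = N * α * p + q := by push_cast; ring
  rw [h2] at h1
  refine le_trans (le_of_eq ?_) h1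
  push_cast
  rw [abs_mul, Nat.abs_cast, div_div]

theorem BadlyApproximable.neg {κ α : ℝ} (h : BadlyApproximable κ α) :
    BadlyApproximable κ (-α) := by
  intro p q hp
  have h1 := h (-p) q (neg_ne_zero.2 hp)
  push_cast at h1
  rw [abs_neg] at h1
  convert h1 using 2
  ring

/-! ### Square root cancellation for theta functions -/

/-- The sum along one diagonal in the expansion of the squared modulus of a theta function,
bounded by Poisson summation. -/
theorem norm_theta_diagonal_le {α v : ℝ} (hv : 0 < v) (z : ℂ) (d : ℤ)
    (hs : Summable fun n : ℤ =>
      Real.exp (-(Real.pi * v / 2 * (d : ℝ) ^ 2 + Real.pi / (2 * v) * (0 + -α * d + n) ^ 2))) :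
    ‖∑' n : ℤ, jacobiTheta₂_term n z (α + v * Complex.I) *
        conj (jacobiTheta₂_term (n - d) z (α + v * Complex.I))‖ ≤
      1 / Real.sqrt (2 * v) * Real.exp (2 * Real.pi * z.im ^ 2 / v) *
        ∑' n : ℤ, Real.exp (-(Real.pi * v / 2 * (d : ℝ) ^ 2 +
          Real.pi / (2 * v) * (0 + -α * d + n) ^ 2)) := by
  set y := z.im with hy
  set a : ℂ := ((2 * v : ℝ) : ℂ) with ha
  set b : ℂ := ((d * v - 2 * y : ℝ) : ℂ) + Complex.I * ((d * α : ℝ) : ℂ) with hb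
  set P : ℂ := Complex.exp (2 * Real.pi * Complex.I * d * conj z -
    Real.pi * Complex.I * d ^ 2 * ((α : ℂ) - v * Complex.I)) with hP
  have hzz : z = conj z + 2 * Complex.I * (y : ℂ) := by
    apply Complex.ext <;> simp [hy]; ring
  have hterm : ∀ n : ℤ, jacobiTheta₂_term n z (α + v * Complex.I) *
        conj (jacobiTheta₂_term (n - d) z (α + v * Complex.I)) =
      P * Complex.exp (-Real.pi * a * n ^ 2 + 2 * Real.pi * b * n) := by
    intro n
    unfold jacobiTheta₂_term
    rw [← Complex.exp_conj, ← Complex.exp_add, hP, ← Complex.exp_add]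
    congr 1
    simp only [map_add, map_mul, Complex.conj_I, Complex.conj_ofReal, map_pow, map_intCast,
      map_ofNat]
    nth_rewrite 1 [hzz]
    rw [ha, hb]
    push_cast
    ring_nf
    simp only [Complex.I_sq]
    ring
  have ha0 : 0 < a.re := by rw [ha, Complex.ofReal_re]; positivity
  simp_rw [hterm]
  rw [tsum_mul_left, Complex.tsum_exp_neg_quadratic ha0, norm_mul, norm_mul]
  have hpre : ‖1 / a ^ (1 / 2 : ℂ)‖ = 1 / Real.sqrt (2 * v) := by
    rw [norm_div, norm_one, ha, Complex.norm_cpow_eq_rpow_re_of_pos (by positivity),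
      Real.sqrt_eq_rpow]
    norm_num
  have hPn : ‖P‖ = Real.exp (2 * Real.pi * d * y - Real.pi * d ^ 2 * v) := by
    rw [hP, Complex.norm_exp]
    congr 1
    simp [hy, ← Complex.ofReal_intCast, ← Complex.ofReal_pow]
  have hn : ∀ n : ℤ, ‖Complex.exp (-Real.pi / a * (n + Complex.I * b) ^ 2)‖ =
      Real.exp (-(Real.pi / (2 * v)) * ((0 + -α * d + n) ^ 2 - (d * v - 2 * y) ^ 2)) := by
    intro n
    rw [Complex.norm_exp]
    congr 1
    have : -Real.pi / a * (n + Complex.I * b) ^ 2 =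
        ((-(Real.pi / (2 * v)) : ℝ) : ℂ) * ((((0 + -α * d + n) ^ 2 - (d * v - 2 * y) ^ 2 : ℝ) : ℂ)
          + ((2 * (-α * d + n) * (d * v - 2 * y) : ℝ) : ℂ) * Complex.I) := by
      rw [ha, hb]
      push_cast
      ring_nf
      simp only [Complex.I_sq, show Complex.I ^ 3 = -Complex.I by
        rw [pow_succ, Complex.I_sq]; ring, show Complex.I ^ 4 = 1 by
        rw [show (4 : ℕ) = 2 * 2 by norm_num, pow_mul, Complex.I_sq]; norm_num]
      ring
    rw [this, Complex.re_ofReal_mul, Complex.add_re, Complex.ofReal_re, Complex.re_ofReal_mul,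
      Complex.I_re, mul_zero, add_zero]
  have hsplit : ∀ n : ℤ,
      Real.exp (-(Real.pi / (2 * v)) * ((0 + -α * d + n) ^ 2 - (d * v - 2 * y) ^ 2)) =
      Real.exp (Real.pi / (2 * v) * (d * v - 2 * y) ^ 2 + Real.pi * v / 2 * d ^ 2) *
      Real.exp (-(Real.pi * v / 2 * (d : ℝ) ^ 2 + Real.pi / (2 * v) * (0 + -α * d + n) ^ 2)) := by
    intro n
    rw [← Real.exp_add]
    congr 1
    ring
  have hbound : ‖∑' n : ℤ, Complex.exp (-Real.pi / a * (n + Complex.I * b) ^ 2)‖ ≤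
      Real.exp (Real.pi / (2 * v) * (d * v - 2 * y) ^ 2 + Real.pi * v / 2 * d ^ 2) *
      ∑' n : ℤ, Real.exp (-(Real.pi * v / 2 * (d : ℝ) ^ 2 +
        Real.pi / (2 * v) * (0 + -α * d + n) ^ 2)) := by
    rw [← tsum_mul_left]
    refine tsum_of_norm_bounded (hs.mul_left _).hasSum fun n => ?_
    rw [hn, hsplit]
  rw [hpre, hPn]
  calc _ ≤ Real.exp (2 * Real.pi * d * y - Real.pi * d ^ 2 * v) * (1 / Real.sqrt (2 * v) *
      (Real.exp (Real.pi / (2 * v) * (d * v - 2 * y) ^ 2 + Real.pi * v / 2 * d ^ 2) *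
      ∑' n : ℤ, Real.exp (-(Real.pi * v / 2 * (d : ℝ) ^ 2 +
        Real.pi / (2 * v) * (0 + -α * d + n) ^ 2)))) := by gcongr
    _ = 1 / Real.sqrt (2 * v) * (Real.exp (2 * Real.pi * d * y - Real.pi * d ^ 2 * v) *
      Real.exp (Real.pi / (2 * v) * (d * v - 2 * y) ^ 2 + Real.pi * v / 2 * d ^ 2)) *
      ∑' n : ℤ, Real.exp (-(Real.pi * v / 2 * (d : ℝ) ^ 2 +
        Real.pi / (2 * v) * (0 + -α * d + n) ^ 2)) := by ring
    _ = _ := by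
      rw [← Real.exp_add]
      congr 4
      field_simp
      ring

/-- Shearing of the index set, used to sum along diagonals. -/
def shear : ℤ × ℤ ≃ ℤ × ℤ where
  toFun p := (p.2, p.2 - p.1)
  invFun p := (p.1 - p.2, p.1)
  left_inv p := by ext <;> simp
  right_inv p := by ext <;> simp

/-- If the real part `α` of the modulus is badly approximable, the theta function has square root
cancellation down to the real axis: its squared modulus is a Gaussian sum over a lattice. -/
theorem norm_jacobiTheta₂_sq_le {κ α v : ℝ} (hκ : 0 < κ) (hκ1 : κ ≤ 1)
    (hα : BadlyApproximable κ α) (hv : 0 < v) (hv1 : v ≤ 1) (z : ℂ) :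
    ‖jacobiTheta₂ z (α + v * Complex.I)‖ ^ 2 ≤
      27 * Real.exp (5 / 2) / κ * (1 / Real.sqrt v) * Real.exp (2 * Real.pi * z.im ^ 2 / v) := by
  have hτ : 0 < ((α : ℂ) + v * Complex.I).im := by simpa using hv
  obtain ⟨hL1, hL2⟩ := lattice_gaussian_sum hκ hα.neg (A := Real.pi * v / 2)
    (B := Real.pi / (2 * v)) (by positivity) (by positivity) 0
  have hsum : Summable fun n : ℤ => jacobiTheta₂_term n z (α + v * Complex.I) :=
    (summable_jacobiTheta₂_term_iff _ _).2 hτ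
  set f : ℤ → ℂ := fun n => jacobiTheta₂_term n z (α + v * Complex.I) with hf
  have hfn : Summable fun n => ‖f n‖ := hsum.norm
  have hgn : Summable fun n => ‖conj (f n)‖ := by
    simpa only [RCLike.norm_conj] using hfn
  have hprod : Summable fun p : ℤ × ℤ => f p.1 * conj (f p.2) :=
    summable_mul_of_summable_norm (f := f) (g := fun n => conj (f n)) hfn hgn
  have h1 : ((‖jacobiTheta₂ z (α + v * Complex.I)‖ ^ 2 : ℝ) : ℂ) =
      ∑' d : ℤ, ∑' n : ℤ, jacobiTheta₂_term n z (α + v * Complex.I) *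
        conj (jacobiTheta₂_term (n - d) z (α + v * Complex.I)) := by
    rw [← Complex.normSq_eq_norm_sq, ← Complex.mul_conj, jacobiTheta₂, Complex.conj_tsum,
      tsum_mul_tsum_of_summable_norm (f := f) (g := fun n => conj (f n)) hfn hgn,
      ← shear.tsum_eq]
    have h0 : Summable fun p : ℤ × ℤ => f p.2 * conj (f (p.2 - p.1)) :=
      shear.summable_iff.2 hprod
    exact h0.tsum_prod
  have h2 : ‖jacobiTheta₂ z (α + v * Complex.I)‖ ^ 2 =
      ‖∑' d : ℤ, ∑' n : ℤ, jacobiTheta₂_term n z (α + v * Complex.I) *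
        conj (jacobiTheta₂_term (n - d) z (α + v * Complex.I))‖ := by
    rw [← h1, Complex.norm_real, Real.norm_of_nonneg (by positivity)]
  rw [h2]
  have h3 := tsum_of_norm_bounded ((hL1.prod).mul_left
    (1 / Real.sqrt (2 * v) * Real.exp (2 * Real.pi * z.im ^ 2 / v))).hasSum
    fun d => norm_theta_diagonal_le (α := α) hv z d (hL1.prod_factor d)
  refine h3.trans ?_
  rw [tsum_mul_left, ← hL1.tsum_prod]
  have h4 : 1 / (κ * Real.sqrt (Real.pi * v / 2 * (Real.pi / (2 * v)))) ≤ 1 / κ := by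
    have : Real.pi * v / 2 * (Real.pi / (2 * v)) = (Real.pi / 2) ^ 2 := by field_simp
    rw [this, Real.sqrt_sq (by positivity)]
    refine one_div_le_one_div_of_le hκ (le_mul_of_one_le_right hκ.le ?_)
    linarith [Real.pi_gt_three]
  have h5 : 1 / Real.sqrt (Real.pi / (2 * v)) ≤ 1 := by
    rw [div_le_one (by positivity), Real.one_le_sqrt, le_div_iff₀ (by positivity)]
    linarith [Real.pi_gt_three]
  have h6 : 1 ≤ 1 / κ := by rw [le_div_iff₀ hκ]; linarith
  have h7 : 1 / Real.sqrt (2 * v) ≤ 1 / Real.sqrt v := by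
    refine one_div_le_one_div_of_le (by positivity) (Real.sqrt_le_sqrt (by linarith))
  calc _ ≤ 1 / Real.sqrt v * Real.exp (2 * Real.pi * z.im ^ 2 / v) *
        (9 * Real.exp (5 / 2) * (1 / κ + 1 / κ + 1 / κ)) := by
        refine mul_le_mul (by gcongr) (hL2.trans ?_) (tsum_nonneg fun _ => Real.exp_nonneg _)
          (by positivity)
        exact mul_le_mul_of_nonneg_left (by linarith) (by positivity)
    _ = _ := by ring

/-- A numerical constant in the bound for theta functions. -/
noncomputable def thetaConst : ℝ := Real.sqrt (81 * Real.exp (5 / 2))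

theorem thetaConst_nonneg : 0 ≤ thetaConst := Real.sqrt_nonneg _

/-- The badly approximable numbers of interest are `± N tan θ`, whose constant is of order `1 / N`.
Up to a factor `√N`, the theta function is as small as for random phases. -/
theorem norm_jacobiTheta₂_le {N : ℕ} (hN : N ≠ 0) {α v : ℝ}
    (hα : BadlyApproximable (1 / 3 / N) α) (hv : 0 < v) (hv1 : v ≤ 1) (z : ℂ) :
    ‖jacobiTheta₂ z (α + v * Complex.I)‖ ≤
      thetaConst * Real.sqrt N * v ^ (-(1 / 4) : ℝ) * Real.exp (Real.pi * z.im ^ 2 / v) := by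
  have hN1 : (1 : ℝ) ≤ N := by exact_mod_cast Nat.one_le_iff_ne_zero.2 hN
  have h := norm_jacobiTheta₂_sq_le (κ := 1 / 3 / N) (by positivity)
    (by rw [div_div, div_le_one (by positivity)]; linarith) hα hv hv1 z
  have hc := thetaConst_nonneg
  rw [← pow_le_pow_iff_left₀ (norm_nonneg _) (by positivity) two_ne_zero]
  refine h.trans (le_of_eq ?_)
  rw [mul_pow, mul_pow, mul_pow, ← Real.exp_nat_mul, Real.sq_sqrt (by positivity),
    ← Real.rpow_mul_natCast hv.le, thetaConst, Real.sq_sqrt (by positivity), Real.sqrt_eq_rpow,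
    one_div (v ^ _), ← Real.rpow_neg hv.le]
  have e1 : -(1 / 4 : ℝ) * (2 : ℕ) = -(1 / 2) := by norm_num
  have e2 : ((2 : ℕ) : ℝ) * (Real.pi * z.im ^ 2 / v) = 2 * Real.pi * z.im ^ 2 / v := by
    push_cast; ring
  rw [e1, e2]
  field_simp
  norm_num

/-! ### Theta functions along residue classes -/

/-- The phase `e(x) = exp (2 i π x)`. -/
noncomputable def cis (x : ℝ) : ℂ := Complex.exp (2 * Real.pi * Complex.I * x)

theorem cis_add (x y : ℝ) : cis (x + y) = cis x * cis y := by
  unfold cis; rw [← Complex.exp_add]; congr 1; push_cast; ring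

theorem cis_zero : cis 0 = 1 := by simp [cis]

theorem norm_cis (x : ℝ) : ‖cis x‖ = 1 := by
  unfold cis; rw [Complex.norm_exp]; simp

theorem cis_int (n : ℤ) : cis n = 1 := by
  unfold cis
  rw [Complex.exp_eq_one_iff]
  exact ⟨n, by push_cast; ring⟩

theorem cis_add_int (x : ℝ) (n : ℤ) : cis (x + n) = cis x := by
  rw [cis_add, cis_int, mul_one]

theorem norm_cis_sub_cis_le_two (x y : ℝ) : ‖cis x - cis y‖ ≤ 2 := by
  refine (norm_sub_le _ _).trans ?_
  rw [norm_cis, norm_cis]; norm_num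

theorem norm_cis_sub_cis_le (x y : ℝ) : ‖cis x - cis y‖ ≤ 2 * Real.pi * |x - y| := by
  have h1 : cis x - cis y = cis y * (Complex.exp (Complex.I * ((2 * Real.pi * (x - y) : ℝ) : ℂ)) - 1) := by
    rw [mul_sub, mul_one]
    congr 1
    unfold cis
    rw [← Complex.exp_add]
    congr 1
    push_cast
    ring
  rw [h1, norm_mul, norm_cis, one_mul]
  refine Real.norm_exp_I_mul_ofReal_sub_one_le.trans (le_of_eq ?_)
  rw [Real.norm_eq_abs, abs_mul, abs_of_pos (by positivity)]

/-- A theta function with characteristic: the sum over `j ≡ j₀ mod N`, `j = j₀ + r N`, of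
`exp (2 i π j x - π j² v)` times the quadratic phase `exp (i π α r² - 2 i π r ξ)`. -/
noncomputable def classTheta (N : ℕ) (j₀ : ℤ) (α ξ v : ℝ) (x : ℂ) : ℂ :=
  Complex.exp (2 * Real.pi * Complex.I * j₀ * x - Real.pi * j₀ ^ 2 * v) *
    jacobiTheta₂ (N * x - ξ + Complex.I * (j₀ * N * v : ℝ)) (α + (N ^ 2 * v : ℝ) * Complex.I)

/-- The general term of `classTheta` at a real point. -/
noncomputable def classTerm (N : ℕ) (j₀ : ℤ) (α ξ v x : ℝ) (r : ℤ) : ℂ :=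
  cis ((j₀ + r * N) * x) * cis (α * r ^ 2 / 2 - r * ξ) *
    Real.exp (-(Real.pi * (j₀ + r * N) ^ 2 * v))

theorem hasSum_classTheta {N : ℕ} (hN : N ≠ 0) (j₀ : ℤ) (α ξ x : ℝ) {v : ℝ} (hv : 0 < v) :
    HasSum (classTerm N j₀ α ξ v x) (classTheta N j₀ α ξ v x) := by
  have hN1 : (0 : ℝ) < N := by exact_mod_cast Nat.pos_of_ne_zero hN
  have h := hasSum_jacobiTheta₂_term (N * x - ξ + Complex.I * (j₀ * N * v : ℝ))
    (τ := α + (N ^ 2 * v : ℝ) * Complex.I) (by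
      rw [Complex.add_im, Complex.ofReal_im, Complex.im_ofReal_mul, Complex.I_im]
      positivity)
  refine (h.mul_left (Complex.exp (2 * Real.pi * Complex.I * j₀ * x -
    Real.pi * j₀ ^ 2 * v))).congr_fun ?_
  intro r
  unfold classTerm cis jacobiTheta₂_term
  rw [← Complex.exp_add, ← Complex.exp_add, Complex.ofReal_exp, ← Complex.exp_add]
  congr 1
  push_cast
  ring_nf
  simp only [Complex.I_sq]
  ring

/-- The bound holds off the real line as well; there the completed square of the prefactor exactly
compensates the shift of the variable of the theta function. -/
theorem norm_classTheta_le {N : ℕ} (hN : N ≠ 0) (j₀ : ℤ) {α : ℝ}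
    (hα : BadlyApproximable (1 / 3 / N) α) (ξ : ℝ) {v : ℝ} (hv : 0 < v) (hv1 : N ^ 2 * v ≤ 1)
    (x : ℂ) :
    ‖classTheta N j₀ α ξ v x‖ ≤
      thetaConst * v ^ (-(1 / 4) : ℝ) * Real.exp (Real.pi * x.im ^ 2 / v) := by
  have hN1 : (0 : ℝ) < N := by exact_mod_cast Nat.pos_of_ne_zero hN
  have hV : 0 < (N : ℝ) ^ 2 * v := by positivity
  unfold classTheta
  rw [norm_mul]
  have h := norm_jacobiTheta₂_le hN hα hV hv1 (N * x - ξ + Complex.I * (j₀ * N * v : ℝ))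
  have him : ((N : ℂ) * x - ξ + Complex.I * (j₀ * N * v : ℝ)).im = N * (x.im + j₀ * v) := by
    simp [← Complex.ofReal_natCast]
    ring
  rw [him] at h
  have hn : ‖Complex.exp (2 * Real.pi * Complex.I * j₀ * x - Real.pi * j₀ ^ 2 * v)‖ =
      Real.exp (-(2 * Real.pi * j₀ * x.im) - Real.pi * j₀ ^ 2 * v) := by
    rw [Complex.norm_exp]
    congr 1
    simp [← Complex.ofReal_intCast, ← Complex.ofReal_pow]
  rw [hn]
  have hsq : Real.sqrt N * ((N : ℝ) ^ 2 * v) ^ (-(1 / 4) : ℝ) = v ^ (-(1 / 4) : ℝ) := by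
    rw [Real.mul_rpow (by positivity) hv.le, ← Real.rpow_natCast, ← Real.rpow_mul hN1.le,
      Real.sqrt_eq_rpow, ← mul_assoc, ← Real.rpow_add hN1]
    norm_num
  calc _ ≤ Real.exp (-(2 * Real.pi * j₀ * x.im) - Real.pi * j₀ ^ 2 * v) *
        (thetaConst * Real.sqrt N * (N ^ 2 * v) ^ (-(1 / 4) : ℝ) *
          Real.exp (Real.pi * (N * (x.im + j₀ * v)) ^ 2 / (N ^ 2 * v))) := by gcongr
    _ = thetaConst * (Real.sqrt N * (N ^ 2 * v) ^ (-(1 / 4) : ℝ)) *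
        (Real.exp (-(2 * Real.pi * j₀ * x.im) - Real.pi * j₀ ^ 2 * v) *
          Real.exp (Real.pi * (N * (x.im + j₀ * v)) ^ 2 / (N ^ 2 * v))) := by ring
    _ = _ := by
      rw [hsq, ← Real.exp_add]
      congr 2
      field_simp
      ring

theorem differentiable_classTheta {N : ℕ} (hN : N ≠ 0) (j₀ : ℤ) (α ξ : ℝ) {v : ℝ} (hv : 0 < v) :
    Differentiable ℂ (classTheta N j₀ α ξ v) := by
  have hN1 : (0 : ℝ) < N := by exact_mod_cast Nat.pos_of_ne_zero hN
  intro x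
  unfold classTheta
  refine DifferentiableAt.mul (by fun_prop) ?_
  refine DifferentiableAt.comp (g := fun z => jacobiTheta₂ z (α + (N ^ 2 * v : ℝ) * Complex.I)) x
    (differentiableAt_jacobiTheta₂_fst _ ?_) (by fun_prop)
  rw [Complex.add_im, Complex.ofReal_im, Complex.im_ofReal_mul, Complex.I_im]
  positivity

/-- The Lipschitz constant on the real line follows from Cauchy's estimate on circles of
radius `√v`. -/
theorem norm_classTheta_sub_le {N : ℕ} (hN : N ≠ 0) (j₀ : ℤ) {α : ℝ}
    (hα : BadlyApproximable (1 / 3 / N) α) (ξ : ℝ) {v : ℝ} (hv : 0 < v) (hv1 : N ^ 2 * v ≤ 1)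
    (x y : ℝ) :
    ‖classTheta N j₀ α ξ v x - classTheta N j₀ α ξ v y‖ ≤
      thetaConst * Real.exp Real.pi * v ^ (-(3 / 4) : ℝ) * |x - y| := by
  have hd := differentiable_classTheta hN j₀ α ξ hv
  have hc := thetaConst_nonneg
  have hs : Convex ℝ {z : ℂ | z.im = 0} := by
    intro a ha b hb p q _ _ _
    simp only [Set.mem_ofPred_eq] at *
    simp [ha, hb]
  have hb : ∀ z ∈ {z : ℂ | z.im = 0}, ‖deriv (classTheta N j₀ α ξ v) z‖ ≤
      thetaConst * Real.exp Real.pi * v ^ (-(3 / 4) : ℝ) := by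
    intro z hz
    have h1 := Complex.norm_deriv_le_of_forall_mem_sphere_norm_le (c := z) (R := Real.sqrt v)
      (C := thetaConst * v ^ (-(1 / 4) : ℝ) * Real.exp Real.pi) (Real.sqrt_pos.2 hv)
      hd.diffContOnCl (by
        intro w hw
        refine (norm_classTheta_le hN j₀ hα ξ hv hv1 w).trans ?_
        gcongr
        have h2 : w.im ^ 2 ≤ v := by
          have h3 : |w.im| ≤ Real.sqrt v := by
            have h4 := Complex.abs_im_le_norm (w - z)
            rw [mem_sphere_iff_norm.1 hw, Complex.sub_im, hz, sub_zero] at h4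
            exact h4
          rw [← sq_abs, ← Real.sq_sqrt hv.le]
          gcongr
        rw [div_le_iff₀ hv]
        gcongr)
    refine h1.trans (le_of_eq ?_)
    rw [Real.sqrt_eq_rpow, div_eq_mul_inv, ← Real.rpow_neg hv.le,
      show (-(3 / 4) : ℝ) = -(1 / 4) + -(1 / 2) by norm_num, Real.rpow_add hv]
    ring
  have h := hs.norm_image_sub_le_of_norm_deriv_le (fun z _ => hd z) hb
    (show (y : ℂ) ∈ {z : ℂ | z.im = 0} by simp) (show (x : ℂ) ∈ {z : ℂ | z.im = 0} by simp)
  rwa [← Complex.ofReal_sub, Complex.norm_real, Real.norm_eq_abs] at h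

/-! ### Fourier coefficients of the sawtooth along residue classes -/

/-- The Fourier coefficients of the sawtooth `Int.fract x - 1 / 2`, averaged over `[x - δ, x + δ]`. -/
noncomputable def sawCoeff (δ : ℝ) (j : ℤ) : ℂ :=
  (cis (j * δ) - cis (-(j * δ))) / ((8 * Real.pi ^ 2 * δ * (j : ℝ) ^ 2 : ℝ) : ℂ)

theorem norm_sawCoeff_le_inv {δ : ℝ} (hδ : 0 < δ) (j : ℤ) :
    ‖sawCoeff δ j‖ ≤ 1 / (2 * Real.pi * |(j : ℝ)|) := by
  unfold sawCoeff
  rw [norm_div, Complex.norm_real, Real.norm_of_nonneg (by positivity)]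
  have h := norm_cis_sub_cis_le (j * δ) (-(j * δ))
  rcases eq_or_ne j 0 with rfl | hj
  · simp
  have hj' : 0 < |(j : ℝ)| := abs_pos.2 (by exact_mod_cast hj)
  rw [show (j : ℝ) * δ - -(j * δ) = 2 * j * δ by ring, abs_mul, abs_mul, abs_two, abs_of_pos hδ] at h
  rw [← sq_abs (j : ℝ), div_le_div_iff₀ (by positivity) (by positivity)]
  calc _ ≤ 2 * Real.pi * (2 * |(j : ℝ)| * δ) * (2 * Real.pi * |(j : ℝ)|) := by gcongr
    _ = _ := by ring

theorem norm_sawCoeff_le_inv_sq {δ : ℝ} (hδ : 0 < δ) (j : ℤ) :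
    ‖sawCoeff δ j‖ ≤ 1 / (4 * Real.pi ^ 2 * δ) * (1 / (j : ℝ) ^ 2) := by
  unfold sawCoeff
  rw [norm_div, Complex.norm_real, Real.norm_of_nonneg (by positivity)]
  calc _ ≤ 2 / (8 * Real.pi ^ 2 * δ * (j : ℝ) ^ 2) := by
        gcongr
        exact norm_cis_sub_cis_le_two _ _
    _ = _ := by
      rw [← one_div_mul_one_div_rev]
      ring

theorem summable_norm_sawCoeff {δ : ℝ} (hδ : 0 < δ) : Summable fun j => ‖sawCoeff δ j‖ := by
  refine Summable.of_nonneg_of_le (fun _ => norm_nonneg _) (norm_sawCoeff_le_inv_sq hδ) ?_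
  exact (Real.summable_one_div_int_pow.2 one_lt_two).mul_left _

theorem residue_injective {N : ℕ} (hN : N ≠ 0) (j₀ : ℤ) :
    Function.Injective fun r : ℤ => j₀ + r * N := by
  intro r r' h
  have h1 : r * (N : ℤ) = r' * N := by simpa using h
  exact mul_right_cancel₀ (by exact_mod_cast hN) h1

theorem integral_exp_neg_mul_Ioc {c V : ℝ} (hc : c ≠ 0) (hV : 0 ≤ V) :
    ∫ v in Set.Ioc 0 V, Real.exp (-(c * v)) = (1 - Real.exp (-(c * V))) / c := by
  rw [← intervalIntegral.integral_of_le hV]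
  have h : ∀ v ∈ Set.uIcc 0 V, HasDerivAt (fun v => -(Real.exp (-(c * v)) / c))
      (Real.exp (-(c * v))) v := by
    intro v _
    have h1 : HasDerivAt (fun v : ℝ => -(c * v)) (-(c * 1)) v :=
      ((hasDerivAt_id v).const_mul c).neg
    refine ((h1.exp.div_const c).neg).congr_deriv ?_
    field_simp
  rw [intervalIntegral.integral_eq_sub_of_hasDerivAt h
    (Continuous.intervalIntegrable (by fun_prop) _ _)]
  simp
  ring

theorem integral_rpow_neg_three_quarters {V : ℝ} (hV : 0 ≤ V) :
    ∫ v in Set.Ioc 0 V, v ^ (-(3 / 4) : ℝ) = 4 * V ^ (1 / 4 : ℝ) := by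
  rw [← intervalIntegral.integral_of_le hV, integral_rpow (Or.inl (by norm_num))]
  norm_num
  ring

/-- The sums of the Fourier coefficients of the sawtooth along a residue class, twisted by a
quadratic phase, are bounded uniformly in the smoothing parameter `δ`. The coefficients decay only
like `1 / j`, so this uses the cancellation in theta functions: `1 / j²` is the integral
of `π exp (- π j² v)` over `v > 0`. -/
theorem norm_tsum_sawCoeff_class_le {N : ℕ} (hN : N ≠ 0) {j₀ : ℤ} (hj : 0 ≤ j₀) (hjN : j₀ < N)
    {α : ℝ} (hα : BadlyApproximable (1 / 3 / N) α) {δ : ℝ} (hδ : 0 < δ) (ξ y : ℝ) :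
    ‖∑' r : ℤ, sawCoeff δ (j₀ + r * N) * cis ((j₀ + r * N) * y) * cis (α * r ^ 2 / 2 - r * ξ)‖ ≤
      thetaConst * Real.exp Real.pi + 3 * Real.exp (5 / 4) := by
  have hN1 : (0 : ℝ) < N := by exact_mod_cast Nat.pos_of_ne_zero hN
  have hN2 : (1 : ℝ) ≤ N := by exact_mod_cast Nat.one_le_iff_ne_zero.2 hN
  have hc := thetaConst_nonneg
  set V : ℝ := 1 / (N : ℝ) ^ 2 with hV
  have hV0 : 0 < V := by positivity
  have hV1 : V ≤ 1 := by
    rw [hV, div_le_one (by positivity)]; exact one_le_pow₀ hN2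
  set K : ℝ := thetaConst * Real.exp Real.pi with hK
  have hK0 : 0 ≤ K := by positivity
  set J : ℤ → ℝ := fun r => j₀ + r * N with hJ
  have hJc : ∀ r, J r = ((j₀ + r * N : ℤ) : ℝ) := fun r => by simp [hJ]
  set W : ℤ → ℂ := fun r =>
    (cis (J r * δ) - cis (-(J r * δ))) * cis (J r * y) * cis (α * r ^ 2 / 2 - r * ξ) with hW
  have hW0 : ∀ r, J r = 0 → W r = 0 := fun r h => by simp [hW, h]
  have hW2 : ∀ r, ‖W r‖ ≤ 2 := fun r => by
    simp only [hW, norm_mul, norm_cis, mul_one]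
    exact norm_cis_sub_cis_le_two _ _
  -- the integrated theta series
  set F : ℤ → ℝ → ℂ := fun r v => W r * (Real.exp (-(Real.pi * J r ^ 2 * v)) : ℂ) with hF
  have hG : ∀ v, 0 < v → HasSum (fun r => F r v)
      (classTheta N j₀ α ξ v ((y + δ : ℝ) : ℂ) - classTheta N j₀ α ξ v ((y - δ : ℝ) : ℂ)) := by
    intro v hv
    refine ((hasSum_classTheta hN j₀ α ξ (y + δ) hv).sub
      (hasSum_classTheta hN j₀ α ξ (y - δ) hv)).congr_fun fun r => ?_
    simp only [hF, hW, hJ, classTerm]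
    rw [mul_add, show ((j₀ : ℝ) + r * N) * (y - δ) = (j₀ + r * N) * y + -((j₀ + r * N) * δ) by ring,
      cis_add, cis_add]
    ring
  have hint : ∀ r, ∫ v in Set.Ioc 0 V, F r v =
      W r * ((1 - Real.exp (-(Real.pi * J r ^ 2 * V))) / (Real.pi * J r ^ 2) : ℝ) := by
    intro r
    simp only [hF]
    rw [integral_const_mul]
    by_cases h0 : J r = 0
    · rw [hW0 r h0]; simp
    · rw [integral_complex_ofReal, integral_exp_neg_mul_Ioc (by positivity) hV0.le]
  have hFi : ∀ r, Integrable (F r) (volume.restrict (Set.Ioc 0 V)) := by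
    intro r
    have : Continuous (F r) := by simp only [hF]; fun_prop
    exact (this.integrableOn_Icc).mono_set Set.Ioc_subset_Icc_self
  have hJs : Summable fun r => 1 / J r ^ 2 := by
    simp_rw [hJc]
    exact (Real.summable_one_div_int_pow.2 one_lt_two).comp_injective (residue_injective hN j₀)
  have hFn : Summable fun r => ∫ v in Set.Ioc 0 V, ‖F r v‖ := by
    refine Summable.of_nonneg_of_le (fun r => integral_nonneg fun _ => norm_nonneg _) (fun r => ?_)
      (hJs.mul_left 2)
    simp only [hF, norm_mul, Complex.norm_real, Real.norm_eq_abs, Real.abs_exp]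
    rw [integral_const_mul]
    by_cases h0 : J r = 0
    · rw [hW0 r h0]; simp [h0]
    · rw [integral_exp_neg_mul_Ioc (by positivity) hV0.le]
      refine mul_le_mul (hW2 r) ?_ ?_ (by norm_num)
      · have h1 : 0 < J r ^ 2 := by positivity
        refine div_le_div₀ zero_le_one (by linarith [Real.exp_pos (-(Real.pi * J r ^ 2 * V))]) h1 ?_
        nlinarith [Real.pi_gt_three]
      · have : Real.exp (-(Real.pi * J r ^ 2 * V)) ≤ 1 := by
          rw [Real.exp_le_one_iff]
          have : 0 ≤ Real.pi * J r ^ 2 * V := by positivity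
          linarith
        exact div_nonneg (by linarith) (by positivity)
  have hsum1 := hasSum_integral_of_summable_integral_norm hFi hFn
  have hnorm1 : ‖∫ v in Set.Ioc 0 V, ∑' r, F r v‖ ≤ 8 * δ * K := by
    have hb : ∀ᵐ v ∂(volume.restrict (Set.Ioc 0 V)),
        ‖∑' r, F r v‖ ≤ 2 * δ * K * v ^ (-(3 / 4) : ℝ) := by
      refine (ae_restrict_iff' measurableSet_Ioc).2 (Filter.Eventually.of_forall fun v hv => ?_)
      rw [(hG v hv.1).tsum_eq]
      have hv1 : (N : ℝ) ^ 2 * v ≤ 1 := by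
        have := hv.2
        rw [hV, le_div_iff₀ (by positivity)] at this
        linarith
      refine (norm_classTheta_sub_le hN j₀ hα ξ hv.1 hv1 _ _).trans (le_of_eq ?_)
      rw [show y + δ - (y - δ) = 2 * δ by ring, abs_of_pos (by positivity)]
      ring
    have hi : Integrable (fun v : ℝ => 2 * δ * K * v ^ (-(3 / 4) : ℝ))
        (volume.restrict (Set.Ioc 0 V)) :=
      ((intervalIntegrable_iff_integrableOn_Ioc_of_le hV0.le).1
        (intervalIntegral.intervalIntegrable_rpow' (by norm_num))).const_mul _
    refine (norm_integral_le_of_norm_le hi hb).trans ?_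
    rw [integral_const_mul, integral_rpow_neg_three_quarters hV0.le]
    have : V ^ (1 / 4 : ℝ) ≤ 1 := Real.rpow_le_one hV0.le hV1 (by norm_num)
    calc _ ≤ 2 * δ * K * (4 * 1) := by gcongr
      _ = _ := by ring
  -- for `v ≥ 1 / N²` the theta bound is of no use, but the class has spacing `N`, so that the terms
  -- decay like a Gaussian in `r`
  set R : ℤ → ℂ := fun r => sawCoeff δ (j₀ + r * N) * cis (J r * y) * cis (α * r ^ 2 / 2 - r * ξ) *
    (Real.exp (-(Real.pi * J r ^ 2 * V)) : ℂ) with hR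
  have hRb : ∀ r, ‖R r‖ ≤ Real.exp (5 / 4) * Real.exp (-(1 * |(r : ℝ)|)) := by
    intro r
    simp only [hR, norm_mul, norm_cis, mul_one, Complex.norm_real, Real.norm_eq_abs, Real.abs_exp]
    have h1 : ‖sawCoeff δ (j₀ + r * N)‖ ≤ 1 := by
      refine (norm_sawCoeff_le_inv hδ _).trans ?_
      rcases eq_or_ne (j₀ + r * N) 0 with h0 | h0
      · rw [h0]; simp
      · have : (1 : ℝ) ≤ |((j₀ + r * N : ℤ) : ℝ)| := by exact_mod_cast Int.one_le_abs h0
        rw [div_le_one (by positivity)]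
        nlinarith [Real.pi_gt_three]
    have h2 := exp_neg_sq_le (x := (j₀ : ℝ) / N + r) one_pos le_rfl
    have hfl : ⌊(j₀ : ℝ) / N + r⌋ = r := by
      rw [Int.floor_add_intCast, Int.floor_eq_zero_iff.2, zero_add]
      have hj' : (0 : ℝ) ≤ j₀ := by exact_mod_cast hj
      exact ⟨by positivity, by rw [div_lt_one hN1]; exact_mod_cast hjN⟩
    rw [hfl] at h2
    have h3 : Real.exp (-(Real.pi * J r ^ 2 * V)) ≤
        Real.exp (-(1 ^ 2 * ((j₀ : ℝ) / N + r) ^ 2)) := by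
      rw [Real.exp_le_exp, neg_le_neg_iff]
      have : Real.pi * J r ^ 2 * V = Real.pi * ((j₀ : ℝ) / N + r) ^ 2 := by
        simp only [hJ, hV]; field_simp
      rw [this]
      have := Real.pi_gt_three
      gcongr
      linarith
    calc _ ≤ 1 * (Real.exp (5 / 4) * Real.exp (-(1 * |(r : ℝ)|))) := by
          exact mul_le_mul h1 (h3.trans h2) (Real.exp_nonneg _) zero_le_one
      _ = _ := one_mul _
  have hRs := (summable_exp_neg_abs_int one_pos).mul_left (Real.exp (5 / 4))
  have hRsum : Summable R := Summable.of_norm_bounded hRs hRb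
  have hnorm2 : ‖∑' r, R r‖ ≤ 3 * Real.exp (5 / 4) := by
    refine (tsum_of_norm_bounded hRs.hasSum hRb).trans ?_
    rw [tsum_mul_left]
    have := tsum_exp_neg_abs_int_le one_pos le_rfl
    nlinarith [Real.exp_pos (5 / 4)]
  have hsplit : ∀ r, sawCoeff δ (j₀ + r * N) * cis ((j₀ + r * N) * y) *
      cis (α * r ^ 2 / 2 - r * ξ) =
      ((1 / (8 * Real.pi * δ) : ℝ) : ℂ) * (∫ v in Set.Ioc 0 V, F r v) + R r := by
    intro r
    rw [hint]
    simp only [hR, sawCoeff, ← hJc]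
    by_cases h0 : J r = 0
    · rw [hW0 r h0]; simp [h0]
    · have h0' : (J r : ℂ) ≠ 0 := by exact_mod_cast h0
      have hδ' : (δ : ℂ) ≠ 0 := by exact_mod_cast hδ.ne'
      have hπ : (Real.pi : ℂ) ≠ 0 := by exact_mod_cast Real.pi_ne_zero
      simp only [hW]
      rw [show ((j₀ : ℝ) + r * N) * y = J r * y from rfl]
      push_cast
      field_simp
      ring
  simp_rw [hsplit]
  rw [((hsum1.summable).mul_left _).tsum_add hRsum, tsum_mul_left, hsum1.tsum_eq]
  refine (norm_add_le _ _).trans (add_le_add ?_ hnorm2)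
  rw [norm_mul, Complex.norm_real, Real.norm_of_nonneg (by positivity)]
  calc _ ≤ 1 / (8 * Real.pi * δ) * (8 * δ * K) := by gcongr
    _ = K / Real.pi := by field_simp
    _ ≤ K := div_le_self hK0 (by linarith [Real.pi_gt_three])

/-! ### The smoothed sawtooth -/

/-- The average of the sawtooth `Int.fract x - 1 / 2` over `[z - δ, z + δ]`, written with its
primitive, the periodic second Bernoulli function. -/
noncomputable def smoothSaw (δ z : ℝ) : ℝ :=
  (bernoulliFun 2 (Int.fract (z + δ)) - bernoulliFun 2 (Int.fract (z - δ))) / (4 * δ)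

/-- Smoothing changes the sawtooth only within distance `δ` of the integers. -/
theorem abs_saw_sub_smoothSaw_le {δ : ℝ} (hδ : 0 < δ) (hδ1 : δ ≤ 1 / 2) (z : ℝ) :
    |Int.fract z - 1 / 2 - smoothSaw δ z| ≤ Real.exp (1 - (z - round z) ^ 2 / δ ^ 2) := by
  have hf0 := Int.fract_nonneg z
  have hf1 := Int.fract_lt_one z
  set f := Int.fract z with hf
  have hz : z = f + ⌊z⌋ := by rw [hf]; exact (Int.fract_add_floor z).symm
  have key : ∀ (a : ℝ) (n : ℤ), f + a - n ∈ Set.Ico (0 : ℝ) 1 → Int.fract (z + a) = f + a - n := by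
    intro a n h
    rw [Int.fract_eq_iff]
    refine ⟨h.1, h.2, ⌊z⌋ + n, ?_⟩
    push_cast
    linarith
  have hmin : (z - round z) ^ 2 = (min f (1 - f)) ^ 2 := by
    rw [← abs_sub_round_eq_min, sq_abs]
  have hsmall : ∀ x : ℝ, |x| ≤ 1 → min f (1 - f) ≤ δ →
      |x| ≤ Real.exp (1 - (z - round z) ^ 2 / δ ^ 2) := by
    intro x hx hm
    refine hx.trans (Real.one_le_exp ?_)
    rw [hmin, sub_nonneg, div_le_one (by positivity)]
    have : 0 ≤ min f (1 - f) := le_min hf0 (by linarith)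
    gcongr
  unfold smoothSaw
  rw [sub_eq_add_neg z δ, bernoulliFun_two, bernoulliFun_two]
  rcases lt_or_ge f δ with h1 | h1
  · rw [key δ 0 (by constructor <;> simp <;> linarith),
      key (-δ) (-1) (by constructor <;> push_cast <;> linarith)]
    refine hsmall _ ?_ ((min_le_left _ _).trans h1.le)
    have e : f - 1 / 2 - ((f + δ - (0 : ℤ)) ^ 2 - (f + δ - (0 : ℤ)) + 6⁻¹ -
        ((f + -δ - (-1 : ℤ)) ^ 2 - (f + -δ - (-1 : ℤ)) + 6⁻¹)) / (4 * δ) = f / (2 * δ) - 1 / 2 := by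
      push_cast
      field_simp
      ring
    have h2 : f / (2 * δ) ≤ 1 := by rw [div_le_one (by positivity)]; linarith
    have h3 : 0 ≤ f / (2 * δ) := by positivity
    rw [e, abs_le]
    constructor <;> linarith
  · rcases lt_or_ge f (1 - δ) with h2 | h2
    · rw [key δ 0 (by constructor <;> simp <;> linarith),
        key (-δ) 0 (by constructor <;> push_cast <;> linarith)]
      have e : f - 1 / 2 - ((f + δ - (0 : ℤ)) ^ 2 - (f + δ - (0 : ℤ)) + 6⁻¹ -
          ((f + -δ - (0 : ℤ)) ^ 2 - (f + -δ - (0 : ℤ)) + 6⁻¹)) / (4 * δ) = 0 := by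
        push_cast
        field_simp
        ring
      rw [e, abs_zero]
      positivity
    · rw [key δ 1 (by constructor <;> push_cast <;> linarith),
        key (-δ) 0 (by constructor <;> push_cast <;> linarith)]
      refine hsmall _ ?_ ((min_le_right _ _).trans (by linarith))
      have e : f - 1 / 2 - ((f + δ - (1 : ℤ)) ^ 2 - (f + δ - (1 : ℤ)) + 6⁻¹ -
          ((f + -δ - (0 : ℤ)) ^ 2 - (f + -δ - (0 : ℤ)) + 6⁻¹)) / (4 * δ) =
          1 / 2 - (1 - f) / (2 * δ) := by
        push_cast
        field_simp
        ring
      have h3 : (1 - f) / (2 * δ) ≤ 1 := by rw [div_le_one (by positivity)]; linarith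
      have h4 : 0 ≤ (1 - f) / (2 * δ) := div_nonneg (by linarith) (by positivity)
      rw [e, abs_le]
      constructor <;> linarith

/-- The Fourier series of the periodic second Bernoulli function, with the junk value `1 / 0 ^ 2 = 0`
as its vanishing mean. -/
theorem hasSum_bernoulli_two (z : ℝ) :
    HasSum (fun j : ℤ => 1 / (j : ℂ) ^ 2 * cis (j * z))
      (2 * Real.pi ^ 2 * bernoulliFun 2 (Int.fract z) : ℂ) := by
  have h := hasSum_one_div_pow_mul_fourier_mul_bernoulliFun (k := 2) le_rfl
    (x := Int.fract z) ⟨Int.fract_nonneg z, (Int.fract_lt_one z).le⟩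
  have e : -(2 * (Real.pi : ℂ) * Complex.I) ^ 2 / (Nat.factorial 2 : ℂ) *
      (bernoulliFun 2 (Int.fract z) : ℂ) = 2 * Real.pi ^ 2 * bernoulliFun 2 (Int.fract z) := by
    rw [mul_pow, mul_pow, Complex.I_sq, Nat.factorial_two]
    push_cast
    ring
  rw [e] at h
  refine h.congr_fun fun j => ?_
  congr 1
  rw [fourier_coe_apply]
  have h1 : cis (j * z) = cis (j * Int.fract z) := by
    have : (j : ℝ) * z = j * Int.fract z + ((j * ⌊z⌋ : ℤ) : ℝ) := by
      nth_rewrite 1 [← Int.fract_add_floor z]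
      push_cast
      ring
    rw [this, cis_add_int]
  rw [h1, cis]
  congr 1
  push_cast
  ring

/-- The Fourier series of the smoothed sawtooth. It converges absolutely, unlike that of the
sawtooth itself. -/
theorem hasSum_smoothSaw {δ : ℝ} (hδ : 0 < δ) (z : ℝ) :
    HasSum (fun j : ℤ => sawCoeff δ j * cis (j * z)) (smoothSaw δ z : ℂ) := by
  have h := ((hasSum_bernoulli_two (z + δ)).sub (hasSum_bernoulli_two (z - δ))).mul_left
    (1 / (8 * Real.pi ^ 2 * δ) : ℂ)
  have hδ' : (δ : ℂ) ≠ 0 := by exact_mod_cast hδ.ne'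
  have hπ : (Real.pi : ℂ) ≠ 0 := by exact_mod_cast Real.pi_ne_zero
  have e : (1 / (8 * Real.pi ^ 2 * δ) : ℂ) * (2 * Real.pi ^ 2 * bernoulliFun 2 (Int.fract (z + δ)) -
      2 * Real.pi ^ 2 * bernoulliFun 2 (Int.fract (z - δ))) = (smoothSaw δ z : ℂ) := by
    unfold smoothSaw
    push_cast
    field_simp
    ring
  rw [e] at h
  refine h.congr_fun fun j => ?_
  rw [mul_add, show (j : ℝ) * (z - δ) = j * z + -(j * δ) by ring, cis_add, cis_add]
  unfold sawCoeff
  push_cast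
  rcases eq_or_ne j 0 with rfl | hj
  · simp
  have hj' : (j : ℂ) ≠ 0 := by exact_mod_cast hj
  field_simp

/-! ### Damped quadratic exponential sums -/

/-- The general term `exp (-π v k²) e(α k² / 2 + k ξ)` of a damped quadratic exponential sum. -/
noncomputable def dampedPhase (α v ξ : ℝ) (k : ℤ) : ℂ :=
  (Real.exp (-(Real.pi * v * (k : ℝ) ^ 2)) : ℂ) * cis (α * (k : ℝ) ^ 2 / 2 + k * ξ)

theorem norm_dampedPhase (α v ξ : ℝ) (k : ℤ) :
    ‖dampedPhase α v ξ k‖ = Real.exp (-(Real.pi * v * (k : ℝ) ^ 2)) := by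
  unfold dampedPhase
  rw [norm_mul, norm_cis, mul_one, Complex.norm_real, Real.norm_of_nonneg (Real.exp_nonneg _)]

theorem hasSum_dampedPhase (α ξ : ℝ) {v : ℝ} (hv : 0 < v) :
    HasSum (dampedPhase α v ξ) (jacobiTheta₂ ξ (α + v * Complex.I)) := by
  refine (hasSum_jacobiTheta₂_term ξ (τ := α + v * Complex.I) (by simpa using hv)).congr_fun
    fun k => ?_
  unfold dampedPhase cis jacobiTheta₂_term
  rw [Complex.ofReal_exp, ← Complex.exp_add]
  congr 1
  push_cast
  ring_nf
  simp only [Complex.I_sq]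
  ring

theorem summable_gauss_int {v : ℝ} (hv : 0 < v) :
    Summable fun k : ℤ => Real.exp (-(Real.pi * v * (k : ℝ) ^ 2)) := by
  have h := (hasSum_dampedPhase 0 0 hv).summable.norm
  simpa only [norm_dampedPhase] using h

/-- The total variation of the discrete Gaussian is at most `2`. -/
theorem hasSum_abs_gauss_sub {v : ℝ} (hv : 0 < v) :
    HasSum (fun k : ℤ => |Real.exp (-(Real.pi * v * (k : ℝ) ^ 2)) -
      Real.exp (-(Real.pi * v * ((k + 1 : ℤ) : ℝ) ^ 2))|) 2 := by
  have hπ := Real.pi_pos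
  have hmono : ∀ n : ℕ, Real.exp (-(Real.pi * v * ((n + 1 : ℕ) : ℝ) ^ 2)) ≤
      Real.exp (-(Real.pi * v * (n : ℝ) ^ 2)) := by
    intro n
    rw [Real.exp_le_exp, neg_le_neg_iff]
    gcongr
    linarith
  have hlim : Filter.Tendsto (fun n : ℕ => Real.exp (-(Real.pi * v * (n : ℝ) ^ 2))) Filter.atTop
      (nhds 0) := by
    have := ((summable_gauss_int hv).comp_injective Nat.cast_injective).tendsto_atTop_zero
    simpa [Function.comp_def] using this
  have h1 : HasSum (fun n : ℕ => Real.exp (-(Real.pi * v * (n : ℝ) ^ 2)) -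
      Real.exp (-(Real.pi * v * ((n + 1 : ℕ) : ℝ) ^ 2))) 1 := by
    rw [hasSum_iff_tendsto_nat_of_nonneg fun n => sub_nonneg.2 (hmono n)]
    simp_rw [Finset.sum_range_sub' (fun n : ℕ => Real.exp (-(Real.pi * v * (n : ℝ) ^ 2)))]
    simpa using hlim.const_sub (1 : ℝ)
  rw [show (2 : ℝ) = 1 + 1 by norm_num]
  refine HasSum.of_nat_of_neg_add_one ?_ ?_
  · refine h1.congr_fun fun n => ?_
    rw [← abs_of_nonneg (sub_nonneg.2 (hmono n))]
    push_cast
    rfl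
  · refine h1.congr_fun fun n => ?_
    rw [← abs_of_nonneg (sub_nonneg.2 (hmono n)), abs_sub_comm]
    push_cast
    ring_nf

/-- Translating the variable of the theta function by its modulus amounts to shifting the
Gaussian weight by one step. -/
theorem norm_theta_add_sub_le (α ξ : ℝ) {v : ℝ} (hv : 0 < v) :
    ‖jacobiTheta₂ ((ξ + α : ℝ) : ℂ) (α + v * Complex.I) -
      cis (-(α / 2) - ξ) * jacobiTheta₂ ξ (α + v * Complex.I)‖ ≤ 2 := by
  have h1 := hasSum_dampedPhase α (ξ + α) hv
  have h2 := (Equiv.addRight (1 : ℤ)).hasSum_iff.2 (hasSum_dampedPhase α ξ hv)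
  have h3 := h1.sub (h2.mul_left (cis (-(α / 2) - ξ)))
  rw [← h3.tsum_eq]
  refine tsum_of_norm_bounded (hasSum_abs_gauss_sub hv) fun k => le_of_eq ?_
  simp only [Function.comp_apply, Equiv.coe_addRight]
  have e : dampedPhase α v (ξ + α) k - cis (-(α / 2) - ξ) * dampedPhase α v ξ (k + 1) =
      ((Real.exp (-(Real.pi * v * (k : ℝ) ^ 2)) -
        Real.exp (-(Real.pi * v * ((k + 1 : ℤ) : ℝ) ^ 2)) : ℝ) : ℂ) *
        cis (α * (k : ℝ) ^ 2 / 2 + k * (ξ + α)) := by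
    unfold dampedPhase
    rw [mul_left_comm, ← cis_add]
    rw [show -(α / 2) - ξ + (α * ((k + 1 : ℤ) : ℝ) ^ 2 / 2 + ((k + 1 : ℤ) : ℝ) * ξ) =
      α * (k : ℝ) ^ 2 / 2 + k * (ξ + α) by push_cast; ring]
    rw [Complex.ofReal_sub]
    ring
  rw [e, norm_mul, norm_cis, mul_one, Complex.norm_real, Real.norm_eq_abs]

/-- The theta function is quasi-periodic under translation by its modulus, up to an error
that grows linearly. -/
theorem norm_theta_add_int_mul_sub_le (α ξ : ℝ) {v : ℝ} (hv : 0 < v) (r : ℤ) :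
    ‖jacobiTheta₂ ((ξ + r * α : ℝ) : ℂ) (α + v * Complex.I) -
      cis (-α * r ^ 2 / 2 - r * ξ) * jacobiTheta₂ ξ (α + v * Complex.I)‖ ≤ 2 * |(r : ℝ)| := by
  have hnat : ∀ (ξ : ℝ) (n : ℕ), ‖jacobiTheta₂ ((ξ + n * α : ℝ) : ℂ) (α + v * Complex.I) -
      cis (-α * n ^ 2 / 2 - n * ξ) * jacobiTheta₂ ξ (α + v * Complex.I)‖ ≤ 2 * n := by
    intro ξ n
    induction n with
    | zero => simp [cis_zero]
    | succ n ih =>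
      have h1 := norm_theta_add_sub_le α (ξ + n * α) hv
      have e1 : ξ + ((n + 1 : ℕ) : ℝ) * α = ξ + n * α + α := by push_cast; ring
      have e2 : cis (-α * ((n + 1 : ℕ) : ℝ) ^ 2 / 2 - ((n + 1 : ℕ) : ℝ) * ξ) =
          cis (-(α / 2) - (ξ + n * α)) * cis (-α * n ^ 2 / 2 - n * ξ) := by
        rw [← cis_add]; congr 1; push_cast; ring
      rw [e1, e2]
      set P := jacobiTheta₂ ((ξ + n * α + α : ℝ) : ℂ) (α + v * Complex.I)
      set Q := jacobiTheta₂ ((ξ + n * α : ℝ) : ℂ) (α + v * Complex.I)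
      set R := jacobiTheta₂ (ξ : ℂ) (α + v * Complex.I)
      have e3 : P - cis (-(α / 2) - (ξ + n * α)) * cis (-α * n ^ 2 / 2 - n * ξ) * R =
          (P - cis (-(α / 2) - (ξ + n * α)) * Q) +
            cis (-(α / 2) - (ξ + n * α)) * (Q - cis (-α * n ^ 2 / 2 - n * ξ) * R) := by ring
      rw [e3]
      refine (norm_add_le _ _).trans ?_
      rw [norm_mul, norm_cis, one_mul]
      push_cast
      linarith
  obtain ⟨n, rfl | rfl⟩ := r.eq_nat_or_neg
  · simpa using hnat ξ n
  · have h := hnat (ξ - n * α) n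
    rw [sub_add_cancel, norm_sub_rev] at h
    have e1 : ξ + ((-(n : ℤ) : ℤ) : ℝ) * α = ξ - n * α := by push_cast; ring
    have e2 : |((-(n : ℤ) : ℤ) : ℝ)| = n := by push_cast; rw [abs_neg, Nat.abs_cast]
    rw [e1, e2]
    refine le_trans (le_of_eq ?_) h
    have e3 : cis (-α * ((-(n : ℤ) : ℤ) : ℝ) ^ 2 / 2 - ((-(n : ℤ) : ℤ) : ℝ) * ξ) *
        cis (-α * n ^ 2 / 2 - n * (ξ - n * α)) = 1 := by
      rw [← cis_add, ← cis_zero]; congr 1; push_cast; ring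
    rw [← one_mul ‖_ - _‖, ← norm_cis (-α * n ^ 2 / 2 - n * (ξ - n * α)), ← norm_mul]
    congr 1
    rw [mul_sub, ← mul_assoc, mul_comm (cis _) (cis (-α * ((-(n : ℤ) : ℤ) : ℝ) ^ 2 / 2 - _)), e3,
      one_mul]

/-! ### Weights on the integers -/

/-- A telescoping series whose terms dominate, for `b ≤ 1` and up to a factor `2 / b`, the weights
`1 / (1 + b n)²`. -/
theorem hasSum_weight_nat {b : ℝ} (hb : 0 < b) :
    HasSum (fun n : ℕ => 1 / (1 + b * n) - 1 / (1 + b * ((n + 1 : ℕ) : ℝ))) 1 := by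
  have hlim : Filter.Tendsto (fun n : ℕ => 1 / (1 + b * (n : ℝ))) Filter.atTop (nhds 0) := by
    refine Filter.Tendsto.div_atTop tendsto_const_nhds ?_
    exact Filter.tendsto_atTop_add_const_left _ _
      (Filter.Tendsto.const_mul_atTop hb tendsto_natCast_atTop_atTop)
  rw [hasSum_iff_tendsto_nat_of_nonneg]
  · simp_rw [Finset.sum_range_sub' (fun n : ℕ => 1 / (1 + b * (n : ℝ)))]
    simpa using hlim.const_sub (1 : ℝ)
  · intro n
    rw [sub_nonneg]
    push_cast
    refine one_div_le_one_div_of_le (by positivity) ?_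
    nlinarith

theorem summable_weight_int {b : ℝ} (hb : 0 < b) (hb1 : b ≤ 1) :
    Summable (fun j : ℤ => 1 / (1 + b * |(j : ℝ)|) ^ 2) ∧
      ∑' j : ℤ, 1 / (1 + b * |(j : ℝ)|) ^ 2 ≤ 3 / b := by
  have h0 : ∀ n : ℕ, 1 / (1 + b * ((n + 1 : ℕ) : ℝ)) ^ 2 ≤
      1 / b * (1 / (1 + b * n) - 1 / (1 + b * ((n + 1 : ℕ) : ℝ))) := by
    intro n
    have h1 : (0 : ℝ) < 1 + b * n := by positivity
    have h2 : (0 : ℝ) < 1 + b * ((n + 1 : ℕ) : ℝ) := by positivity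
    have h3 : 1 / b * (1 / (1 + b * n) - 1 / (1 + b * ((n + 1 : ℕ) : ℝ))) =
        1 / ((1 + b * n) * (1 + b * ((n + 1 : ℕ) : ℝ))) := by
      push_cast at *
      field_simp
      ring
    rw [h3, sq]
    refine one_div_le_one_div_of_le (by positivity) ?_
    gcongr
    linarith
  have hs := (hasSum_weight_nat hb).mul_left (1 / b)
  have hs1 : Summable fun n : ℕ => 1 / (1 + b * ((n + 1 : ℕ) : ℝ)) ^ 2 :=
    Summable.of_nonneg_of_le (fun _ => by positivity) h0 hs.summable
  have hs1le : ∑' n : ℕ, 1 / (1 + b * ((n + 1 : ℕ) : ℝ)) ^ 2 ≤ 1 / b := by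
    have := hs1.tsum_le_tsum h0 hs.summable
    rwa [hs.tsum_eq, mul_one] at this
  have hs2 : HasSum (fun n : ℕ => 1 / (1 + b * (n : ℝ)) ^ 2)
      (1 + ∑' n : ℕ, 1 / (1 + b * ((n + 1 : ℕ) : ℝ)) ^ 2) := by
    have := (hasSum_nat_add_iff (f := fun n : ℕ => 1 / (1 + b * (n : ℝ)) ^ 2) 1).1 hs1.hasSum
    simpa [add_comm] using this
  have h := HasSum.of_nat_of_neg_add_one (f := fun j : ℤ => 1 / (1 + b * |(j : ℝ)|) ^ 2)
    (hs2.congr_fun fun n => by simp) (hs1.hasSum.congr_fun fun n => by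
      have : |((-((n : ℤ) + 1) : ℤ) : ℝ)| = ((n + 1 : ℕ) : ℝ) := by
        push_cast
        rw [abs_of_nonpos (by linarith [Nat.cast_nonneg (α := ℝ) n])]
        ring
      rw [this])
  refine ⟨h.summable, ?_⟩
  rw [h.tsum_eq]
  have h5 : 1 ≤ 1 / b := by rw [le_div_iff₀ hb]; linarith
  have h6 : 3 / b = 1 / b + 1 / b + 1 / b := by ring
  linarith

/-! ### Birkhoff sums of the sawtooth over the skew rotation -/

/-- A residue `0 ≤ i < N` cannot bring `i + r N` closer to `0` than `|r|`. -/
theorem abs_le_abs_residue {N : ℕ} {i : ℤ} (hi : 0 ≤ i) (hiN : i < N) (r : ℤ) :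
    |(r : ℝ)| ≤ |((i + r * N : ℤ) : ℝ)| := by
  have hN : (1 : ℤ) ≤ N := by linarith
  have h : |r| ≤ |i + r * N| := by
    rcases le_or_gt 0 r with hr | hr
    · rw [abs_of_nonneg hr, abs_of_nonneg (by positivity)]
      nlinarith
    · have : i + r * N ≤ r := by nlinarith
      rw [abs_of_neg hr, abs_of_nonpos (by linarith)]
      linarith
  exact_mod_cast h

/-- Splitting of the integers into residue classes modulo `N`. -/
theorem tsum_residue {N : ℕ} [NeZero N] {g : ℤ → ℂ} (hg : Summable g) :
    ∑' j, g j = ∑ i : Fin N, ∑' r : ℤ, g ((i : ℕ) + r * N) := by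
  set E := (Equiv.prodComm (Fin N) ℤ).trans (Int.divModEquiv N).symm with hE
  have hEa : ∀ p : Fin N × ℤ, E p = ((p.1 : ℕ) : ℤ) + p.2 * N := fun p => by
    simp only [hE, Equiv.trans_apply, Equiv.prodComm_apply, Int.divModEquiv, Equiv.coe_fn_symm_mk,
      Prod.fst_swap, Prod.snd_swap]
    ring
  have hs : Summable fun p => g (E p) := (E.summable_iff (f := g)).2 hg
  rw [← E.tsum_eq g, hs.tsum_prod, tsum_fintype]
  simp only [hEa]

/-- Birkhoff sums of the smoothed sawtooth, expanded in Fourier modes. Modes that differ by a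
multiple of `N` are cohomologous over the skew rotation, so that the modes of each residue class
recombine into a single theta function times a bounded factor. -/
theorem norm_tsum_dampedPhase_smoothSaw_le {N : ℕ} [NeZero N] {t : ℝ}
    (ht : BadlyApproximable (1 / 3) t) {b : ℝ} (hb : 0 < b) (hb1 : b ≤ 1) (ξ y : ℝ) :
    ‖∑' k : ℤ, dampedPhase (N * t) (b ^ 4) ξ k * smoothSaw (b / 2) (y + k * t)‖ ≤
      N * (thetaConst * Real.sqrt N / b) * (thetaConst * Real.exp Real.pi + 3 * Real.exp (5 / 4)) +
        12 * (1 + thetaConst * Real.sqrt N) / b := by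
  have hN : N ≠ 0 := NeZero.ne N
  have hc := thetaConst_nonneg
  set v : ℝ := b ^ 4 with hv
  have hv0 : 0 < v := by positivity
  have hv1 : v ≤ 1 := pow_le_one₀ hb.le hb1
  set α : ℝ := N * t with hα
  have hαb : BadlyApproximable (1 / 3 / N) α := ht.nat_mul hN
  have hb4 : v ^ (-(1 / 4) : ℝ) = 1 / b := by
    rw [hv, ← Real.rpow_natCast, ← Real.rpow_mul hb.le]
    norm_num
    exact Real.rpow_neg_one b
  set A : ℝ → ℂ := fun x => jacobiTheta₂ x (α + v * Complex.I) with hA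
  set S : ℝ := thetaConst * Real.sqrt N with hS
  have hS0 : 0 ≤ S := by positivity
  have hAb : ∀ x, ‖A x‖ ≤ S / b := by
    intro x
    refine (norm_jacobiTheta₂_le hN hαb hv0 hv1 x).trans (le_of_eq ?_)
    rw [hb4]
    simp
    ring
  set c : ℤ → ℂ := sawCoeff (b / 2) with hcdef
  have hcs : Summable fun j => ‖c j‖ := summable_norm_sawCoeff (by positivity)
  have hds : Summable fun k => ‖dampedPhase α v ξ k‖ := (hasSum_dampedPhase α ξ hv0).summable.norm
  -- expansion in Fourier modes
  have hexp : ∑' k : ℤ, dampedPhase α v ξ k * smoothSaw (b / 2) (y + k * t) =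
      ∑' j : ℤ, c j * cis (j * y) * A (ξ + j * t) := by
    have h1 : ∀ k : ℤ, dampedPhase α v ξ k * smoothSaw (b / 2) (y + k * t) =
        ∑' j : ℤ, dampedPhase α v ξ k * (c j * cis (j * (y + k * t))) := fun k => by
      rw [tsum_mul_left, (hasSum_smoothSaw (by positivity) _).tsum_eq]
    have h2 : ∀ j : ℤ, c j * cis (j * y) * A (ξ + j * t) =
        ∑' k : ℤ, dampedPhase α v ξ k * (c j * cis (j * (y + k * t))) := fun j => by
      rw [hA]
      simp only
      rw [← (hasSum_dampedPhase α (ξ + j * t) hv0).tsum_eq, ← tsum_mul_left]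
      congr 1
      ext k
      have e1 : cis (α * (k : ℝ) ^ 2 / 2 + k * (ξ + j * t)) =
          cis (α * (k : ℝ) ^ 2 / 2 + k * ξ) * cis (j * (k * t)) := by
        rw [← cis_add]; congr 1; ring
      have e2 : cis (j * (y + k * t)) = cis (j * y) * cis (j * (k * t)) := by
        rw [← cis_add]; congr 1; ring
      unfold dampedPhase
      rw [e1, e2]
      ring
    simp_rw [h1, h2]
    refine Summable.tsum_comm ?_
    refine Summable.of_norm_bounded (hcs.mul_of_nonneg hds (fun _ => norm_nonneg _)
      (fun _ => norm_nonneg _)) fun p => le_of_eq ?_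
    simp only [Function.uncurry, norm_mul, norm_cis, mul_one]
    ring
  rw [hexp]
  set g : ℤ → ℂ := fun j => c j * cis (j * y) * A (ξ + j * t) with hg
  have hgb : ∀ j, ‖g j‖ ≤ ‖c j‖ * (S / b) := fun j => by
    simp only [hg, norm_mul, norm_cis, mul_one]
    exact mul_le_mul_of_nonneg_left (hAb _) (norm_nonneg _)
  have hgs : Summable g := Summable.of_norm_bounded (hcs.mul_right _) hgb
  -- replace every mode by the representative of its residue class; the theta function is
  -- quasi-periodic only approximately, and the error is small for low modes, while the decay of the
  -- Fourier coefficients controls the high ones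
  set g₁ : ℤ → ℂ := fun j => c j * cis (j * y) *
    (cis (-α * ((j / N : ℤ) : ℝ) ^ 2 / 2 - ((j / N : ℤ) : ℝ) * (ξ + ((j % N : ℤ) : ℝ) * t)) *
      A (ξ + ((j % N : ℤ) : ℝ) * t)) with hg₁
  have hg₁b : ∀ j, ‖g₁ j‖ ≤ ‖c j‖ * (S / b) := fun j => by
    simp only [hg₁, norm_mul, norm_cis, mul_one, one_mul]
    exact mul_le_mul_of_nonneg_left (hAb _) (norm_nonneg _)
  have hg₁s : Summable g₁ := Summable.of_norm_bounded (hcs.mul_right _) hg₁b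
  have hdiff : ∀ j, ‖g j - g₁ j‖ ≤ 4 * (1 + S) * (1 / (1 + b * |(j : ℝ)|) ^ 2) := by
    intro j
    have hNz : (N : ℤ) ≠ 0 := by exact_mod_cast hN
    have e1 : ξ + j * t = ξ + ((j % N : ℤ) : ℝ) * t + ((j / N : ℤ) : ℝ) * α := by
      have : (j : ℝ) = ((j % N : ℤ) : ℝ) + ((j / N : ℤ) : ℝ) * N := by
        have := Int.emod_add_ediv_mul j N
        exact_mod_cast this.symm
      nth_rewrite 1 [this]
      rw [hα]
      ring
    have h1 := norm_theta_add_int_mul_sub_le α (ξ + ((j % N : ℤ) : ℝ) * t) hv0 (j / N)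
    rw [← e1] at h1
    set err := jacobiTheta₂ ((ξ + j * t : ℝ) : ℂ) (α + v * Complex.I) -
      cis (-α * ((j / N : ℤ) : ℝ) ^ 2 / 2 - ((j / N : ℤ) : ℝ) * (ξ + ((j % N : ℤ) : ℝ) * t)) *
        jacobiTheta₂ ((ξ + ((j % N : ℤ) : ℝ) * t : ℝ) : ℂ) (α + v * Complex.I) with herr
    have h2 : |((j / N : ℤ) : ℝ)| ≤ |(j : ℝ)| := by
      have := abs_le_abs_residue (N := N) (Int.emod_nonneg j hNz)
        (Int.emod_lt_of_pos j (by positivity)) (j / N)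
      rwa [Int.emod_add_ediv_mul] at this
    have h3 : ‖err‖ ≤ 2 * (S / b) := by
      refine (norm_sub_le _ _).trans ?_
      rw [norm_mul, norm_cis, one_mul]
      have := hAb (ξ + j * t)
      have := hAb (ξ + ((j % N : ℤ) : ℝ) * t)
      simp only [hA] at *
      linarith
    have e2 : ‖g j - g₁ j‖ = ‖c j‖ * ‖err‖ := by
      have : g j - g₁ j = c j * cis (j * y) * err := by
        simp only [hg, hg₁, hA, herr]; ring
      rw [this, norm_mul, norm_mul, norm_cis, mul_one]
    rw [e2]
    have hπ := Real.pi_gt_three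
    rcases eq_or_ne j 0 with rfl | hj
    · have : c 0 = 0 := by simp [hcdef, sawCoeff]
      rw [this, norm_zero, zero_mul]
      positivity
    have hj0 : 0 < |(j : ℝ)| := abs_pos.2 (by exact_mod_cast hj)
    rcases le_or_gt (b * |(j : ℝ)|) 1 with hbj | hbj
    · have h4 : ‖c j‖ * ‖err‖ ≤ 1 := by
        calc _ ≤ 1 / (2 * Real.pi * |(j : ℝ)|) * (2 * |(j : ℝ)|) :=
              mul_le_mul (norm_sawCoeff_le_inv (by positivity) j) (by linarith) (norm_nonneg _)
                (by positivity)
          _ = 1 / Real.pi := by field_simp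
          _ ≤ 1 := by rw [div_le_one (by positivity)]; linarith
      refine h4.trans ?_
      rw [mul_one_div, le_div_iff₀ (by positivity)]
      have h5 : 0 ≤ b * |(j : ℝ)| := by positivity
      nlinarith
    · have h4 : ‖c j‖ * ‖err‖ ≤ S * (1 / (b * |(j : ℝ)|) ^ 2) := by
        calc _ ≤ 1 / (4 * Real.pi ^ 2 * (b / 2)) * (1 / (j : ℝ) ^ 2) * (2 * (S / b)) :=
              mul_le_mul (norm_sawCoeff_le_inv_sq (by positivity) j) h3 (norm_nonneg _)
                (by positivity)
          _ = S * (1 / (b * |(j : ℝ)|) ^ 2) * (1 / Real.pi ^ 2) := by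
              rw [mul_pow, sq_abs]
              field_simp
              norm_num
          _ ≤ S * (1 / (b * |(j : ℝ)|) ^ 2) * 1 := by
              gcongr
              rw [div_le_one (by positivity)]
              nlinarith
          _ = _ := mul_one _
      refine h4.trans ?_
      have h5 : 1 / (b * |(j : ℝ)|) ^ 2 ≤ 4 * (1 / (1 + b * |(j : ℝ)|) ^ 2) := by
        rw [mul_one_div, div_le_div_iff₀ (by positivity) (by positivity)]
        nlinarith
      calc _ ≤ S * (4 * (1 / (1 + b * |(j : ℝ)|) ^ 2)) := by gcongr
        _ ≤ _ := by
          have : 0 ≤ 1 / (1 + b * |(j : ℝ)|) ^ 2 := by positivity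
          nlinarith
  obtain ⟨hw, hwle⟩ := summable_weight_int hb hb1
  have herr : ‖∑' j, (g j - g₁ j)‖ ≤ 12 * (1 + S) / b := by
    refine (tsum_of_norm_bounded (hw.mul_left _).hasSum hdiff).trans ?_
    rw [tsum_mul_left]
    calc _ ≤ 4 * (1 + S) * (3 / b) := by gcongr
      _ = _ := by ring
  have hmain : ‖∑' j, g₁ j‖ ≤
      N * (S / b) * (thetaConst * Real.exp Real.pi + 3 * Real.exp (5 / 4)) := by
    rw [tsum_residue (N := N) hg₁s]
    have hterm : ∀ i : Fin N, ‖∑' r : ℤ, g₁ ((i : ℕ) + r * N)‖ ≤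
        S / b * (thetaConst * Real.exp Real.pi + 3 * Real.exp (5 / 4)) := by
      intro i
      have hiN : ((i : ℕ) : ℤ) < N := by exact_mod_cast i.isLt
      have hi0 : (0 : ℤ) ≤ ((i : ℕ) : ℤ) := by positivity
      have e : ∀ r : ℤ, g₁ ((i : ℕ) + r * N) = A (ξ + ((i : ℕ) : ℝ) * t) *
          (sawCoeff (b / 2) (((i : ℕ) : ℤ) + r * N) * cis ((((i : ℕ) : ℤ) + r * N) * y) *
            cis (-α * r ^ 2 / 2 - r * (ξ + ((i : ℕ) : ℝ) * t))) := by
        intro r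
        have hdiv : (((i : ℕ) : ℤ) + r * N) / N = r := by
          rw [Int.add_mul_ediv_right _ _ (by exact_mod_cast hN), Int.ediv_eq_zero_of_lt hi0 hiN,
            zero_add]
        have hmod : (((i : ℕ) : ℤ) + r * N) % N = ((i : ℕ) : ℤ) := by
          rw [Int.add_mul_emod_self_right, Int.emod_eq_of_lt hi0 hiN]
        simp only [hg₁, hdiv, hmod, hcdef]
        push_cast
        ring
      simp_rw [e]
      rw [tsum_mul_left, norm_mul]
      exact mul_le_mul (hAb _) (norm_tsum_sawCoeff_class_le hN hi0 hiN hαb.neg (by positivity) _ _)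
        (norm_nonneg _) (by positivity)
    refine (norm_sum_le_of_le _ fun i _ => hterm i).trans (le_of_eq ?_)
    rw [Finset.sum_const, Finset.card_univ, Fintype.card_fin, nsmul_eq_mul]
    ring
  have hfin : ∑' j, g j = ∑' j, g₁ j + ∑' j, (g j - g₁ j) := by
    rw [← hg₁s.tsum_add (hgs.sub hg₁s)]
    congr 1
    ext j
    ring
  rw [hfin]
  exact (norm_add_le _ _).trans (add_le_add hmain herr)

/-- A numerical constant in the bound for the Birkhoff sums of the sawtooth. -/
noncomputable def sawConst : ℝ :=
  45 * Real.exp (7 / 2) + 12 * (1 + thetaConst) +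
    thetaConst * (thetaConst * Real.exp Real.pi + 3 * Real.exp (5 / 4))

theorem sawConst_nonneg : 0 ≤ sawConst := by
  have := thetaConst_nonneg
  unfold sawConst
  positivity

theorem summable_dampedPhase_mul {α v ξ : ℝ} (hv : 0 < v) {g : ℤ → ℂ} {C : ℝ}
    (hg : ∀ k, ‖g k‖ ≤ C) : Summable fun k : ℤ => dampedPhase α v ξ k * g k := by
  refine Summable.of_norm_bounded ((summable_gauss_int hv).mul_right C) fun k => ?_
  rw [norm_mul, norm_dampedPhase]
  exact mul_le_mul_of_nonneg_left (hg k) (Real.exp_nonneg _)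

/-- Square root cancellation in the Birkhoff sums of the sawtooth. The loss is polynomial in `N`,
and there is no logarithmic loss in the length `b⁻²` of the sum. -/
theorem norm_tsum_dampedPhase_saw_le {N : ℕ} [NeZero N] {t : ℝ}
    (ht : BadlyApproximable (1 / 3) t) {b : ℝ} (hb : 0 < b) (hb1 : b ≤ 1) (ξ y : ℝ) :
    ‖∑' k : ℤ, dampedPhase (N * t) (b ^ 4) ξ k *
      ((Int.fract (y + k * t) - 1 / 2 : ℝ) : ℂ)‖ ≤ sawConst * N ^ 2 / b := by
  have hN1 : (1 : ℝ) ≤ N := by exact_mod_cast Nat.one_le_iff_ne_zero.2 (NeZero.ne N)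
  have hc := thetaConst_nonneg
  have hv0 : 0 < b ^ 4 := by positivity
  have hδ : 0 < b / 2 := by positivity
  -- smoothing at scale `b` affects only the `O(b⁻¹)` of the `b⁻²` points that come close to the jump
  obtain ⟨hL1, hL2⟩ := lattice_gaussian_sum (A := Real.pi * b ^ 4) (B := 1 / (b / 2) ^ 2)
    (by norm_num) ht (by positivity) (by positivity) y
  have hnear : ∀ k : ℤ, ‖dampedPhase (N * t) (b ^ 4) ξ k *
      ((Int.fract (y + k * t) - 1 / 2 - smoothSaw (b / 2) (y + k * t) : ℝ) : ℂ)‖ ≤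
      Real.exp 1 * Real.exp (-(Real.pi * b ^ 4 * (k : ℝ) ^ 2 + 1 / (b / 2) ^ 2 *
        (y + t * k + (-round (y + k * t) : ℤ)) ^ 2)) := by
    intro k
    rw [norm_mul, norm_dampedPhase, Complex.norm_real, Real.norm_eq_abs]
    refine (mul_le_mul_of_nonneg_left (abs_saw_sub_smoothSaw_le hδ (by linarith) _)
      (Real.exp_nonneg _)).trans (le_of_eq ?_)
    rw [← Real.exp_add, ← Real.exp_add]
    congr 1
    push_cast
    ring
  have hinj : Function.Injective fun k : ℤ => (k, -round (y + k * t)) := fun k k' h =>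
    (Prod.mk.inj h).1
  have hsn := (hL1.comp_injective hinj).mul_left (Real.exp 1)
  have h1 : ‖∑' k : ℤ, dampedPhase (N * t) (b ^ 4) ξ k *
      ((Int.fract (y + k * t) - 1 / 2 - smoothSaw (b / 2) (y + k * t) : ℝ) : ℂ)‖ ≤
      45 * Real.exp (7 / 2) / b := by
    refine (tsum_of_norm_bounded hsn.hasSum hnear).trans ?_
    rw [tsum_mul_left]
    have h2 := (tsum_comp_le_tsum_of_inj hL1 (fun _ => Real.exp_nonneg _) hinj).trans hL2
    have h3 : 1 / (1 / 3 * Real.sqrt (Real.pi * b ^ 4 * (1 / (b / 2) ^ 2))) ≤ 3 / b := by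
      have h4 : b ≤ Real.sqrt (Real.pi * b ^ 4 * (1 / (b / 2) ^ 2)) := by
        refine Real.le_sqrt_of_sq_le ?_
        have : Real.pi * b ^ 4 * (1 / (b / 2) ^ 2) = 4 * Real.pi * b ^ 2 := by field_simp; norm_num
        rw [this]
        nlinarith [Real.pi_gt_three, sq_nonneg b]
      rw [div_le_div_iff₀ (by positivity) hb]
      linarith
    have h5 : 1 / Real.sqrt (1 / (b / 2) ^ 2) ≤ 1 := by
      rw [Real.sqrt_div zero_le_one, Real.sqrt_one, Real.sqrt_sq hδ.le, one_div_one_div]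
      linarith
    have h6 : 1 ≤ 1 / b := by rw [le_div_iff₀ hb]; linarith
    have h7 : 3 / b = 3 * (1 / b) := by ring
    calc _ ≤ Real.exp 1 * (9 * Real.exp (5 / 2) * (1 / b + 3 / b + 1 / b)) := by
          refine mul_le_mul_of_nonneg_left (h2.trans ?_) (Real.exp_nonneg _)
          exact mul_le_mul_of_nonneg_left (by linarith) (by positivity)
      _ = 45 * (Real.exp 1 * Real.exp (5 / 2)) / b := by ring
      _ = _ := by rw [← Real.exp_add]; norm_num
  have hbd1 : ∀ k : ℤ, ‖((Int.fract (y + k * t) - 1 / 2 : ℝ) : ℂ)‖ ≤ 1 / 2 := by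
    intro k
    rw [Complex.norm_real, Real.norm_eq_abs, abs_le]
    have := Int.fract_nonneg (y + k * t)
    have := (Int.fract_lt_one (y + k * t)).le
    constructor <;> linarith
  have hs1 := summable_dampedPhase_mul (α := N * t) (ξ := ξ) hv0 hbd1
  have hs3 : Summable fun k : ℤ => dampedPhase (N * t) (b ^ 4) ξ k *
      ((Int.fract (y + k * t) - 1 / 2 - smoothSaw (b / 2) (y + k * t) : ℝ) : ℂ) :=
    Summable.of_norm_bounded hsn hnear
  have hsplit : ∑' k : ℤ, dampedPhase (N * t) (b ^ 4) ξ k *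
      ((Int.fract (y + k * t) - 1 / 2 : ℝ) : ℂ) =
      ∑' k : ℤ, dampedPhase (N * t) (b ^ 4) ξ k *
        ((Int.fract (y + k * t) - 1 / 2 - smoothSaw (b / 2) (y + k * t) : ℝ) : ℂ) +
      ∑' k : ℤ, dampedPhase (N * t) (b ^ 4) ξ k * smoothSaw (b / 2) (y + k * t) := by
    have hs2 : Summable fun k : ℤ => dampedPhase (N * t) (b ^ 4) ξ k *
        (smoothSaw (b / 2) (y + k * t) : ℂ) := by
      refine (hs1.sub hs3).congr fun k => ?_
      push_cast
      ring
    rw [← hs3.tsum_add hs2]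
    congr 1
    ext k
    push_cast
    ring
  rw [hsplit]
  have hsN : Real.sqrt N ≤ N := by
    rw [Real.sqrt_le_left (by linarith)]
    nlinarith
  have hN2 : (1 : ℝ) ≤ (N : ℝ) ^ 2 := one_le_pow₀ hN1
  have hNN : (N : ℝ) ≤ (N : ℝ) ^ 2 := by nlinarith
  set Q := thetaConst * Real.exp Real.pi + 3 * Real.exp (5 / 4) with hQ
  have hQ0 : 0 ≤ Q := by positivity
  refine (norm_add_le _ _).trans ((add_le_add h1
    (norm_tsum_dampedPhase_smoothSaw_le (N := N) ht hb hb1 ξ y)).trans ?_)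
  have e1 : 45 * Real.exp (7 / 2) / b + (N * (thetaConst * Real.sqrt N / b) * Q +
      12 * (1 + thetaConst * Real.sqrt N) / b) =
      (45 * Real.exp (7 / 2) * 1 + 12 * (1 + thetaConst * Real.sqrt N) +
        thetaConst * Q * (N * Real.sqrt N)) / b := by ring
  rw [e1]
  refine div_le_div_of_nonneg_right ?_ hb.le
  calc _ ≤ 45 * Real.exp (7 / 2) * (N : ℝ) ^ 2 + 12 * ((N : ℝ) ^ 2 + thetaConst * (N : ℝ) ^ 2) +
        thetaConst * Q * (N * N) := by
        gcongr
        exact hsN.trans hNN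
    _ = sawConst * (N : ℝ) ^ 2 := by unfold sawConst; ring

/-! ### Birkhoff sums of piecewise smooth observables -/

/-- Indicators of arcs of the circle are differences of two sawtooths plus a constant. -/
theorem indicator_le_fract {τ : ℝ} (h0 : 0 ≤ τ) (h1 : τ ≤ 1) (z : ℝ) :
    (if τ ≤ Int.fract z then (1 : ℝ) else 0) = 1 - τ + Int.fract z - Int.fract (z - τ) := by
  have hf0 := Int.fract_nonneg z
  have hf1 := Int.fract_lt_one z
  have hz : z = Int.fract z + ⌊z⌋ := (Int.fract_add_floor z).symm
  split_ifs with h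
  · have : Int.fract (z - τ) = Int.fract z - τ := by
      rw [Int.fract_eq_iff]
      exact ⟨by linarith, by linarith, ⌊z⌋, by linarith⟩
    rw [this]; ring
  · have : Int.fract (z - τ) = Int.fract z - τ + 1 := by
      rw [Int.fract_eq_iff]
      exact ⟨by linarith, by linarith, ⌊z⌋ - 1, by push_cast; linarith⟩
    rw [this]; ring

theorem norm_tsum_dampedPhase_le {N : ℕ} [NeZero N] {t : ℝ}
    (ht : BadlyApproximable (1 / 3) t) {b : ℝ} (hb : 0 < b) (hb1 : b ≤ 1) (ξ : ℝ) :
    ‖∑' k : ℤ, dampedPhase (N * t) (b ^ 4) ξ k‖ ≤ sawConst * N ^ 2 / b := by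
  have hN : N ≠ 0 := NeZero.ne N
  have hN1 : (1 : ℝ) ≤ N := by exact_mod_cast Nat.one_le_iff_ne_zero.2 hN
  have hc := thetaConst_nonneg
  have hv0 : 0 < b ^ 4 := by positivity
  rw [(hasSum_dampedPhase (N * t) ξ hv0).tsum_eq]
  have hb4 : (b ^ 4) ^ (-(1 / 4) : ℝ) = b⁻¹ := by
    rw [← Real.rpow_natCast, ← Real.rpow_mul hb.le]
    norm_num
    exact Real.rpow_neg_one b
  refine (norm_jacobiTheta₂_le hN (ht.nat_mul hN) hv0 (pow_le_one₀ hb.le hb1) ξ).trans ?_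
  rw [hb4, Complex.ofReal_im, div_eq_mul_inv _ b]
  have hsN : Real.sqrt N ≤ (N : ℝ) ^ 2 := by
    rw [Real.sqrt_le_left (by positivity)]
    nlinarith [sq_nonneg ((N : ℝ) ^ 2 - 1)]
  have h1 : thetaConst ≤ sawConst := by
    unfold sawConst
    have : 0 ≤ 45 * Real.exp (7 / 2) +
      thetaConst * (thetaConst * Real.exp Real.pi + 3 * Real.exp (5 / 4)) := by positivity
    linarith
  have e : Real.exp (Real.pi * 0 ^ 2 / b ^ 4) = 1 := by simp
  have h2 := sawConst_nonneg
  rw [e, mul_one]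
  gcongr

theorem norm_tsum_dampedPhase_indicator_le {N : ℕ} [NeZero N] {t : ℝ}
    (ht : BadlyApproximable (1 / 3) t) {b : ℝ} (hb : 0 < b) (hb1 : b ≤ 1) (ξ y : ℝ)
    {τ : ℝ} (h0 : 0 ≤ τ) (h1 : τ ≤ 1) :
    ‖∑' k : ℤ, dampedPhase (N * t) (b ^ 4) ξ k *
      ((if τ ≤ Int.fract (y + k * t) then (1 : ℝ) else 0 : ℝ) : ℂ)‖ ≤
        3 * (sawConst * N ^ 2 / b) := by
  have hv0 : 0 < b ^ 4 := by positivity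
  have hbd : ∀ (y : ℝ) (k : ℤ), ‖((Int.fract (y + k * t) - 1 / 2 : ℝ) : ℂ)‖ ≤ 1 / 2 := by
    intro y k
    rw [Complex.norm_real, Real.norm_eq_abs, abs_le]
    have := Int.fract_nonneg (y + k * t)
    have := (Int.fract_lt_one (y + k * t)).le
    constructor <;> linarith
  have s0 := (hasSum_dampedPhase (N * t) ξ hv0).summable
  have s1 := summable_dampedPhase_mul (α := N * t) (ξ := ξ) hv0 (hbd y)
  have s2 := summable_dampedPhase_mul (α := N * t) (ξ := ξ) hv0 (hbd (y - τ))
  have e : ∀ k : ℤ, dampedPhase (N * t) (b ^ 4) ξ k *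
      ((if τ ≤ Int.fract (y + k * t) then (1 : ℝ) else 0 : ℝ) : ℂ) =
      ((1 - τ : ℝ) : ℂ) * dampedPhase (N * t) (b ^ 4) ξ k +
        (dampedPhase (N * t) (b ^ 4) ξ k * ((Int.fract (y + k * t) - 1 / 2 : ℝ) : ℂ) -
        dampedPhase (N * t) (b ^ 4) ξ k * ((Int.fract (y - τ + k * t) - 1 / 2 : ℝ) : ℂ)) := by
    intro k
    rw [indicator_le_fract h0 h1, show y + k * t - τ = y - τ + k * t by ring]
    push_cast
    ring
  simp_rw [e]
  rw [(s0.mul_left _).tsum_add (s1.sub s2), tsum_mul_left, s1.tsum_sub s2]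
  have b0 := norm_tsum_dampedPhase_le (N := N) ht hb hb1 ξ
  have b1 := norm_tsum_dampedPhase_saw_le (N := N) ht hb hb1 ξ y
  have b2 := norm_tsum_dampedPhase_saw_le (N := N) ht hb hb1 ξ (y - τ)
  have b3 : ‖((1 - τ : ℝ) : ℂ) * ∑' k : ℤ, dampedPhase (N * t) (b ^ 4) ξ k‖ ≤
      1 * (sawConst * N ^ 2 / b) := by
    rw [norm_mul, Complex.norm_real, Real.norm_of_nonneg (by linarith)]
    exact mul_le_mul (by linarith) b0 (norm_nonneg _) zero_le_one
  refine (norm_add_le _ _).trans ?_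
  have := norm_sub_le (∑' k : ℤ, dampedPhase (N * t) (b ^ 4) ξ k *
    ((Int.fract (y + k * t) - 1 / 2 : ℝ) : ℂ)) (∑' k : ℤ, dampedPhase (N * t) (b ^ 4) ξ k *
    ((Int.fract (y - τ + k * t) - 1 / 2 : ℝ) : ℂ))
  linarith

/-- Square root cancellation for Birkhoff sums of a function that is `C¹` on `[0, 1]`, with a
possible jump at the integers: such a function is a superposition of indicators of intervals. -/
theorem norm_tsum_dampedPhase_fract_le {N : ℕ} [NeZero N] {t : ℝ}
    (ht : BadlyApproximable (1 / 3) t) {b : ℝ} (hb : 0 < b) (hb1 : b ≤ 1) (ξ y : ℝ)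
    {G G' : ℝ → ℂ} (hG : ∀ x, HasDerivAt G (G' x) x) (hG' : Continuous G') {B : ℝ}
    (hB : ∀ x ∈ Set.Icc (0 : ℝ) 1, ‖G x‖ ≤ B) (hB' : ∀ x ∈ Set.Icc (0 : ℝ) 1, ‖G' x‖ ≤ B) :
    ‖∑' k : ℤ, dampedPhase (N * t) (b ^ 4) ξ k * G (Int.fract (y + k * t))‖ ≤
      4 * B * (sawConst * N ^ 2 / b) := by
  have hv0 : 0 < b ^ 4 := by positivity
  have hB0 : 0 ≤ B := (norm_nonneg _).trans (hB 0 (by simp))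
  set d := dampedPhase (N * t) (b ^ 4) ξ with hd
  have sd : Summable d := (hasSum_dampedPhase (N * t) ξ hv0).summable
  set z : ℤ → ℝ := fun k => Int.fract (y + k * t) with hz
  set H : ℤ → ℝ → ℂ := fun k τ => d k * ((if τ ≤ z k then (1 : ℝ) else 0 : ℝ) : ℂ) * G' τ with hH
  -- the increment of `G` from `0` to `z` is the integral over `τ` of its derivative times the
  -- indicator of `τ ≤ z`
  have hint : ∀ k, ∫ τ in Set.Ioc (0 : ℝ) 1, H k τ = d k * (G (z k) - G 0) := by
    intro k
    have hz0 : 0 ≤ z k := Int.fract_nonneg _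
    have hz1 : z k ≤ 1 := (Int.fract_lt_one _).le
    have e1 : ∀ τ, H k τ = d k * (Set.Iic (z k)).indicator G' τ := by
      intro τ
      simp only [hH, Set.indicator, Set.mem_Iic]
      split_ifs <;> simp
    simp_rw [e1]
    rw [integral_const_mul, setIntegral_indicator measurableSet_Iic,
      show Set.Ioc (0 : ℝ) 1 ∩ Set.Iic (z k) = Set.Ioc 0 (z k) by
        ext x; simp only [Set.mem_inter_iff, Set.mem_Ioc, Set.mem_Iic]
        constructor
        · rintro ⟨⟨h1, h2⟩, h3⟩; exact ⟨h1, h3⟩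
        · rintro ⟨h1, h2⟩; exact ⟨⟨h1, h2.trans hz1⟩, h2⟩,
      ← intervalIntegral.integral_of_le hz0,
      intervalIntegral.integral_eq_sub_of_hasDerivAt (fun x _ => hG x)
        (hG'.intervalIntegrable _ _)]
  have hGi : Integrable G' (volume.restrict (Set.Ioc (0 : ℝ) 1)) :=
    (hG'.integrableOn_Icc).mono_set Set.Ioc_subset_Icc_self
  have hHi : ∀ k, Integrable (H k) (volume.restrict (Set.Ioc (0 : ℝ) 1)) := by
    intro k
    have e1 : H k = fun τ => d k * (Set.Iic (z k)).indicator G' τ := by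
      ext τ
      simp only [hH, Set.indicator, Set.mem_Iic]
      split_ifs <;> simp
    rw [e1]
    exact (hGi.indicator measurableSet_Iic).const_mul _
  have hHn : ∀ k τ, τ ∈ Set.Ioc (0 : ℝ) 1 → ‖H k τ‖ ≤ ‖d k‖ * B := by
    intro k τ hτ
    simp only [hH, norm_mul]
    refine mul_le_mul ?_ (hB' τ ⟨hτ.1.le, hτ.2⟩) (norm_nonneg _) (norm_nonneg _)
    refine mul_le_of_le_one_right (norm_nonneg _) ?_
    split_ifs <;> simp
  have hHs : Summable fun k => ∫ τ in Set.Ioc (0 : ℝ) 1, ‖H k τ‖ := by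
    refine Summable.of_nonneg_of_le (fun k => integral_nonneg fun _ => norm_nonneg _) (fun k => ?_)
      (sd.norm.mul_right B)
    have : ∫ τ in Set.Ioc (0 : ℝ) 1, ‖H k τ‖ ≤ ∫ _ in Set.Ioc (0 : ℝ) 1, ‖d k‖ * B :=
      setIntegral_mono_on (hHi k).norm (integrable_const _) measurableSet_Ioc (hHn k)
    simpa using this
  have hsum := hasSum_integral_of_summable_integral_norm hHi hHs
  have hbound : ‖∫ τ in Set.Ioc (0 : ℝ) 1, ∑' k, H k τ‖ ≤ 3 * (sawConst * N ^ 2 / b) * B := by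
    have : ∀ τ ∈ Set.Ioc (0 : ℝ) 1, ‖∑' k, H k τ‖ ≤ 3 * (sawConst * N ^ 2 / b) * B := by
      intro τ hτ
      simp only [hH]
      rw [tsum_mul_right, norm_mul]
      refine mul_le_mul (norm_tsum_dampedPhase_indicator_le ht hb hb1 ξ y hτ.1.le hτ.2)
        (hB' τ ⟨hτ.1.le, hτ.2⟩) (norm_nonneg _) ?_
      have := sawConst_nonneg
      positivity
    have h := norm_setIntegral_le_of_norm_le_const (μ := volume) (by simp) this
    simpa using h
  have hsplit : ∑' k, d k * G (z k) = G 0 * ∑' k, d k + ∫ τ in Set.Ioc (0 : ℝ) 1, ∑' k, H k τ := by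
    rw [← hsum.tsum_eq, ← tsum_mul_left, ← (sd.mul_left _).tsum_add hsum.summable]
    congr 1
    ext k
    rw [hint]
    ring
  rw [hsplit]
  refine (norm_add_le _ _).trans ?_
  have h1 : ‖G 0 * ∑' k, d k‖ ≤ B * (sawConst * N ^ 2 / b) := by
    rw [norm_mul]
    exact mul_le_mul (hB 0 (by simp)) (norm_tsum_dampedPhase_le ht hb hb1 ξ) (norm_nonneg _) hB0
  linarith

/-! ### Periodization of the observable -/

/-- The observable along the unstable direction, as a function on the line: the Gaussian profile at
scale `√h` with its phase. -/
noncomputable def packetProfile (N : ℕ) (q₀ w : ℝ) : ℂ :=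
  profile (w / Real.sqrt (planck N)) * Complex.exp (2 * Complex.I * Real.pi / planck N * q₀ * w)

theorem packetProfile_eq (N : ℕ) (q₀ w : ℝ) :
    packetProfile N q₀ w = Complex.exp (-(Real.pi * N * Real.cos theta ^ 2 *
      (1 + Complex.I * Real.tan theta)) * w ^ 2 + 2 * Real.pi * Complex.I * N * q₀ * w) := by
  unfold packetProfile profile
  rw [← Complex.exp_add]
  congr 1
  have h1 : ((w / Real.sqrt (planck N) : ℝ) : ℂ) ^ 2 = (N : ℂ) * (w : ℂ) ^ 2 := by
    rw [← Complex.ofReal_pow, div_pow, Real.sq_sqrt (by unfold planck; positivity)]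
    unfold planck
    push_cast
    rw [div_div_eq_mul_div]
    ring
  rw [h1]
  unfold planck
  push_cast
  rw [div_div_eq_mul_div]
  ring

theorem norm_packetProfile (N : ℕ) (q₀ w : ℝ) :
    ‖packetProfile N q₀ w‖ = Real.exp (-(Real.pi * N * Real.cos theta ^ 2 * w ^ 2)) := by
  rw [packetProfile_eq, Complex.norm_exp]
  congr 1
  have : (-(Real.pi * N * Real.cos theta ^ 2 * (1 + Complex.I * Real.tan theta)) * w ^ 2 +
      2 * Real.pi * Complex.I * N * q₀ * w : ℂ) =
      ((-(Real.pi * N * Real.cos theta ^ 2 * w ^ 2) : ℝ) : ℂ) +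
      ((-(Real.pi * N * Real.cos theta ^ 2 * Real.tan theta * w ^ 2) + 2 * Real.pi * N * q₀ * w : ℝ) : ℂ)
        * Complex.I := by
    push_cast; ring
  rw [this, Complex.add_re, Complex.ofReal_re, Complex.re_ofReal_mul, Complex.I_re, mul_zero,
    add_zero]

theorem packetProfile_hasDerivAt (N : ℕ) (q₀ w : ℝ) :
    HasDerivAt (packetProfile N q₀) ((-(2 * Real.pi * N * Real.cos theta ^ 2 *
      (1 + Complex.I * Real.tan theta)) * w + 2 * Real.pi * Complex.I * N * q₀) *
      packetProfile N q₀ w) w := by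
  have e : packetProfile N q₀ = fun w : ℝ => Complex.exp (-(Real.pi * N * Real.cos theta ^ 2 *
      (1 + Complex.I * Real.tan theta)) * w ^ 2 + 2 * Real.pi * Complex.I * N * q₀ * w) :=
    funext (packetProfile_eq N q₀)
  rw [e]
  have h1 : HasDerivAt (fun x : ℝ => (x : ℂ)) 1 w := Complex.ofRealCLM.hasDerivAt
  have h2 := (((h1.pow 2).const_mul (-(Real.pi * N * Real.cos theta ^ 2 *
      (1 + Complex.I * Real.tan theta)) : ℂ)).add
        (h1.const_mul (2 * Real.pi * Complex.I * N * q₀ : ℂ))).cexp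
  refine h2.congr_deriv ?_
  simp only [Pi.add_apply, Pi.pow_apply]
  ring

theorem cos_theta_sq_gt : 0.72 < Real.cos theta ^ 2 := by
  rw [cos_theta_sq, tan_theta_sq, lt_div_iff₀ (by linarith [tan_theta_lt])]
  linarith [tan_theta_gt]

theorem cos_theta_sq_lt : Real.cos theta ^ 2 < 0.73 := by
  rw [cos_theta_sq, tan_theta_sq, div_lt_iff₀ (by linarith [tan_theta_lt])]
  linarith [tan_theta_lt]

/-- Away from the origin the profile and its derivative are exponentially small in `N`. -/
theorem packetProfile_far_bound {N : ℕ} [NeZero N] {q₀ : ℝ} (hq : q₀ ∈ Set.Ico (0 : ℝ) 1) {l : ℤ}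
    (hl : l ≠ 0) {w : ℝ} (hw : |w - l| ≤ 1 / 2) :
    ‖packetProfile N q₀ w‖ ≤ 80 * N * Real.exp (-(N / 8)) * Real.exp (-(1 / 8 * |(l : ℝ)|)) ∧
    ‖(-(2 * Real.pi * N * Real.cos theta ^ 2 * (1 + Complex.I * Real.tan theta)) * w +
      2 * Real.pi * Complex.I * N * q₀) * packetProfile N q₀ w‖ ≤
      80 * N * Real.exp (-(N / 8)) * Real.exp (-(1 / 8 * |(l : ℝ)|)) := by
  have hN1 : (1 : ℝ) ≤ N := by exact_mod_cast Nat.one_le_iff_ne_zero.2 (NeZero.ne N)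
  have hL : (1 : ℝ) ≤ |(l : ℝ)| := by exact_mod_cast Int.one_le_abs hl
  set L := |(l : ℝ)| with hLdef
  have hw1 : L / 2 ≤ |w| := by
    have := abs_sub_abs_le_abs_sub (l : ℝ) w
    rw [abs_sub_comm] at this
    linarith
  have hw2 : |w| ≤ L + 1 / 2 := by
    have := abs_sub_abs_le_abs_sub w (l : ℝ)
    linarith
  have hc := cos_theta_sq_gt
  have hc' := cos_theta_sq_lt
  have hπ := Real.pi_gt_three
  have hn : ‖packetProfile N q₀ w‖ ≤ Real.exp (-(N / 2 * L)) := by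
    rw [norm_packetProfile, Real.exp_le_exp, neg_le_neg_iff]
    have h1 : (L / 2) ^ 2 ≤ w ^ 2 := by rw [← sq_abs w]; gcongr
    have h2 : (2 : ℝ) ≤ Real.pi * Real.cos theta ^ 2 := by nlinarith
    calc (N : ℝ) / 2 * L ≤ N * (2 * (L / 2) ^ 2) := by
          have : L ≤ L ^ 2 := by nlinarith
          nlinarith
      _ ≤ N * (Real.pi * Real.cos theta ^ 2 * w ^ 2) := by gcongr
      _ = _ := by ring
  have hsplit : L * Real.exp (-(N / 2 * L)) ≤ 4 * (Real.exp (-(N / 8)) * Real.exp (-(1 / 8 * L))) := by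
    have h1 : L ≤ 4 * Real.exp (L / 4) := by linarith [Real.add_one_le_exp (L / 4)]
    calc _ ≤ 4 * Real.exp (L / 4) * Real.exp (-(N / 2 * L)) := by gcongr
      _ = 4 * Real.exp (L / 4 - N / 2 * L) := by rw [mul_assoc, ← Real.exp_add]; ring_nf
      _ ≤ 4 * Real.exp (-(N / 8) + -(1 / 8 * L)) := by
          gcongr
          nlinarith
      _ = _ := by rw [Real.exp_add]
  have hE0 : 0 < Real.exp (-(N / 2 * L)) := Real.exp_pos _
  constructor
  · calc _ ≤ 1 * (L * Real.exp (-(N / 2 * L))) := by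
          rw [one_mul]; exact hn.trans (le_mul_of_one_le_left hE0.le hL)
      _ ≤ N * (4 * (Real.exp (-(N / 8)) * Real.exp (-(1 / 8 * L)))) := by gcongr
      _ ≤ _ := by
        have : 0 ≤ N * (Real.exp (-(N / 8)) * Real.exp (-(1 / 8 * L))) := by positivity
        linarith
  · rw [norm_mul]
    have h1 : ‖(1 + Complex.I * Real.tan theta : ℂ)‖ ≤ 1.62 := by
      refine (norm_add_le _ _).trans ?_
      rw [norm_one, norm_mul, Complex.norm_I, Complex.norm_real, Real.norm_eq_abs,
        abs_of_pos (by linarith [tan_theta_gt])]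
      linarith [tan_theta_lt]
    have h2 : ‖(-(2 * Real.pi * N * Real.cos theta ^ 2 * (1 + Complex.I * Real.tan theta)) * w +
      2 * Real.pi * Complex.I * N * q₀ : ℂ)‖ ≤ 20 * N * L * 1 := by
      refine (norm_add_le _ _).trans ?_
      have e1 : ‖(-(2 * Real.pi * N * Real.cos theta ^ 2 * (1 + Complex.I * Real.tan theta)) * w : ℂ)‖ =
          2 * Real.pi * N * Real.cos theta ^ 2 * |w| * ‖(1 + Complex.I * Real.tan theta : ℂ)‖ := by
        rw [norm_mul, norm_neg, norm_mul, Complex.norm_real, Real.norm_eq_abs]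
        have : ‖(2 * Real.pi * N * Real.cos theta ^ 2 : ℂ)‖ = 2 * Real.pi * N * Real.cos theta ^ 2 := by
          have e : (2 * Real.pi * N * Real.cos theta ^ 2 : ℂ) =
            ((2 * Real.pi * N * Real.cos theta ^ 2 : ℝ) : ℂ) := by push_cast; rfl
          rw [e, Complex.norm_real, Real.norm_of_nonneg (by positivity)]
        rw [this]
        ring
      have e2 : ‖(2 * Real.pi * Complex.I * N * q₀ : ℂ)‖ = 2 * Real.pi * N * q₀ := by
        simp only [norm_mul, Complex.norm_I, Complex.norm_real, Real.norm_eq_abs, abs_of_pos Real.pi_pos,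
          abs_of_nonneg hq.1, Complex.norm_natCast, Complex.norm_two]
        ring
      rw [e1, e2]
      have hπ' := Real.pi_lt_d2
      calc _ ≤ 2 * 3.15 * N * 0.73 * (L + 1 / 2) * 1.62 + 2 * 3.15 * N * 1 := by
            gcongr
            · exact hq.1
            · exact hq.2.le
        _ ≤ _ := by nlinarith
    calc _ ≤ 20 * N * L * 1 * Real.exp (-(N / 2 * L)) := by gcongr
      _ = 20 * N * (L * Real.exp (-(N / 2 * L))) := by ring
      _ ≤ 20 * N * (4 * (Real.exp (-(N / 8)) * Real.exp (-(1 / 8 * L)))) := by gcongr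
      _ = _ := by ring

theorem dampedPhase_neg (α v ξ : ℝ) (k : ℤ) : dampedPhase α v ξ (-k) = dampedPhase α v (-ξ) k := by
  unfold dampedPhase
  push_cast
  ring_nf

theorem norm_dampedPhase_mul_packetProfile (N : ℕ) (α v ξ q₀ w : ℝ) (k : ℤ) :
    ‖dampedPhase α v ξ k * packetProfile N q₀ w‖ =
      Real.exp (-(Real.pi * v * (k : ℝ) ^ 2 + Real.pi * N * Real.cos theta ^ 2 * w ^ 2)) := by
  rw [norm_mul, norm_dampedPhase, norm_packetProfile, ← Real.exp_add]
  congr 1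
  ring

theorem summable_dampedPhase_mul_packetProfile {N : ℕ} [NeZero N] {α v : ℝ} (hv : 0 < v)
    (ξ x₀ q₀ : ℝ) :
    Summable fun p : ℤ × ℤ => dampedPhase α v ξ p.1 *
      packetProfile N q₀ (x₀ + p.1 * Real.tan theta + p.2) := by
  have hN : (0 : ℝ) < N := by exact_mod_cast Nat.pos_of_ne_zero (NeZero.ne N)
  have hc := cos_theta_pos
  obtain ⟨hL, -⟩ := lattice_gaussian_sum (A := Real.pi * v)
    (B := Real.pi * N * Real.cos theta ^ 2) (by norm_num) tan_theta_badlyApproximable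
    (by positivity) (by positivity) x₀
  refine Summable.of_norm_bounded hL fun p => ?_
  rw [norm_dampedPhase_mul_packetProfile, mul_comm (p.1 : ℝ) (Real.tan theta)]

/-- The Birkhoff sum of a single translate, by `l ≠ 0`, of the profile of the signed distance. Only
translates away from the origin occur, so their `C¹` size is exponentially small in `N`. -/
theorem norm_tsum_packetProfile_translate_le {N : ℕ} [NeZero N] {b : ℝ} (hb : 0 < b) (hb1 : b ≤ 1)
    {q₀ : ℝ} (hq : q₀ ∈ Set.Ico (0 : ℝ) 1) (ξ x₀ : ℝ) {l : ℤ} (hl : l ≠ 0) :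
    ‖∑' k : ℤ, dampedPhase (N * Real.tan theta) (b ^ 4) ξ k *
      packetProfile N q₀ (1 / 2 - Int.fract (1 / 2 - (x₀ + k * Real.tan theta)) + l)‖ ≤
      4 * (80 * N * Real.exp (-(N / 8)) * Real.exp (-(1 / 8 * |(l : ℝ)|))) *
        (sawConst * N ^ 2 / b) := by
  have hG : ∀ x : ℝ, HasDerivAt (fun x : ℝ => packetProfile N q₀ (1 / 2 - x + l))
      (((-(2 * Real.pi * N * Real.cos theta ^ 2 * (1 + Complex.I * Real.tan theta)) *
        ((1 / 2 - x + l : ℝ) : ℂ) + 2 * Real.pi * Complex.I * N * q₀) *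
        packetProfile N q₀ (1 / 2 - x + l)) * ((-1 : ℝ) : ℂ)) x := by
    intro x
    have h1 : HasDerivAt (fun x : ℝ => 1 / 2 - x + (l : ℝ)) (-1) x :=
      ((hasDerivAt_id x).const_sub (1 / 2)).add_const _
    have h2 := (packetProfile_hasDerivAt N q₀ (1 / 2 - x + l)).scomp x h1
    refine h2.congr_deriv ?_
    rw [Complex.real_smul, mul_comm]
  have hcont : Continuous (packetProfile N q₀) :=
    continuous_iff_continuousAt.2 fun w => (packetProfile_hasDerivAt N q₀ w).continuousAt
  have hmem : ∀ x ∈ Set.Icc (0 : ℝ) 1, |(1 / 2 - x + l) - (l : ℝ)| ≤ 1 / 2 := by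
    intro x hx
    rw [abs_le]
    constructor <;> linarith [hx.1, hx.2]
  have key := norm_tsum_dampedPhase_fract_le (N := N) tan_theta_badlyApproximable hb hb1 (-ξ)
    (1 / 2 - x₀) hG (by fun_prop) (B := 80 * N * Real.exp (-(N / 8)) *
      Real.exp (-(1 / 8 * |(l : ℝ)|)))
    (fun x hx => (packetProfile_far_bound hq hl (hmem x hx)).1)
    (fun x hx => by
      rw [norm_mul]
      simpa using (packetProfile_far_bound hq hl (hmem x hx)).2)
  refine le_trans (le_of_eq ?_) key
  congr 1
  rw [← (Equiv.neg ℤ).tsum_eq]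
  congr 1
  ext k
  rw [Equiv.neg_apply, dampedPhase_neg]
  congr 3
  push_cast
  ring_nf

/-- In Birkhoff sums the observable may be replaced by its periodization, up to an error that is
exponentially small in `N` relative to the square root of the length of the sum. The difference
of the two functions is small but discontinuous, and its Birkhoff sums have square root
cancellation nevertheless. -/
theorem norm_periodization_error_le {N : ℕ} [NeZero N] {b : ℝ} (hb : 0 < b) (hb1 : b ≤ 1)
    {q₀ : ℝ} (hq : q₀ ∈ Set.Ico (0 : ℝ) 1) (ξ x₀ : ℝ) :
    ‖(∑' p : ℤ × ℤ, dampedPhase (N * Real.tan theta) (b ^ 4) ξ p.1 *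
        packetProfile N q₀ (x₀ + p.1 * Real.tan theta + p.2)) -
      ∑' k : ℤ, dampedPhase (N * Real.tan theta) (b ^ 4) ξ k *
        packetProfile N q₀ (1 / 2 - Int.fract (1 / 2 - (x₀ + k * Real.tan theta)))‖ ≤
      7680 * sawConst * N ^ 3 * Real.exp (-(N / 8)) / b := by
  have hv0 : 0 < b ^ 4 := by positivity
  set t := Real.tan theta with ht
  set d := dampedPhase (N * t) (b ^ 4) ξ with hd
  have hsum := summable_dampedPhase_mul_packetProfile (N := N) (α := N * t) hv0 ξ x₀ q₀
  rw [← ht, ← hd] at hsum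
  -- translate the inner sum so that its term of index `0` is the one of the main sum
  set E : ℤ × ℤ ≃ ℤ × ℤ :=
    { toFun := fun p => (p.1, p.2 - (⌊1 / 2 - (x₀ + p.1 * t)⌋ * (-1)) )
      invFun := fun p => (p.1, p.2 + (⌊1 / 2 - (x₀ + p.1 * t)⌋ * (-1)))
      left_inv := fun p => by ext <;> simp
      right_inv := fun p => by ext <;> simp } with hE
  have hval : ∀ p : ℤ × ℤ, d p.1 * packetProfile N q₀ (1 / 2 - Int.fract (1 / 2 - (x₀ + p.1 * t)) + p.2)
      = d (E p).1 * packetProfile N q₀ (x₀ + (E p).1 * t + (E p).2) := by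
    intro p
    congr 2
    simp only [hE, Equiv.coe_fn_mk]
    have := Int.self_sub_floor (1 / 2 - (x₀ + p.1 * t))
    rw [← this]
    push_cast
    ring
  set f : ℤ × ℤ → ℂ := fun p =>
    d p.1 * packetProfile N q₀ (1 / 2 - Int.fract (1 / 2 - (x₀ + p.1 * t)) + p.2) with hf
  have hfs : Summable f := by
    rw [hf]
    simp_rw [hval]
    exact (E.summable_iff (f := fun p : ℤ × ℤ => d p.1 * packetProfile N q₀ (x₀ + p.1 * t + p.2))).2
      hsum
  have hft : ∑' p : ℤ × ℤ, d p.1 * packetProfile N q₀ (x₀ + p.1 * t + p.2) = ∑' p, f p := by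
    rw [hf]
    simp_rw [hval]
    exact (E.tsum_eq (fun p : ℤ × ℤ => d p.1 * packetProfile N q₀ (x₀ + p.1 * t + p.2))).symm
  have hfs' : Summable fun p : ℤ × ℤ => f p.swap := (Equiv.prodComm ℤ ℤ).summable_iff.2 hfs
  have hft' : ∑' p, f p = ∑' l : ℤ, ∑' k : ℤ, f (k, l) := by
    rw [← (Equiv.prodComm ℤ ℤ).tsum_eq f]
    exact hfs'.tsum_prod
  have hls : Summable fun l : ℤ => ∑' k : ℤ, f (k, l) := hfs'.prod
  have h0 : ∑' k : ℤ, d k * packetProfile N q₀ (1 / 2 - Int.fract (1 / 2 - (x₀ + k * t))) =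
      ∑' k : ℤ, f (k, 0) := by
    simp [hf]
  rw [hft, hft', h0, hls.tsum_eq_add_tsum_ite 0, add_sub_cancel_left]
  set K := sawConst * (N : ℝ) ^ 2 / b with hK
  have hK0 : 0 ≤ K := by have := sawConst_nonneg; positivity
  have hbound : ∀ l : ℤ, ‖if l = 0 then 0 else ∑' k : ℤ, f (k, l)‖ ≤
      320 * N * Real.exp (-(N / 8)) * K * Real.exp (-(1 / 8 * |(l : ℝ)|)) := by
    intro l
    split_ifs with hl
    · rw [norm_zero]; positivity
    · refine (norm_tsum_packetProfile_translate_le hb hb1 hq ξ x₀ hl).trans (le_of_eq ?_)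
      rw [hK]
      ring
  have hw := (summable_exp_neg_abs_int (b := 1 / 8) (by norm_num)).mul_left
    (320 * N * Real.exp (-(N / 8)) * K)
  refine (tsum_of_norm_bounded hw.hasSum hbound).trans ?_
  rw [tsum_mul_left]
  calc _ ≤ 320 * N * Real.exp (-(N / 8)) * K * (3 / (1 / 8)) := by
        gcongr
        exact tsum_exp_neg_abs_int_le (by norm_num) (by norm_num)
    _ = _ := by rw [hK]; ring

/-! ### The orbit of the skew rotation -/

/-- The choice `β = N tan θ / 2` turns the triangular numbers of the orbit into `k² / 2`. -/
theorem skewRotation_zpow_apply (N : ℕ) (s : ℝ) (k : ℤ) :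
    (skewRotation N ^ k) ((s : UnitAddCircle), 0) =
      (((s + k * Real.tan theta : ℝ) : UnitAddCircle),
        ((N * (k * s + Real.tan theta * k ^ 2 / 2) : ℝ) : UnitAddCircle)) := by
  set Z : ℤ → UnitAddCircle × UnitAddCircle := fun k =>
    (((s + k * Real.tan theta : ℝ) : UnitAddCircle),
        ((N * (k * s + Real.tan theta * k ^ 2 / 2) : ℝ) : UnitAddCircle)) with hZ
  have hstep : ∀ k, skewRotation N (Z k) = Z (k + 1) := by
    intro k
    simp only [hZ, skewRotation, Equiv.coe_fn_mk]
    refine Prod.ext ?_ ?_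
    · change ((s + k * Real.tan theta : ℝ) : UnitAddCircle) + (Real.tan theta : UnitAddCircle) = _
      rw [← AddCircle.coe_add]
      congr 1
      push_cast
      ring
    · change ((N * (k * s + Real.tan theta * k ^ 2 / 2) : ℝ) : UnitAddCircle) +
        N • ((s + k * Real.tan theta : ℝ) : UnitAddCircle) +
          ((Real.tan theta * N / 2 : ℝ) : UnitAddCircle) = _
      rw [← AddCircle.coe_nsmul, ← AddCircle.coe_add, ← AddCircle.coe_add]
      congr 1
      simp only [nsmul_eq_mul]
      push_cast
      ring
  have h0 : ((s : UnitAddCircle), (0 : UnitAddCircle)) = Z 0 := by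
    simp [hZ]
  change (skewRotation N ^ k) _ = Z k
  rw [h0]
  induction k using Int.induction_on with
  | zero => simp
  | succ n ih => rw [add_comm, zpow_add, zpow_one, Equiv.Perm.mul_apply, ih, hstep, add_comm]
  | pred n ih =>
    rw [sub_eq_add_neg, add_comm, zpow_add, zpow_neg_one, Equiv.Perm.mul_apply, ih,
      Equiv.Perm.inv_eq_iff_eq, hstep]
    congr 1
    ring

/-- The representative in the half-open interval `(-1/2, 1/2]` is `1 / 2 - Int.fract (1 / 2 - ·)`; the
plain fractional part would produce `[-1/2, 1/2)`. -/
theorem signedDist_coe (x y : ℝ) :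
    signedDist (x : UnitAddCircle) (y : UnitAddCircle) = 1 / 2 - Int.fract (1 / 2 - (x - y)) := by
  unfold signedDist
  rw [← AddCircle.coe_sub]
  have h0 := Int.fract_nonneg (1 / 2 - (x - y))
  have h1 := Int.fract_lt_one (1 / 2 - (x - y))
  have h2 : ((x - y : ℝ) : UnitAddCircle) =
      ((1 / 2 - Int.fract (1 / 2 - (x - y)) : ℝ) : UnitAddCircle) := by
    rw [← sub_eq_zero, ← AddCircle.coe_sub, AddCircle.coe_eq_zero_iff]
    refine ⟨-⌊1 / 2 - (x - y)⌋, ?_⟩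
    rw [← Int.self_sub_floor, zsmul_eq_mul]
    push_cast
    ring
  rw [h2]
  exact AddCircle.equivIoc_coe_of_mem ⟨by linarith, by linarith⟩

/-- Along the orbit of `(s, 0)` the second coordinate contributes the quadratic phase, and the damping
function its Gaussian weight. -/
theorem birkhoffSum_observable (N : ℕ) [NeZero N] {m : ℝ} (hm : 0 < m) (q₀ p₀ s : ℝ) :
    birkhoffSum (skewRotation N) (damping N) m (observable N q₀ p₀) ((s : UnitAddCircle), 0) =
      ∑' k : ℤ, dampedPhase (N * Real.tan theta) (N / (Real.cos theta ^ 2 * m ^ 2)) (N * s) k *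
        packetProfile N q₀ (1 / 2 - Int.fract (1 / 2 -
          (s - (p₀ - q₀ * Real.tan theta) + k * Real.tan theta))) := by
  unfold birkhoffSum
  congr 1
  ext k
  rw [skewRotation_zpow_apply]
  unfold observable
  simp only
  rw [signedDist_coe, show s + k * Real.tan theta - (p₀ - q₀ * Real.tan theta) =
    s - (p₀ - q₀ * Real.tan theta) + k * Real.tan theta by ring]
  unfold packetProfile dampedPhase
  have e1 : ((AddCircle.toCircle ((N * (k * s + Real.tan theta * k ^ 2 / 2) : ℝ) : UnitAddCircle) :
      Circle) : ℂ) = cis (N * Real.tan theta * (k : ℝ) ^ 2 / 2 + k * (N * s)) := by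
    rw [AddCircle.toCircle_apply_mk, Circle.coe_exp, cis]
    congr 1
    push_cast
    ring
  have e2 : damping N (k / m) =
      (Real.exp (-(Real.pi * (N / (Real.cos theta ^ 2 * m ^ 2)) * (k : ℝ) ^ 2)) : ℂ) := by
    have hc : (Real.cos theta : ℂ) ≠ 0 := by exact_mod_cast cos_theta_pos.ne'
    have hm' : (m : ℂ) ≠ 0 := by exact_mod_cast hm.ne'
    have hN : (N : ℂ) ≠ 0 := by exact_mod_cast NeZero.ne N
    unfold damping planck
    push_cast
    congr 1
    field_simp
  rw [e1, e2]
  ring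

/-! ### Evolution of the coherent state -/

/-- Principal square roots multiply in the right half-plane. -/
theorem mul_cpow_half_of_re_pos {p q : ℂ} (hp : 0 < p.re) (hq : 0 < q.re) :
    (p * q) ^ (1 / 2 : ℂ) = p ^ (1 / 2 : ℂ) * q ^ (1 / 2 : ℂ) := by
  have h1 := abs_lt.1 (Complex.abs_arg_lt_pi_div_two_iff.2 (Or.inl hp))
  have h2 := abs_lt.1 (Complex.abs_arg_lt_pi_div_two_iff.2 (Or.inl hq))
  have hp0 : p ≠ 0 := fun h => by simp [h] at hp
  have hq0 : q ≠ 0 := fun h => by simp [h] at hq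
  rw [Complex.cpow_def_of_ne_zero (mul_ne_zero hp0 hq0), Complex.cpow_def_of_ne_zero hp0,
    Complex.cpow_def_of_ne_zero hq0, ← Complex.exp_add,
    (Complex.log_mul_eq_add_log_iff hp0 hq0).2 ⟨by linarith [h1.1, h2.1], by linarith [h1.2, h2.2]⟩,
    add_mul]

theorem ofReal_mul_cpow_half {x : ℝ} (hx : 0 < x) {z : ℂ} (hz : z ≠ 0) :
    (x * z) ^ (1 / 2 : ℂ) = Real.sqrt x * z ^ (1 / 2 : ℂ) := by
  have hx0 : (x : ℂ) ≠ 0 := by exact_mod_cast hx.ne'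
  have h : (Real.sqrt x : ℂ) = (x : ℂ) ^ (1 / 2 : ℂ) := by
    rw [Real.sqrt_eq_rpow, Complex.ofReal_cpow hx.le]
    norm_num
  rw [h, Complex.cpow_def_of_ne_zero (mul_ne_zero hx0 hz), Complex.cpow_def_of_ne_zero hx0,
    Complex.cpow_def_of_ne_zero hz, ← Complex.exp_add, Complex.log_ofReal_mul hx hz,
    Complex.ofReal_log hx.le, add_mul]

theorem inv_re_pos {z : ℂ} (hz : 0 < z.re) : 0 < (1 / z).re := by
  rw [one_div, Complex.inv_re]
  have : z ≠ 0 := fun h => by simp [h] at hz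
  exact div_pos hz (Complex.normSq_pos.2 this)

/-- The quantum cat map acts on Gaussians by the Möbius transformation
`ζ ↦ (ζ - i) / (2 + i ζ)` of the parameter. -/
theorem catOperator_gauss {N : ℕ} [NeZero N] {ζ c : ℂ} (hζ : 0 < ζ.re) {φ : 𝓢(ℝ, ℂ)}
    (hφ : ∀ x, φ x = c * gauss (N * ζ) x) (x : ℝ) :
    catOperator N φ x = c * (1 / (2 + Complex.I * ζ)) ^ (1 / 2 : ℂ) *
      gauss (N * ((ζ - Complex.I) / (2 + Complex.I * ζ))) x := by
  have hN : (0 : ℝ) < N := by exact_mod_cast Nat.pos_of_ne_zero (NeZero.ne N)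
  have hNc : (N : ℂ) ≠ 0 := by exact_mod_cast NeZero.ne N
  have hζ0 : ζ ≠ 0 := fun h => by simp [h] at hζ
  have hπ : (Real.pi : ℂ) ≠ 0 := by exact_mod_cast Real.pi_ne_zero
  have hh : planck N ≠ 0 := (planck_pos N).ne'
  have hM : catMatrix 0 0 ≠ 0 := by simp [catMatrix]
  set w : ℂ := 1 / ζ + Complex.I / 2 with hw
  have hwre : 0 < w.re := by
    have := inv_re_pos hζ
    rw [hw, Complex.add_re]
    simpa using this
  have hw0 : w ≠ 0 := fun h => by simp [h] at hwre
  have hrel : 2 + Complex.I * ζ = 2 * (ζ * w) := by rw [hw]; field_simp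
  -- the Fourier transform of the Gaussian
  have hF : ∀ ξ : ℝ, hFourier (planck N) φ ξ =
      c * N * (1 / (N * ζ)) ^ (1 / 2 : ℂ) * Complex.exp (-(Real.pi * N / ζ) * ξ ^ 2) := by
    intro ξ
    rw [hFourier_apply hh]
    have e : ∀ x : ℝ, Complex.exp (-(2 * Complex.I * Real.pi * (x * ξ) / planck N)) * φ x =
        c * Complex.exp (-(Real.pi * N * ζ) * x ^ 2 + -(2 * Complex.I * Real.pi * N * ξ) * x + 0) := by
      intro x
      rw [hφ, gauss, mul_left_comm, ← Complex.exp_add]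
      congr 2
      unfold planck
      push_cast
      rw [div_div_eq_mul_div]
      ring
    simp_rw [e]
    have hb : (-(Real.pi * N * ζ : ℂ)).re < 0 := by
      have : (Real.pi * N * ζ : ℂ) = ((Real.pi * N : ℝ) : ℂ) * ζ := by push_cast; ring
      rw [this, Complex.neg_re, Complex.re_ofReal_mul, neg_lt_zero]
      have := Real.pi_pos
      positivity
    rw [integral_const_mul, integral_cexp_quadratic hb]
    have e1 : (Real.pi : ℂ) / - -(Real.pi * N * ζ) = 1 / (N * ζ) := by
      rw [neg_neg]; field_simp
    have e2 : (0 : ℂ) - (-(2 * Complex.I * Real.pi * N * ξ)) ^ 2 / (4 * -(Real.pi * N * ζ)) =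
        -(Real.pi * N / ζ) * ξ ^ 2 := by
      field_simp
      rw [Complex.I_sq]
      ring
    rw [e1, e2]
    unfold planck
    push_cast
    field_simp
  have e : ∀ ξ : ℝ, Complex.exp (2 * Real.pi * Complex.I * action catMatrix x ξ / planck N) *
      hFourier (planck N) φ ξ = c * N * (1 / (N * ζ)) ^ (1 / 2 : ℂ) *
        Complex.exp (-(Real.pi * N * w) * ξ ^ 2 + (Complex.I * Real.pi * N * x) * ξ +
          Complex.I * Real.pi * N * x ^ 2 / 2) := by
    intro ξ
    rw [hF, mul_left_comm, ← Complex.exp_add]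
    congr 2
    unfold planck action
    simp [catMatrix]
    rw [hw]
    field_simp
    ring
  unfold catOperator
  rw [metaplectic_apply hh hM]
  simp_rw [e]
  have hb : (-(Real.pi * N * w : ℂ)).re < 0 := by
    have : (Real.pi * N * w : ℂ) = ((Real.pi * N : ℝ) : ℂ) * w := by push_cast; ring
    rw [this, Complex.neg_re, Complex.re_ofReal_mul, neg_lt_zero]
    have := Real.pi_pos
    positivity
  rw [integral_const_mul, integral_cexp_quadratic hb]
  have e1 : (Real.pi : ℂ) / - -(Real.pi * N * w) = 1 / (N * w) := by
    rw [neg_neg]; field_simp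
  have e2 : Complex.I * Real.pi * N * x ^ 2 / 2 - (Complex.I * Real.pi * N * x) ^ 2 /
      (4 * -(Real.pi * N * w)) = -(Real.pi * (N * ((ζ - Complex.I) / (2 + Complex.I * ζ))) * x ^ 2) := by
    rw [hrel]
    have : ζ - Complex.I = ζ * (1 - Complex.I * w * 2) / 2 := by
      rw [hw]
      field_simp
      linear_combination ζ * Complex.I_sq
    rw [this]
    field_simp
    linear_combination (4 * (x : ℂ) ^ 2) * Complex.I_sq
  rw [e1, e2]
  have hsq : (1 / (2 + Complex.I * ζ)) ^ (1 / 2 : ℂ) =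
      ((1 / Real.sqrt (catMatrix 0 0) : ℝ) : ℂ) * (N * (1 / (N * ζ)) ^ (1 / 2 : ℂ) *
        (1 / (N * w)) ^ (1 / 2 : ℂ)) := by
    have hp : 0 < (1 / ((N : ℂ) * ζ)).re := by
      refine inv_re_pos ?_
      rw [← Complex.ofReal_natCast, Complex.re_ofReal_mul]
      positivity
    have hq : 0 < (1 / ((N : ℂ) * w)).re := by
      refine inv_re_pos ?_
      rw [← Complex.ofReal_natCast, Complex.re_ofReal_mul]
      positivity
    have e3 : 1 / (2 + Complex.I * ζ) = (((N : ℝ) ^ 2 / 2 : ℝ) : ℂ) * (1 / (N * ζ) * (1 / (N * w))) := by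
      rw [hrel]
      push_cast
      field_simp
    have e4 : Real.sqrt ((N : ℝ) ^ 2 / 2) = 1 / Real.sqrt (catMatrix 0 0) * N := by
      rw [Real.sqrt_div (by positivity), Real.sqrt_sq hN.le]
      simp [catMatrix]
      ring
    have hpq0 : 1 / ((N : ℂ) * ζ) * (1 / (N * w)) ≠ 0 := by
      refine mul_ne_zero (one_div_ne_zero (mul_ne_zero hNc hζ0)) (one_div_ne_zero (mul_ne_zero hNc hw0))
    rw [e3, ofReal_mul_cpow_half (by positivity) hpq0, e4,
      mul_cpow_half_of_re_pos hp hq]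
    push_cast
    ring
  rw [hsq]
  unfold gauss
  ring

theorem tan_mul_I_ne (x : ℝ) : (1 - Complex.I * x : ℂ) ≠ 0 := fun h => by
  have := congrArg Complex.re h
  simp at this

theorem tan_theta_sq_complex : (Real.tan theta : ℂ) ^ 2 = 1 - Real.tan theta := by
  exact_mod_cast tan_theta_sq

/-- The parameter of the coherent state at the origin after its wave function has been stretched
by a factor `m` along the unstable direction. -/
noncomputable def stretchParam (m : ℝ) : ℂ :=
  (((m ^ 2)⁻¹ : ℝ) - Complex.I * Real.tan theta) /
    (1 - Complex.I * ((m ^ 2)⁻¹ * Real.tan theta : ℝ))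

/-- The inverse square of the amplitude of the stretched coherent state. -/
noncomputable def stretchAmplitude (m : ℝ) : ℂ :=
  m * (1 - Complex.I * ((m ^ 2)⁻¹ * Real.tan theta : ℝ)) / (1 - Complex.I * Real.tan theta)

theorem stretchParam_one : stretchParam 1 = 1 := by
  unfold stretchParam
  rw [div_eq_one_iff_eq (tan_mul_I_ne _)]
  simp

theorem stretchAmplitude_one : stretchAmplitude 1 = 1 := by
  unfold stretchAmplitude
  rw [div_eq_one_iff_eq (tan_mul_I_ne _)]
  simp

theorem re_mul_normSq_div (p q : ℂ) (hq : q ≠ 0) :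
    (p / q).re * Complex.normSq q = (p * conj q).re := by
  have : Complex.normSq q ≠ 0 := Complex.normSq_pos.2 hq |>.ne'
  rw [Complex.div_re, Complex.mul_re, Complex.conj_re, Complex.conj_im]
  field_simp
  ring

theorem stretchParam_re_pos {m : ℝ} (hm : 0 < m) : 0 < (stretchParam m).re := by
  have h := re_mul_normSq_div (((m ^ 2)⁻¹ : ℝ) - Complex.I * Real.tan theta)
    (1 - Complex.I * ((m ^ 2)⁻¹ * Real.tan theta : ℝ)) (tan_mul_I_ne _)
  have hq := Complex.normSq_pos.2 (tan_mul_I_ne ((m ^ 2)⁻¹ * Real.tan theta))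
  refine pos_of_mul_pos_left ?_ hq.le
  unfold stretchParam
  rw [h]
  have : 0 < (m ^ 2)⁻¹ := by positivity
  simp only [Complex.mul_re, Complex.sub_re, Complex.ofReal_re, Complex.I_re, Complex.I_im,
    Complex.ofReal_im, Complex.conj_re, Complex.conj_im, Complex.one_re, Complex.one_im,
    Complex.mul_im, Complex.sub_im]
  nlinarith [mul_nonneg this.le (sq_nonneg (Real.tan theta))]

theorem stretchAmplitude_re_pos {m : ℝ} (hm : 0 < m) : 0 < (stretchAmplitude m).re := by
  have h := re_mul_normSq_div (m * (1 - Complex.I * ((m ^ 2)⁻¹ * Real.tan theta : ℝ)))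
    (1 - Complex.I * Real.tan theta) (tan_mul_I_ne _)
  have hq := Complex.normSq_pos.2 (tan_mul_I_ne (Real.tan theta))
  refine pos_of_mul_pos_left ?_ hq.le
  unfold stretchAmplitude
  rw [h]
  have : 0 < m * (m ^ 2)⁻¹ := by positivity
  simp only [Complex.mul_re, Complex.sub_re, Complex.ofReal_re, Complex.I_re, Complex.I_im,
    Complex.ofReal_im, Complex.conj_re, Complex.conj_im, Complex.one_re, Complex.one_im,
    Complex.mul_im, Complex.sub_im]
  nlinarith [mul_nonneg this.le (sq_nonneg (Real.tan theta))]

/-- The factors gained at each step of the evolution stay in the right half-plane, so that the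
principal square roots of the amplitudes multiply. -/
theorem two_add_I_mul_stretchParam_re_pos {m : ℝ} (hm : 1 ≤ m) :
    0 < (2 + Complex.I * stretchParam m).re := by
  have e : 2 + Complex.I * stretchParam m =
      (2 * (1 - Complex.I * ((m ^ 2)⁻¹ * Real.tan theta : ℝ)) +
        Complex.I * (((m ^ 2)⁻¹ : ℝ) - Complex.I * Real.tan theta)) /
      (1 - Complex.I * ((m ^ 2)⁻¹ * Real.tan theta : ℝ)) := by
    have := tan_mul_I_ne ((m ^ 2)⁻¹ * Real.tan theta)
    unfold stretchParam
    rw [add_div, mul_div_assoc, mul_div_assoc, div_self this, mul_one]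
  have h := re_mul_normSq_div (2 * (1 - Complex.I * ((m ^ 2)⁻¹ * Real.tan theta : ℝ)) +
        Complex.I * (((m ^ 2)⁻¹ : ℝ) - Complex.I * Real.tan theta))
    (1 - Complex.I * ((m ^ 2)⁻¹ * Real.tan theta : ℝ)) (tan_mul_I_ne _)
  have hq := Complex.normSq_pos.2 (tan_mul_I_ne ((m ^ 2)⁻¹ * Real.tan theta))
  refine pos_of_mul_pos_left ?_ hq.le
  rw [e, h]
  have h0 : 0 < (m ^ 2)⁻¹ := by positivity
  have h1 : (m ^ 2)⁻¹ ≤ 1 := inv_le_one_of_one_le₀ (one_le_pow₀ hm)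
  simp only [Complex.mul_re, Complex.sub_re, Complex.ofReal_re, Complex.I_re, Complex.I_im,
    Complex.ofReal_im, Complex.conj_re, Complex.conj_im, Complex.one_re, Complex.one_im,
    Complex.mul_im, Complex.sub_im, Complex.add_re, Complex.add_im, Complex.re_ofNat,
    Complex.im_ofNat]
  have ht := tan_theta_gt
  have h3 : (m ^ 2)⁻¹ * (m ^ 2)⁻¹ ≤ 1 := by nlinarith
  nlinarith [mul_nonneg (sq_nonneg (m ^ 2)⁻¹) (sq_nonneg (Real.tan theta))]

/-- The other eigenvalue of the cat map. -/
theorem lam_inv : lam⁻¹ = 1 - Real.tan theta := by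
  rw [inv_eq_iff_eq_inv, eq_comm, inv_eq_iff_eq_inv, eq_comm]
  refine inv_eq_of_mul_eq_one_left ?_
  rw [lam_eq]
  linear_combination -tan_theta_sq

theorem two_add_I_mul_div_eq {t E : ℂ} (h : 1 - Complex.I * (E * t) ≠ 0) (ht : t ^ 2 = 1 - t) :
    2 + Complex.I * ((E - Complex.I * t) / (1 - Complex.I * (E * t))) =
      (2 + t) * (1 - Complex.I * ((1 - t) ^ 2 * E * t)) / (1 - Complex.I * (E * t)) := by
  rw [eq_div_iff h, add_mul, mul_assoc Complex.I, div_mul_cancel₀ _ h]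
  linear_combination (-(Complex.I * E * (1 + t - t ^ 2))) * ht - t * Complex.I_sq

theorem div_sub_I_eq {t E : ℂ} (h : 1 - Complex.I * (E * t) ≠ 0) (ht : t ^ 2 = 1 - t) :
    (E - Complex.I * t) / (1 - Complex.I * (E * t)) - Complex.I =
      ((1 - t) ^ 2 * E - Complex.I * t) * (2 + t) / (1 - Complex.I * (E * t)) := by
  rw [eq_div_iff h, sub_mul, div_mul_cancel₀ _ h]
  linear_combination (E * (1 - t) + Complex.I) * ht + E * t * Complex.I_sq

/-- The amplitude acquires the automorphy factor of the Möbius transformation of `catOperator_gauss`. -/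
theorem stretchAmplitude_lam_mul (m : ℝ) :
    stretchAmplitude (lam * m) = stretchAmplitude m * (2 + Complex.I * stretchParam m) := by
  have h1 := tan_mul_I_ne ((m ^ 2)⁻¹ * Real.tan theta)
  have h2 := tan_mul_I_ne (Real.tan theta)
  have e : ((lam * m) ^ 2)⁻¹ = (1 - Real.tan theta) ^ 2 * (m ^ 2)⁻¹ := by
    rw [mul_pow, mul_inv, ← inv_pow, lam_inv]
  have h3 := two_add_I_mul_div_eq (E := (((m ^ 2)⁻¹ : ℝ) : ℂ))
    (by rwa [← Complex.ofReal_mul]) tan_theta_sq_complex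
  unfold stretchAmplitude stretchParam
  rw [e, lam_eq]
  push_cast at h1 h3 ⊢
  have e' : ∀ D₀ D₁ D₂ L : ℂ, m * D₁ / D₀ * (L * D₂ / D₁) = L * m * D₂ / D₀ * (D₁ / D₁) := by
    intro D₀ D₁ D₂ L
    ring
  rw [h3, e', div_self h1, mul_one]

/-- One step of the Möbius transformation of `catOperator_gauss` stretches by `λ`. -/
theorem stretchParam_lam_mul {m : ℝ} (hm : 1 ≤ m) :
    stretchParam (lam * m) =
      (stretchParam m - Complex.I) / (2 + Complex.I * stretchParam m) := by
  have h1 := tan_mul_I_ne ((m ^ 2)⁻¹ * Real.tan theta)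
  have h2 := tan_mul_I_ne (((lam * m) ^ 2)⁻¹ * Real.tan theta)
  have h3 : 2 + Complex.I * stretchParam m ≠ 0 := fun h => by
    have := two_add_I_mul_stretchParam_re_pos hm
    simp [h] at this
  have e : ((lam * m) ^ 2)⁻¹ = (1 - Real.tan theta) ^ 2 * (m ^ 2)⁻¹ := by
    rw [mul_pow, mul_inv, ← inv_pow, lam_inv]
  have h4 := two_add_I_mul_div_eq (E := (((m ^ 2)⁻¹ : ℝ) : ℂ))
    (by rwa [← Complex.ofReal_mul]) tan_theta_sq_complex
  have h5 := div_sub_I_eq (E := (((m ^ 2)⁻¹ : ℝ) : ℂ))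
    (by rwa [← Complex.ofReal_mul]) tan_theta_sq_complex
  rw [eq_div_iff h3]
  unfold stretchParam
  rw [e] at h2 ⊢
  push_cast at h1 h2 h4 h5 ⊢
  rw [h4, h5, mul_div_assoc', div_left_inj' h1, div_mul_eq_mul_div, div_eq_iff h2]
  ring

/-- The evolution of the coherent state at the origin. -/
theorem catOperator_iterate_wavePacket_zero (N : ℕ) [NeZero N] (n : ℕ) (x : ℝ) :
    (catOperator N)^[n] (wavePacket (planck N) (planck_pos N) 0 0) x =
      (((2 / planck N) ^ (1 / 4 : ℝ) : ℝ) : ℂ) * (1 / stretchAmplitude (lam ^ n)) ^ (1 / 2 : ℂ) *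
        gauss (N * stretchParam (lam ^ n)) x := by
  induction n generalizing x with
  | zero =>
    rw [Function.iterate_zero, id, wavePacket_apply, pow_zero, stretchAmplitude_one,
      stretchParam_one]
    unfold gauss planck
    simp
    left
    ring_nf
  | succ n ih =>
    have hm : 1 ≤ lam ^ n := one_le_pow₀ one_lt_lam.le
    rw [Function.iterate_succ_apply', catOperator_gauss
      (stretchParam_re_pos (zero_lt_one.trans_le hm)) ih, pow_succ', stretchParam_lam_mul hm,
      stretchAmplitude_lam_mul, mul_assoc _ _ (_ ^ (1 / 2 : ℂ)),
      ← mul_cpow_half_of_re_pos (inv_re_pos (stretchAmplitude_re_pos (zero_lt_one.trans_le hm)))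
        (inv_re_pos (two_add_I_mul_stretchParam_re_pos hm)), one_div_mul_one_div]

theorem wavePacket_eq_translation (N : ℕ) [NeZero N] (a b : ℝ) :
    wavePacket (planck N) (planck_pos N) a b = Complex.exp (-(Complex.I * Real.pi * N * (a * b))) •
      translation (planck N) a b (wavePacket (planck N) (planck_pos N) 0 0) := by
  ext x
  rw [smul_apply, smul_eq_mul, translation_apply, wavePacket_apply, wavePacket_apply]
  have e : ∀ c u v w y z : ℂ, Complex.exp u * (Complex.exp v * Complex.exp w *
      (c * Complex.exp y * Complex.exp z)) = c * Complex.exp (u + v + w + y + z) := by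
    intro c u v w y z
    simp only [Complex.exp_add]
    ring
  rw [e, mul_assoc, ← Complex.exp_add]
  congr 2
  have hN : (N : ℂ) ≠ 0 := by exact_mod_cast NeZero.ne N
  unfold planck
  push_cast
  field_simp
  ring

theorem catOrbit_succ (n : ℕ) (a b : ℝ) :
    catOrbit (n + 1) a b 0 = 2 * catOrbit n a b 0 + catOrbit n a b 1 ∧
      catOrbit (n + 1) a b 1 = catOrbit n a b 0 + catOrbit n a b 1 := by
  unfold catOrbit
  rw [pow_succ', ← Matrix.mulVec_mulVec]
  simp [catMatrix, Matrix.mulVec, dotProduct, Fin.sum_univ_two]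

theorem catOperator_iterate_translation (N : ℕ) [NeZero N] (n : ℕ) (a b : ℝ) (f : 𝓢(ℝ, ℂ)) :
    (catOperator N)^[n] (translation (planck N) a b f) =
      translation (planck N) (catOrbit n a b 0) (catOrbit n a b 1) ((catOperator N)^[n] f) := by
  induction n with
  | zero => simp [catOrbit]
  | succ n ih =>
    rw [Function.iterate_succ_apply', Function.iterate_succ_apply', ih, (catOrbit_succ n a b).1,
      (catOrbit_succ n a b).2]
    unfold catOperator
    rw [metaplectic_translation (planck_pos N).ne' (by simp [catMatrix])
      (by simp [catMatrix]; norm_num)]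
    simp [catMatrix]

theorem torusOperator_iterate_symm (N : ℕ) [NeZero N] [Fact (Even N)] (n : ℕ) (φ : 𝓢(ℝ, ℂ)) :
    (torusOperator N)^[n] (symm N φ) = symm N ((catOperator N)^[n] φ) := by
  induction n with
  | zero => rfl
  | succ n ih =>
    rw [Function.iterate_succ_apply', ih, torusOperator_symm, Function.iterate_succ_apply']

/-! ### Overlap of an evolved coherent state with a coherent state -/

/-- The overlap of the stretched coherent state with the unstretched one has a real amplitude: the
phases of the two square roots cancel. -/
theorem stretchAmplitude_mul_one_add {m : ℝ} :
    stretchAmplitude m * (1 + stretchParam m) = (m * (1 + (m ^ 2)⁻¹) : ℝ) := by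
  have h1 := tan_mul_I_ne ((m ^ 2)⁻¹ * Real.tan theta)
  have h2 := tan_mul_I_ne (Real.tan theta)
  unfold stretchAmplitude stretchParam
  rw [div_mul_eq_mul_div, div_eq_iff h2, mul_assoc, mul_add, mul_div_cancel₀ _ h1]
  push_cast
  ring

theorem cos_theta_sq_complex : (Real.cos theta ^ 2 : ℂ) * (2 - Real.tan theta) = 1 := by
  have h : Real.cos theta ^ 2 * (2 - Real.tan theta) = 1 := by
    rw [cos_theta_sq, tan_theta_sq, one_div, show 2 - Real.tan theta = 1 + (1 - Real.tan theta) by ring]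
    exact inv_mul_cancel₀ (by linarith [tan_theta_lt])
  exact_mod_cast h

/-- The inverse of `1 + ζ`, for the parameter `ζ` of a stretched coherent state. -/
theorem one_add_stretchParam_mul {m : ℝ} (hm : 0 < m) :
    (1 + stretchParam m) * (Real.cos theta ^ 2 * (1 + Complex.I * Real.tan theta) -
      ((m ^ 2)⁻¹ / (1 + (m ^ 2)⁻¹) : ℝ) * Real.cos theta ^ 2 *
        (1 + Complex.I * Real.tan theta) ^ 2) = 1 := by
  have h1 := tan_mul_I_ne ((m ^ 2)⁻¹ * Real.tan theta)
  have h2 := tan_mul_I_ne (Real.tan theta)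
  have hE : 0 < (m ^ 2)⁻¹ := by positivity
  have h3 : ((1 + (m ^ 2)⁻¹ : ℝ) : ℂ) ≠ 0 := by exact_mod_cast (by linarith : 1 + (m ^ 2)⁻¹ ≠ 0)
  have ht := tan_theta_sq_complex
  have hc := cos_theta_sq_complex
  have hI := Complex.I_sq
  unfold stretchParam
  rw [← mul_left_inj' h1, mul_right_comm, add_mul, div_mul_cancel₀ _ h1]
  generalize (m ^ 2)⁻¹ = E at *
  have h4 : ((E / (1 + E) : ℝ) : ℂ) * (1 + E) = E := by
    push_cast at h3 ⊢
    exact div_mul_cancel₀ _ h3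
  generalize ((E / (1 + E) : ℝ) : ℂ) = r at *
  have h5 : (Real.cos theta ^ 2 : ℂ) * (1 + Complex.I * Real.tan theta) *
      (1 - Complex.I * Real.tan theta) = 1 := by
    linear_combination hc + (Real.cos theta ^ 2 : ℂ) * ht -
      (Real.cos theta ^ 2 : ℂ) * (Real.tan theta : ℂ) ^ 2 * hI
  push_cast at *
  linear_combination (1 + E - r * (1 + E) * (1 + Complex.I * Complex.tan theta)) * h5 -
    (1 + Complex.I * Complex.tan theta) * h4

/-- The algebra behind `overlap_exponent_eq`: with `t = tan θ`, `c = cos² θ` and `w` the distance to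
the unstable line, the Gaussian exponent is a quadratic phase in `κ`, plus the profile in `w`, plus
a term of order `e`. -/
theorem gaussian_exponent_identity {I t c e κ w : ℂ} (hI : I ^ 2 = -1) (ht : t ^ 2 = 1 - t)
    (hc : c * (2 - t) = 1) :
    -κ ^ 2 + 2 * I * κ * (w + t * κ) +
        (I * (w + t * κ) - κ) ^ 2 * (c * (1 + I * t) - e * c * (1 + I * t) ^ 2) =
      I * (t * κ ^ 2 - t * c * w ^ 2) - c * w ^ 2 -
        e * (2 - t) * (κ + c * (t - I) * w) ^ 2 := by
  grind

theorem catOperator_iterate_smul (N n : ℕ) (c : ℂ) (f : 𝓢(ℝ, ℂ)) :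
    (catOperator N)^[n] (c • f) = c • (catOperator N)^[n] f := by
  induction n with
  | zero => rfl
  | succ n ih => rw [Function.iterate_succ_apply', Function.iterate_succ_apply', ih, map_smul]

/-- The factor by which a matrix element of the quantum cat map deviates from the damped value of
the observable; `d` is a real offset. -/
noncomputable def overlapFactor (N : ℕ) (m d : ℝ) (k : ℤ) (w : ℝ) : ℂ :=
  Complex.exp (-(Real.pi * N * ((m ^ 2)⁻¹ / (1 + (m ^ 2)⁻¹) : ℝ) / Real.cos theta ^ 2) *
    (k - d - Real.cos theta ^ 2 * (Real.tan theta - Complex.I) * w) ^ 2)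

/-- The matrix element between a translate of the evolved coherent state and a coherent state is a
Gaussian integral. -/
theorem inner2_translation_evolved {N : ℕ} [NeZero N] [Fact (Even N)] (n : ℕ) (a b q₀ p₀ : ℝ)
    (k : ℤ × ℤ) :
    inner2 (translation (planck N) k.1 k.2
        ((catOperator N)^[n] (wavePacket (planck N) (planck_pos N) a b)))
        (wavePacket (planck N) (planck_pos N) q₀ p₀) =
      (Real.sqrt 2 / Real.sqrt (lam ^ n * (1 + ((lam ^ n) ^ 2)⁻¹)) : ℝ) *
        Complex.exp (Real.pi * N * ((-(stretchParam (lam ^ n) * (k.1 + catOrbit n a b 0) ^ 2) - q₀ ^ 2 +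
          2 * Complex.I * p₀ * q₀ - 2 * Complex.I * catOrbit n a b 1 * k.1 -
          Complex.I * catOrbit n a b 0 * catOrbit n a b 1 - Complex.I * a * b) +
          (stretchParam (lam ^ n) * (k.1 + catOrbit n a b 0) + q₀ +
            Complex.I * (k.2 + catOrbit n a b 1 - p₀)) ^ 2 / (1 + stretchParam (lam ^ n)))) := by
  have hN : (0 : ℝ) < N := by exact_mod_cast Nat.pos_of_ne_zero (NeZero.ne N)
  have hNc : (N : ℂ) ≠ 0 := by exact_mod_cast NeZero.ne N
  have hπ : (Real.pi : ℂ) ≠ 0 := by exact_mod_cast Real.pi_ne_zero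
  have hm : 0 < lam ^ n := pow_pos (zero_lt_one.trans one_lt_lam) n
  rw [wavePacket_eq_translation N a b, catOperator_iterate_smul, catOperator_iterate_translation]
  set X := catOrbit n a b 0
  set Y := catOrbit n a b 1
  have hφ := catOperator_iterate_wavePacket_zero N n
  set φ := (catOperator N)^[n] (wavePacket (planck N) (planck_pos N) 0 0)
  have hζ := stretchParam_re_pos hm
  have hρ := stretchAmplitude_re_pos hm
  have hρζ := stretchAmplitude_mul_one_add (m := lam ^ n)
  set ζ := stretchParam (lam ^ n)
  set ρ := stretchAmplitude (lam ^ n)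
  set m := lam ^ n
  set C : ℝ := (2 / planck N) ^ (1 / 4 : ℝ) with hC
  have hCC : C * C = Real.sqrt (2 * N) := by
    have h0 : 0 < 2 / planck N := div_pos two_pos (planck_pos N)
    rw [hC, ← Real.rpow_add h0, Real.sqrt_eq_rpow]
    unfold planck
    rw [div_div_eq_mul_div, div_one]
    norm_num
  have e : ∀ x : ℝ, translation (planck N) k.1 k.2 (Complex.exp (-(Complex.I * Real.pi * N * (a * b))) •
      translation (planck N) X Y φ) x * conj (wavePacket (planck N) (planck_pos N) q₀ p₀ x) =
      ((C * C : ℝ) * (1 / ρ) ^ (1 / 2 : ℂ)) * Complex.exp (-(Real.pi * N * (1 + ζ)) * x ^ 2 +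
        (2 * Real.pi * N * (ζ * (k.1 + X) + q₀ + Complex.I * (k.2 + Y - p₀))) * x +
        Real.pi * N * (-(ζ * (k.1 + X) ^ 2) - q₀ ^ 2 +
          2 * Complex.I * p₀ * q₀ - 2 * Complex.I * Y * k.1 -
          Complex.I * X * Y - Complex.I * a * b)) := by
    intro x
    rw [translation_int, smul_apply, smul_eq_mul, translation_apply, hφ, wavePacket_apply, gauss]
    simp only [map_mul, Complex.conj_ofReal, ← Complex.exp_conj]
    have e1 : ∀ c d u v w x y z s: ℂ, Complex.exp u * (Complex.exp v * (Complex.exp w *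
        Complex.exp x * (c * d * Complex.exp y))) * (c * Complex.exp z * Complex.exp s) =
        c * c * d * Complex.exp (u + v + w + x + y + z + s) := by
      intro c d u v w x y z s
      simp only [Complex.exp_add]
      ring
    rw [e1]
    push_cast
    congr 2
    unfold planck
    simp only [map_div₀, map_neg, map_mul, map_sub, map_pow, Complex.conj_I, Complex.conj_ofReal, map_ofNat]
    push_cast
    simp only [div_div_eq_mul_div, div_one]
    ring
  unfold inner2
  simp_rw [e]
  have hζ1 : 0 < (1 + ζ).re := by rw [Complex.add_re, Complex.one_re]; linarith
  have hζ0 : 1 + ζ ≠ 0 := fun h => by simp [h] at hζ1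
  have hρ0 : ρ ≠ 0 := fun h => by simp [h] at hρ
  have hb : (-(Real.pi * N * (1 + ζ) : ℂ)).re < 0 := by
    have : (Real.pi * N * (1 + ζ) : ℂ) = ((Real.pi * N : ℝ) : ℂ) * (1 + ζ) := by push_cast; ring
    rw [this, Complex.neg_re, Complex.re_ofReal_mul, neg_lt_zero]
    have := Real.pi_pos
    positivity
  rw [integral_const_mul, integral_cexp_quadratic hb, ← mul_assoc]
  congr 1
  · have e2 : (Real.pi : ℂ) / - -(Real.pi * N * (1 + ζ)) = 1 / (N * (1 + ζ)) := by
      rw [neg_neg]; field_simp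
    have hq : 0 < (1 / ((N : ℂ) * (1 + ζ))).re := by
      refine inv_re_pos ?_
      rw [← Complex.ofReal_natCast, Complex.re_ofReal_mul]
      positivity
    have hpos : 0 < m * (1 + (m ^ 2)⁻¹) := by positivity
    rw [e2, mul_assoc, ← mul_cpow_half_of_re_pos (inv_re_pos hρ) hq]
    have e3 : 1 / ρ * (1 / (N * (1 + ζ))) = ((1 / (N * (m * (1 + (m ^ 2)⁻¹))) : ℝ) : ℂ) * 1 := by
      rw [one_div_mul_one_div, mul_left_comm, hρζ]
      push_cast
      ring
    rw [e3, ofReal_mul_cpow_half (by positivity) one_ne_zero, Complex.one_cpow, mul_one,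
      ← Complex.ofReal_mul, hCC, ← Real.sqrt_mul (by positivity), ← Real.sqrt_div (by positivity)]
    congr 2
    field_simp
  · congr 1
    field_simp
    ring

/-- Recentring of the exponent of the overlap at the position `q₀`. -/
theorem sq_div_one_add_eq {ζ z K κ q₀ μ : ℂ} (hz : (1 + ζ) * z = 1) (hK : K = κ + q₀) :
    -(ζ * K ^ 2) - q₀ ^ 2 + (ζ * K + q₀ + Complex.I * μ) ^ 2 / (1 + ζ) =
      -κ ^ 2 + 2 * Complex.I * κ * μ + (Complex.I * μ - κ) ^ 2 * z + 2 * Complex.I * q₀ * μ := by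
  rw [div_eq_mul_inv, inv_eq_of_mul_eq_one_right hz, hK]
  linear_combination (2 * (κ + q₀) * (Complex.I * μ - κ) + (1 + ζ) * (κ + q₀) ^ 2) * hz

/-- The exponent of a matrix element, after completing the square along the unstable direction. -/
theorem overlap_exponent_eq {N : ℕ} [Fact (Even N)] {m : ℝ} (hm : 0 < m) (a b q₀ p₀ x y : ℝ)
    (l₁ l₂ k l : ℤ) {w : ℝ}
    (hw : w = y - x * Real.tan theta - (p₀ - q₀ * Real.tan theta) + k * Real.tan theta + l) :
    Complex.exp (Real.pi * N * ((-(stretchParam m * ((-k - l₁ : ℤ) + (l₁ + x : ℝ)) ^ 2) - q₀ ^ 2 +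
        2 * Complex.I * p₀ * q₀ - 2 * Complex.I * (l₂ + y : ℝ) * (-k - l₁ : ℤ) -
        Complex.I * (l₁ + x : ℝ) * (l₂ + y : ℝ) - Complex.I * a * b) +
        (stretchParam m * ((-k - l₁ : ℤ) + (l₁ + x : ℝ)) + q₀ +
          Complex.I * ((l - l₂ : ℤ) + (l₂ + y : ℝ) - p₀)) ^ 2 / (1 + stretchParam m))) =
      Complex.exp (Complex.I * Real.pi * N * ((l₁ * y - l₂ * x - a * b - x * y +
        Real.tan theta * x ^ 2 + 2 * q₀ * p₀ - Real.tan theta * q₀ ^ 2 : ℝ) : ℂ)) *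
      (cis (N * Real.tan theta * k ^ 2 / 2 + k * (N * (y - x * Real.tan theta))) *
        packetProfile N q₀ w * overlapFactor N m (x - q₀) k w) := by
  have hc := cos_theta_sq_complex
  have hc0 : (Real.cos theta ^ 2 : ℂ) ≠ 0 := fun h => by rw [h] at hc; simp at hc
  have hc' : ∀ r : ℂ, -(Real.pi * N * r / Real.cos theta ^ 2) =
      -(Real.pi * N * r * (2 - Real.tan theta)) := by
    intro r
    rw [neg_inj, div_eq_iff hc0]
    linear_combination (-(Real.pi * N * r : ℂ)) * hc
  have h1 := sq_div_one_add_eq (K := ((-k - l₁ : ℤ) + (l₁ + x : ℝ) : ℂ)) (κ := x - k - q₀)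
    (q₀ := q₀) (μ := ((l - l₂ : ℤ) + (l₂ + y : ℝ) - p₀ : ℂ)) (one_add_stretchParam_mul hm)
    (by push_cast; ring)
  have h2 := gaussian_exponent_identity (e := (((m ^ 2)⁻¹ / (1 + (m ^ 2)⁻¹) : ℝ) : ℂ))
    (κ := x - k - q₀) (w := w) Complex.I_sq tan_theta_sq_complex hc
  have h3 : ((l - l₂ : ℤ) + (l₂ + y : ℝ) - p₀ : ℂ) = w + Real.tan theta * (x - k - q₀) := by
    rw [hw]
    push_cast
    ring
  rw [← h3] at h2
  rw [packetProfile_eq, overlapFactor, cis, hc', ← Complex.exp_add, ← Complex.exp_add,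
    ← Complex.exp_add]
  have h4 : ∀ {A B : ℂ}, A = Complex.I * Real.pi * N * (2 * l₂ * k + l₁ * l₂ : ℤ) + B →
      Complex.exp A = Complex.exp B := by
    intro A B h
    rw [h, Complex.exp_add, exp_even, one_mul]
  refine h4 ?_
  generalize ((m ^ 2)⁻¹ / (1 + (m ^ 2)⁻¹) : ℝ) = e at *
  generalize stretchParam m = ζ at *
  generalize hS : (ζ * ((-k - l₁ : ℤ) + (l₁ + x : ℝ)) + q₀ +
          Complex.I * ((l - l₂ : ℤ) + (l₂ + y : ℝ) - p₀)) ^ 2 / (1 + ζ) = S at *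
  push_cast at h1 h2 h3 ⊢
  linear_combination (Real.pi * N : ℂ) * (h1 + h2) + (Real.pi * N * 2 * Complex.I * q₀ : ℂ) * h3

/-- An exact formula for the matrix element. Re-indexing the lattice sum removes the integer part of
`Mⁿ (a, b)`, at the price of the phase. -/
theorem torusInner_eq_tsum {N : ℕ} [NeZero N] [Fact (Even N)] (n : ℕ) (a b q₀ p₀ : ℝ) :
    torusInner N ((torusOperator N)^[n] (torusPacket N a b)) (torusPacket N q₀ p₀) =
      (Real.sqrt 2 / Real.sqrt (lam ^ n * (1 + ((lam ^ n) ^ 2)⁻¹)) : ℝ) * phase N n a b q₀ p₀ *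
        ∑' p : ℤ × ℤ, (cis (N * Real.tan theta * p.1 ^ 2 / 2 + p.1 *
          (N * (Int.fract (catOrbit n a b 1) - Int.fract (catOrbit n a b 0) * Real.tan theta))) *
        packetProfile N q₀ (Int.fract (catOrbit n a b 1) - Int.fract (catOrbit n a b 0) *
          Real.tan theta - (p₀ - q₀ * Real.tan theta) + p.1 * Real.tan theta + p.2) *
        overlapFactor N (lam ^ n) (Int.fract (catOrbit n a b 0) - q₀) p.1
          (Int.fract (catOrbit n a b 1) - Int.fract (catOrbit n a b 0) *
          Real.tan theta - (p₀ - q₀ * Real.tan theta) + p.1 * Real.tan theta + p.2)) := by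
  unfold torusPacket
  rw [torusOperator_iterate_symm, torusInner_symm, ← tsum_mul_left]
  set X := catOrbit n a b 0 with hX
  set Y := catOrbit n a b 1 with hY
  -- the sign change of the first index gives the orbit of `tan θ` its positive direction
  rw [← ((Equiv.subLeft (-⌊X⌋)).prodCongr (Equiv.subRight ⌊Y⌋)).tsum_eq]
  congr 1
  ext ⟨k, l⟩
  have hk : ((Equiv.subLeft (-⌊X⌋)).prodCongr (Equiv.subRight ⌊Y⌋)) (k, l) =
      (-k - ⌊X⌋, l - ⌊Y⌋) := by
    simp only [Equiv.prodCongr_apply, Prod.map_apply, Equiv.subLeft_apply, Equiv.subRight_apply,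
      neg_sub_left, neg_sub_left, Prod.mk.injEq, and_true]
    ring
  rw [hk, inner2_translation_evolved]
  refine Eq.trans ?_ (mul_assoc _ _ _).symm
  congr 1
  have h := overlap_exponent_eq (N := N) (pow_pos (zero_lt_one.trans one_lt_lam) n) a b q₀ p₀
    (Int.fract X) (Int.fract Y) ⌊X⌋ ⌊Y⌋ k l rfl
  rw [Int.floor_add_fract, Int.floor_add_fract] at h
  exact h

/-! ### Comparison of the overlaps with the damped observable -/

theorem norm_exp_sub_exp_le {M : ℝ} {a b : ℂ} (ha : a.re ≤ M) (hb : b.re ≤ M) :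
    ‖Complex.exp a - Complex.exp b‖ ≤ Real.exp M * ‖a - b‖ := by
  refine (convex_halfSpace_re_le M).norm_image_sub_le_of_norm_hasDerivWithin_le
    (fun z _ => (Complex.hasDerivAt_exp z).hasDerivWithinAt) (fun z hz => ?_) hb ha
  rw [Complex.norm_exp]
  exact Real.exp_le_exp.2 hz

theorem one_sub_inv_sqrt_one_add_le {E : ℝ} (hE : 0 ≤ E) :
    0 ≤ 1 - 1 / Real.sqrt (1 + E) ∧ 1 - 1 / Real.sqrt (1 + E) ≤ E := by
  have h1 : 1 ≤ Real.sqrt (1 + E) := by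
    rw [Real.one_le_sqrt]; linarith
  have h2 : Real.sqrt (1 + E) ≤ 1 + E := by
    rw [Real.sqrt_le_left (by linarith)]; nlinarith
  have h3 : 1 / Real.sqrt (1 + E) ≤ 1 := by
    rw [div_le_one (by linarith)]; exact h1
  have h4 : 1 - E ≤ 1 / Real.sqrt (1 + E) := by
    rw [le_div_iff₀ (by linarith)]
    rcases le_total E 1 with h | h
    · nlinarith
    · nlinarith
  constructor <;> linarith

/-- The exponents of the overlap factor and of the damping factor differ by a small amount, for
times `k` up to the stretching factor. -/
theorem norm_overlap_exponent_sub_le {N E d w : ℝ} (hN : 0 ≤ N) (hE : 0 ≤ E) (hd : |d| ≤ 1) (k : ℤ) :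
    ‖(-(Real.pi * N * (E / (1 + E) : ℝ) / Real.cos theta ^ 2) *
      (k - d - Real.cos theta ^ 2 * (Real.tan theta - Complex.I) * w) ^ 2 -
      (-(Real.pi * N * E / Real.cos theta ^ 2 * k ^ 2) : ℝ) : ℂ)‖ ≤
      5 * (N * E) * (4 * |(k : ℝ)| * (1 + |w|) + 4 * (1 + |w|) ^ 2 + E * (k : ℝ) ^ 2) := by
  have hc := cos_theta_sq_gt
  have hc' := cos_theta_sq_lt
  have hπ := Real.pi_lt_d2
  have hπ0 := Real.pi_pos
  have ht := tan_theta_lt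
  have ht0 := tan_theta_gt
  set c := Real.cos theta ^ 2
  have hcc : (Real.cos theta ^ 2 : ℂ) = (c : ℂ) := (Complex.ofReal_pow _ _).symm
  rw [hcc]
  set η : ℂ := d + c * (Real.tan theta - Complex.I) * w with hη
  have hηn : ‖η‖ ≤ 2 * (1 + |w|) := by
    refine (norm_add_le _ _).trans ?_
    have h1 : ‖(Real.tan theta - Complex.I : ℂ)‖ ≤ 1.62 := by
      refine (norm_sub_le _ _).trans ?_
      rw [Complex.norm_I, Complex.norm_real, Real.norm_eq_abs, abs_of_pos (by linarith)]
      linarith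
    rw [norm_mul, norm_mul, Complex.norm_real, Complex.norm_real, Complex.norm_real,
      Real.norm_eq_abs, Real.norm_eq_abs, Real.norm_eq_abs, abs_of_pos (by linarith : 0 < c)]
    calc |d| + c * ‖(Real.tan theta - Complex.I : ℂ)‖ * |w| ≤ 1 + 0.73 * 1.62 * |w| := by gcongr
      _ ≤ _ := by linarith [abs_nonneg w]
  have hE1 : (0 : ℝ) < 1 + E := by linarith
  have he0 : 0 ≤ E / (1 + E) := by positivity
  have he1 : E / (1 + E) ≤ E := div_le_self hE (by linarith)
  have he2 : E - E / (1 + E) ≤ E * E := by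
    rw [sub_le_iff_le_add, ← sub_le_iff_le_add', le_div_iff₀ hE1]
    nlinarith [mul_nonneg hE (mul_nonneg hE hE)]
  set e := E / (1 + E)
  have key : (-(Real.pi * N * (e : ℝ) / c) *
      (k - d - c * (Real.tan theta - Complex.I) * w) ^ 2 -
      (-(Real.pi * N * E / c * k ^ 2) : ℝ) : ℂ) =
      ((Real.pi / c * N : ℝ) : ℂ) * ((e : ℂ) * (2 * k * η - η ^ 2) + ((E - e) * k ^ 2 : ℝ)) := by
    rw [show (k - d - c * (Real.tan theta - Complex.I) * w : ℂ) = k - η by rw [hη]; ring]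
    push_cast
    ring
  rw [key, norm_mul, Complex.norm_real, Real.norm_of_nonneg (by positivity)]
  have h1 : Real.pi / c ≤ 5 := by
    rw [div_le_iff₀ (by linarith)]; linarith
  have h2 : ‖((e : ℂ) * (2 * k * η - η ^ 2) + ((E - e) * k ^ 2 : ℝ))‖ ≤
      E * (4 * |(k : ℝ)| * (1 + |w|) + 4 * (1 + |w|) ^ 2 + E * (k : ℝ) ^ 2) := by
    refine (norm_add_le _ _).trans ?_
    rw [norm_mul, Complex.norm_real, Real.norm_of_nonneg he0, Complex.norm_real, norm_mul,
      Real.norm_of_nonneg (sub_nonneg.2 he1), Real.norm_of_nonneg (sq_nonneg _)]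
    have h3 : ‖(2 * k * η - η ^ 2 : ℂ)‖ ≤ 4 * |(k : ℝ)| * (1 + |w|) + 4 * (1 + |w|) ^ 2 := by
      refine (norm_sub_le _ _).trans ?_
      rw [norm_mul, norm_mul, norm_pow, Complex.norm_two, Complex.norm_intCast]
      calc 2 * |(k : ℝ)| * ‖η‖ + ‖η‖ ^ 2 ≤ 2 * |(k : ℝ)| * (2 * (1 + |w|)) + (2 * (1 + |w|)) ^ 2 := by
            gcongr
        _ = _ := by ring
    calc _ ≤ E * (4 * |(k : ℝ)| * (1 + |w|) + 4 * (1 + |w|) ^ 2) + E * E * (k : ℝ) ^ 2 := by gcongr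
      _ = _ := by ring
  calc _ ≤ 5 * N * (E * (4 * |(k : ℝ)| * (1 + |w|) + 4 * (1 + |w|) ^ 2 + E * (k : ℝ) ^ 2)) := by
        gcongr
    _ = _ := by ring

/-- The overlap factor may grow in `w`, but more slowly than the profile, of modulus
`exp (-π N cos² θ w²)`, decays: the product keeps a Gaussian decay in both `k` and `w`. -/
theorem overlap_exponent_re_le {N E d w : ℝ} (hN : 0 ≤ N) (hE : 0 ≤ E) (hE1 : E ≤ 1 / 4)
    (hNE : N * E ≤ 1 / 2) (hd : |d| ≤ 1) (k : ℤ) :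
    (-(Real.pi * N * (E / (1 + E) : ℝ) / Real.cos theta ^ 2) *
      (k - d - Real.cos theta ^ 2 * (Real.tan theta - Complex.I) * w) ^ 2 : ℂ).re ≤
      Real.pi * N * Real.cos theta ^ 2 * w ^ 2 + 5 - (N * E * k ^ 2 + N * w ^ 2) / 2 := by
  have hc := cos_theta_sq_gt
  have hc' := cos_theta_sq_lt
  have hπ := Real.pi_lt_d2
  have hπ0 := Real.pi_gt_three
  have ht := tan_theta_lt
  have ht0 := tan_theta_gt
  set c := Real.cos theta ^ 2
  set t := Real.tan theta
  have hcc : (Real.cos theta ^ 2 : ℂ) = (c : ℂ) := (Complex.ofReal_pow _ _).symm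
  rw [hcc]
  have hE2 : (0 : ℝ) < 1 + E := by linarith
  set z : ℝ := k - d - c * t * w with hz
  have e1 : (-(Real.pi * N * (E / (1 + E) : ℝ) / c) * (k - d - c * (t - Complex.I) * w) ^ 2 : ℂ) =
      ((-(Real.pi * N * (E / (1 + E)) / c) * (z ^ 2 - (c * w) ^ 2) : ℝ) : ℂ) +
        ((-(Real.pi * N * (E / (1 + E)) / c) * (2 * z * (c * w)) : ℝ) : ℂ) * Complex.I := by
    rw [hz]
    push_cast
    linear_combination (-(Real.pi * N * (E / (1 + E)) / c) * (c * w) ^ 2 : ℂ) * Complex.I_sq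
  rw [e1, Complex.add_re, Complex.ofReal_re, Complex.re_ofReal_mul, Complex.I_re, mul_zero, add_zero]
  -- the quadratic form is bounded below by a diagonal one
  have hk : (k : ℝ) ^ 2 / 2 ≤ z ^ 2 + 2 + 2 * (c * t * w) ^ 2 := by
    have h1 : (k : ℝ) = z + (d + c * t * w) := by rw [hz]; ring
    have h2 : d ^ 2 ≤ 1 := by rw [← sq_abs]; exact pow_le_one₀ (abs_nonneg d) hd
    rw [h1]
    nlinarith [sq_nonneg (z - (d + c * t * w)), sq_nonneg (d - c * t * w)]
  have hct : (c * t * w) ^ 2 ≤ 0.3 * (c * w ^ 2) := by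
    have : c * t ^ 2 ≤ 0.3 := by nlinarith
    calc (c * t * w) ^ 2 = (c * t ^ 2) * (c * w ^ 2) := by ring
      _ ≤ _ := by gcongr
  have hid : -(Real.pi * N * (E / (1 + E)) / c) * (z ^ 2 - (c * w) ^ 2) =
      Real.pi * N * c * w ^ 2 - Real.pi / (1 + E) * N * (c * w ^ 2 + E * z ^ 2 / c) := by
    have : c ≠ 0 := by linarith
    field_simp
    ring
  rw [hid]
  have h1 : 2.4 ≤ Real.pi / (1 + E) := by rw [le_div_iff₀ hE2]; linarith
  have h1' : Real.pi / (1 + E) ≤ 3.15 := by rw [div_le_iff₀ hE2]; nlinarith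
  set p := Real.pi / (1 + E)
  have h2 : E * ((k : ℝ) ^ 2 / 2 - 2 - 2 * (0.3 * (c * w ^ 2))) ≤ E * z ^ 2 := by
    gcongr; linarith
  have h3 : E * ((k : ℝ) ^ 2 / 2) / c - 2 * E / c - 0.6 * (E * w ^ 2) ≤ E * z ^ 2 / c := by
    have : E * ((k : ℝ) ^ 2 / 2) / c - 2 * E / c - 0.6 * (E * w ^ 2) =
      (E * ((k : ℝ) ^ 2 / 2 - 2 - 2 * (0.3 * (c * w ^ 2)))) / c := by
      have : c ≠ 0 := by linarith
      field_simp
      ring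
    rw [this]
    gcongr
  have h4 : 0.6 * (E * (k : ℝ) ^ 2) ≤ E * ((k : ℝ) ^ 2 / 2) / c := by
    rw [le_div_iff₀ (by linarith)]
    have : 0 ≤ E * (k : ℝ) ^ 2 := by positivity
    nlinarith
  have h5 : 2 * E / c ≤ 2.8 * E := by
    rw [div_le_iff₀ (by linarith)]; nlinarith
  have hw : E * w ^ 2 ≤ 1 / 4 * w ^ 2 := by gcongr
  have hcw : 0.72 * w ^ 2 ≤ c * w ^ 2 := by gcongr
  have h6 : 0.5 * w ^ 2 + 0.6 * (E * (k : ℝ) ^ 2) - 2.8 * E ≤ c * w ^ 2 + E * z ^ 2 / c := by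
    linarith [sq_nonneg w]
  have h7 : p * N * (0.5 * w ^ 2 + 0.6 * (E * (k : ℝ) ^ 2) - 2.8 * E) ≤
      p * N * (c * w ^ 2 + E * z ^ 2 / c) := by gcongr
  have h8 : 2.4 * (N * w ^ 2) ≤ p * (N * w ^ 2) := by gcongr
  have h9 : 2.4 * (N * E * (k : ℝ) ^ 2) ≤ p * (N * E * (k : ℝ) ^ 2) := by gcongr
  have h10 : p * (N * E) ≤ 3.15 * (1 / 2) := by gcongr
  have h13 : p * N * (0.5 * w ^ 2 + 0.6 * (E * (k : ℝ) ^ 2) - 2.8 * E) =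
      0.5 * (p * (N * w ^ 2)) + 0.6 * (p * (N * E * (k : ℝ) ^ 2)) - 2.8 * (p * (N * E)) := by ring
  have h11 : 0 ≤ N * w ^ 2 := by positivity
  have h12 : 0 ≤ N * E * (k : ℝ) ^ 2 := by positivity
  linarith

/-- The polynomial factor in the difference of exponents is absorbed by half of the Gaussian. -/
theorem overlap_polynomial_le {N E r : ℝ} (hN : 1 ≤ N) (hr0 : 0 ≤ r) (hr1 : r ≤ 1) (hrr : r * r = N * E)
    (hEr : E ≤ r) (k : ℤ) (w : ℝ) :
    5 * (N * E) * (4 * |(k : ℝ)| * (1 + |w|) + 4 * (1 + |w|) ^ 2 + E * (k : ℝ) ^ 2) ≤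
      240 * r * Real.exp ((N * E * k ^ 2 + N * w ^ 2) / 4) := by
  have hx : (r * |(k : ℝ)|) ^ 2 = N * E * k ^ 2 := by rw [mul_pow, sq_abs, sq, hrr]
  set A := N * E * (k : ℝ) ^ 2 with hA
  set B := N * w ^ 2 with hB
  have hw : |w| ^ 2 ≤ B := by
    rw [sq_abs]
    exact le_mul_of_one_le_left (sq_nonneg w) hN
  have hA0 : 0 ≤ A := by rw [← hx]; positivity
  have hB0 : 0 ≤ B := (sq_nonneg _).trans hw
  set W := 1 + |w| with hW
  have hW0 : 0 ≤ W := by positivity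
  have hW2 : W ^ 2 ≤ 2 + 2 * B := by
    rw [hW]
    linarith [sq_nonneg (1 - |w|)]
  have hxW : 2 * (r * |(k : ℝ)| * W) ≤ A + W ^ 2 := by
    rw [← hx]
    linarith [sq_nonneg (r * |(k : ℝ)| - W)]
  have e0 := Real.add_one_le_exp ((A + B) / 4)
  calc _ = 5 * (r * (4 * (r * |(k : ℝ)| * W)) + r * (4 * (r * W ^ 2)) + E * A) := by
        rw [hA, ← hrr]; ring
    _ ≤ 5 * (r * (4 * (r * |(k : ℝ)| * W)) + r * (4 * (1 * W ^ 2)) + r * A) := by gcongr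
    _ = 5 * r * (2 * (2 * (r * |(k : ℝ)| * W)) + 4 * W ^ 2 + A) := by ring
    _ ≤ 5 * r * (2 * (A + (2 + 2 * B)) + 4 * (2 + 2 * B) + A) := by gcongr; linarith
    _ ≤ 5 * r * (48 * ((A + B) / 4 + 1)) := by gcongr; linarith
    _ = 240 * r * ((A + B) / 4 + 1) := by ring
    _ ≤ _ := by gcongr

/-- On the effective support of the profile, overlap and damping factors agree up to `O(√(N E))`,
with room to spare in the Gaussian decay. -/
theorem norm_overlap_sub_damping_le {N : ℕ} [NeZero N] {m d q₀ : ℝ} (hm : 0 < m)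
    (hE1 : (m ^ 2)⁻¹ ≤ 1 / 4) (hNE : N * (m ^ 2)⁻¹ ≤ 1 / 2) (hd : |d| ≤ 1) (k : ℤ) (w : ℝ) :
    ‖packetProfile N q₀ w * ((1 / Real.sqrt (1 + (m ^ 2)⁻¹) : ℝ) * overlapFactor N m d k w -
      (Real.exp (-(Real.pi * N * (m ^ 2)⁻¹ / Real.cos theta ^ 2 * k ^ 2)) : ℂ))‖ ≤
      241 * Real.exp 5 * Real.sqrt (N * (m ^ 2)⁻¹) *
        Real.exp (-(N * (m ^ 2)⁻¹ / 4 * k ^ 2 + N / 4 * w ^ 2)) := by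
  have hN1 : (1 : ℝ) ≤ N := by exact_mod_cast Nat.one_le_iff_ne_zero.2 (NeZero.ne N)
  have hE0 : 0 < (m ^ 2)⁻¹ := by positivity
  have hc := cos_theta_sq_gt
  have hc' := cos_theta_sq_lt
  have hπ0 := Real.pi_gt_three
  have hs := one_sub_inv_sqrt_one_add_le hE0.le
  have hq := norm_overlap_exponent_sub_le (w := w) (by linarith : (0 : ℝ) ≤ N) hE0.le hd k
  have hr := overlap_exponent_re_le (w := w) (by linarith : (0 : ℝ) ≤ N) hE0.le hE1 hNE hd k
  have hF := norm_packetProfile N q₀ w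
  have hR : overlapFactor N m d k w = Complex.exp
    (-(Real.pi * N * ((m ^ 2)⁻¹ / (1 + (m ^ 2)⁻¹) : ℝ) / Real.cos theta ^ 2) *
      (k - d - Real.cos theta ^ 2 * (Real.tan theta - Complex.I) * w) ^ 2) := rfl
  rw [hR, Complex.ofReal_exp]
  generalize (m ^ 2)⁻¹ = E at *
  generalize (-(Real.pi * N * (E / (1 + E) : ℝ) / Real.cos theta ^ 2) *
      (k - d - Real.cos theta ^ 2 * (Real.tan theta - Complex.I) * w) ^ 2 : ℂ) = Q at *
  set c := Real.cos theta ^ 2 with hcdef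
  set Q₀ : ℝ := -(Real.pi * N * E / c * k ^ 2) with hQ₀
  set s := 1 / Real.sqrt (1 + E)
  set A := N * E * (k : ℝ) ^ 2 with hA
  set B := N * w ^ 2 with hB
  set r := Real.sqrt (N * E) with hr_def
  have hNE0 : 0 ≤ N * E := by positivity
  have hrr : r * r = N * E := Real.mul_self_sqrt hNE0
  have hr0 : 0 ≤ r := Real.sqrt_nonneg _
  have hA0 : 0 ≤ A := by positivity
  have hB0 : 0 ≤ B := by positivity
  set M := Real.pi * N * c * w ^ 2 + 5 - (A + B) / 2 with hM
  have hQ₀M : Q₀ ≤ M := by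
    have h1 : 1 / 2 * A ≤ Real.pi / c * A := by
      refine mul_le_mul_of_nonneg_right ?_ hA0
      rw [le_div_iff₀ (by linarith)]
      linarith
    have h2 : 2.16 * B ≤ Real.pi * c * B := by
      refine mul_le_mul_of_nonneg_right ?_ hB0
      nlinarith
    have h3 : Q₀ = -(Real.pi / c * A) := by rw [hQ₀, hA]; ring
    have h4 : Real.pi * N * c * w ^ 2 = Real.pi * c * B := by rw [hB]; ring
    rw [h3, hM, h4]
    linarith
  have h1 := norm_exp_sub_exp_le (a := Q) (b := (Q₀ : ℂ)) hr (by simpa using hQ₀M)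
  have hFM : ‖packetProfile N q₀ w‖ * Real.exp M = Real.exp 5 * Real.exp (-((A + B) / 2)) := by
    rw [hF, ← Real.exp_add, ← Real.exp_add, hM]
    congr 1
    ring
  -- the polynomial factor is absorbed by half of the Gaussian
  have hr1 : r ≤ 1 := by
    rw [hr_def, Real.sqrt_le_left zero_le_one, one_pow]
    linarith
  have hEr : E ≤ r := by
    calc E ≤ N * E := le_mul_of_one_le_left hE0.le hN1
      _ = r * r := hrr.symm
      _ ≤ r := mul_le_of_le_one_left hr0 hr1
  have hpoly := overlap_polynomial_le hN1 hr0 hr1 hrr hEr k w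
  have h2 : ‖packetProfile N q₀ w‖ * ‖Complex.exp Q - Complex.exp Q₀‖ ≤
      240 * Real.exp 5 * r * Real.exp (-((A + B) / 4)) := by
    calc _ ≤ ‖packetProfile N q₀ w‖ * (Real.exp M * (240 * r * Real.exp ((A + B) / 4))) := by
          gcongr
          exact h1.trans (by gcongr; exact hq.trans hpoly)
      _ = (‖packetProfile N q₀ w‖ * Real.exp M) * (240 * r * Real.exp ((A + B) / 4)) := by ring
      _ = 240 * Real.exp 5 * r * (Real.exp (-((A + B) / 2)) * Real.exp ((A + B) / 4)) := by
          rw [hFM]; ring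
      _ = _ := by rw [← Real.exp_add]; congr 2; ring
  have h3 : ‖packetProfile N q₀ w‖ * Real.exp Q₀ ≤ Real.exp 5 * Real.exp (-((A + B) / 4)) := by
    calc _ ≤ ‖packetProfile N q₀ w‖ * Real.exp M := by gcongr
      _ = Real.exp 5 * Real.exp (-((A + B) / 2)) := hFM
      _ ≤ _ := by
        gcongr
        linarith
  have e1 : (s : ℂ) * Complex.exp Q - Complex.exp Q₀ =
      s * (Complex.exp Q - Complex.exp Q₀) - ((1 - s : ℝ) : ℂ) * (Real.exp Q₀ : ℂ) := by
    push_cast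
    ring
  have e2 : -(N * E / 4 * (k : ℝ) ^ 2 + N / 4 * w ^ 2) = -((A + B) / 4) := by
    rw [hA, hB]; ring
  have hs0 : 0 ≤ s := by positivity
  rw [e1, e2, norm_mul]
  calc _ ≤ ‖packetProfile N q₀ w‖ * (1 * ‖Complex.exp Q - Complex.exp Q₀‖ + r * Real.exp Q₀) := by
        gcongr
        refine (norm_sub_le _ _).trans ?_
        rw [norm_mul, norm_mul, Complex.norm_real, Complex.norm_real, Complex.norm_real,
          Real.norm_of_nonneg hs0, Real.norm_of_nonneg hs.1, Real.norm_of_nonneg (Real.exp_pos _).le]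
        gcongr
        · linarith [hs.1]
        · exact hs.2.trans hEr
    _ = ‖packetProfile N q₀ w‖ * ‖Complex.exp Q - Complex.exp Q₀‖ +
        r * (‖packetProfile N q₀ w‖ * Real.exp Q₀) := by ring
    _ ≤ 240 * Real.exp 5 * r * Real.exp (-((A + B) / 4)) +
        r * (Real.exp 5 * Real.exp (-((A + B) / 4))) := by gcongr
    _ = _ := by ring

/-- The sum of the overlaps is a damped sum of the profile, up to `O(√h)`. By `lattice_gaussian_sum`
there are `O(m / N)` effective terms, each of which contributes an error `O(√N / m)`. -/
theorem norm_overlap_sum_sub_le {N : ℕ} [NeZero N] (hN : 2 ≤ N) {m d : ℝ} (hm : N ≤ m) (hd : |d| ≤ 1)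
    (q₀ x₀ ξ : ℝ) :
    ‖((1 / Real.sqrt (1 + (m ^ 2)⁻¹) : ℝ) : ℂ) * ∑' p : ℤ × ℤ,
        (cis (N * Real.tan theta * p.1 ^ 2 / 2 + p.1 * ξ) *
          packetProfile N q₀ (x₀ + p.1 * Real.tan theta + p.2) *
          overlapFactor N m d p.1 (x₀ + p.1 * Real.tan theta + p.2)) -
      ∑' p : ℤ × ℤ, dampedPhase (N * Real.tan theta) (N / (Real.cos theta ^ 2 * m ^ 2)) ξ p.1 *
        packetProfile N q₀ (x₀ + p.1 * Real.tan theta + p.2)‖ ≤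
      241 * Real.exp 5 * (135 * Real.exp (5 / 2)) / Real.sqrt N := by
  have hN2 : (2 : ℝ) ≤ N := by exact_mod_cast hN
  have hm0 : 0 < m := by linarith
  have hE0 : 0 < (m ^ 2)⁻¹ := by positivity
  have hE1 : (m ^ 2)⁻¹ ≤ 1 / 4 := by
    rw [one_div]
    exact inv_anti₀ (by norm_num) (by nlinarith)
  have hNE : N * (m ^ 2)⁻¹ ≤ 1 / 2 := by
    rw [← div_eq_mul_inv, div_le_div_iff₀ (by positivity) two_pos]
    nlinarith
  have hc : 0 < Real.cos theta ^ 2 := by linarith [cos_theta_sq_gt]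
  have hlat := lattice_gaussian_sum (by norm_num) tan_theta_badlyApproximable
    (A := N * (m ^ 2)⁻¹ / 4) (B := N / 4) (by positivity) (by positivity) x₀
  set g : ℤ × ℤ → ℝ := fun k =>
    Real.exp (-(N * (m ^ 2)⁻¹ / 4 * (k.1 : ℝ) ^ 2 + N / 4 * (x₀ + Real.tan theta * k.1 + k.2) ^ 2))
    with hg
  set s := 1 / Real.sqrt (1 + (m ^ 2)⁻¹) with hs
  set f₁ : ℤ × ℤ → ℂ := fun p => cis (N * Real.tan theta * p.1 ^ 2 / 2 + p.1 * ξ) *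
          packetProfile N q₀ (x₀ + p.1 * Real.tan theta + p.2) *
          overlapFactor N m d p.1 (x₀ + p.1 * Real.tan theta + p.2) with hf₁
  set f₂ : ℤ × ℤ → ℂ := fun p => dampedPhase (N * Real.tan theta)
    (N / (Real.cos theta ^ 2 * m ^ 2)) ξ p.1 *
      packetProfile N q₀ (x₀ + p.1 * Real.tan theta + p.2) with hf₂
  have hbd : ∀ p, ‖(s : ℂ) * f₁ p - f₂ p‖ ≤
      241 * Real.exp 5 * Real.sqrt (N * (m ^ 2)⁻¹) * g p := by
    intro p
    have h := norm_overlap_sub_damping_le (q₀ := q₀) hm0 hE1 hNE hd p.1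
      (x₀ + p.1 * Real.tan theta + p.2)
    have e : (s : ℂ) * f₁ p - f₂ p = cis (N * Real.tan theta * p.1 ^ 2 / 2 + p.1 * ξ) *
        (packetProfile N q₀ (x₀ + p.1 * Real.tan theta + p.2) *
          (s * overlapFactor N m d p.1 (x₀ + p.1 * Real.tan theta + p.2) -
          (Real.exp (-(Real.pi * N * (m ^ 2)⁻¹ / Real.cos theta ^ 2 * (p.1 : ℝ) ^ 2)) : ℂ))) := by
      have e2 : Real.pi * (N / (Real.cos theta ^ 2 * m ^ 2)) * (p.1 : ℝ) ^ 2 =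
          Real.pi * N * (m ^ 2)⁻¹ / Real.cos theta ^ 2 * (p.1 : ℝ) ^ 2 := by
        field_simp
      simp only [hf₁, hf₂, dampedPhase, e2]
      ring
    rw [e, norm_mul, norm_cis, one_mul]
    refine h.trans (le_of_eq ?_)
    simp only [hg]
    ring_nf
  have hs₂ : Summable f₂ := summable_dampedPhase_mul_packetProfile (by positivity) ξ x₀ q₀
  have hsd : Summable fun p => (s : ℂ) * f₁ p - f₂ p :=
    Summable.of_norm_bounded (hlat.1.mul_left _) hbd
  have hs₁ : Summable fun p => (s : ℂ) * f₁ p := by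
    simpa using hsd.add hs₂
  rw [← tsum_mul_left, ← hs₁.tsum_sub hs₂]
  refine (tsum_of_norm_bounded (hlat.1.mul_left _).hasSum hbd).trans ?_
  rw [tsum_mul_left]
  have hsN : 0 < Real.sqrt N := Real.sqrt_pos.2 (by linarith)
  have hsN2 : Real.sqrt N * Real.sqrt N = N := Real.mul_self_sqrt (by linarith)
  have h1 : Real.sqrt (N * (m ^ 2)⁻¹) = Real.sqrt N / m := by
    rw [← div_eq_mul_inv, Real.sqrt_div (by linarith), Real.sqrt_sq hm0.le]
  have h2 : Real.sqrt (N * (m ^ 2)⁻¹ / 4 * (N / 4)) = N / (4 * m) := by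
    rw [show N * (m ^ 2)⁻¹ / 4 * (N / 4) = ((N : ℝ) / (4 * m)) ^ 2 by field_simp,
      Real.sqrt_sq (by positivity)]
  have h3 : 1 / Real.sqrt ((N : ℝ) / 4) ≤ 2 := by
    rw [div_le_iff₀ (Real.sqrt_pos.2 (by linarith))]
    have : (1 / 2 : ℝ) ≤ Real.sqrt ((N : ℝ) / 4) := by
      rw [Real.le_sqrt (by norm_num) (by linarith)]; linarith
    linarith
  have h4 : 1 + 1 / (1 / 3 * Real.sqrt (N * (m ^ 2)⁻¹ / 4 * (N / 4))) + 1 / Real.sqrt ((N : ℝ) / 4) ≤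
      15 * (m / N) := by
    have h5 : 1 ≤ m / N := by rw [le_div_iff₀ (by linarith)]; linarith
    have h6 : 1 / (1 / 3 * Real.sqrt (N * (m ^ 2)⁻¹ / 4 * (N / 4))) = 12 * (m / N) := by
      rw [h2]; field_simp; norm_num
    rw [h6]
    linarith
  calc _ ≤ 241 * Real.exp 5 * Real.sqrt (N * (m ^ 2)⁻¹) * (9 * Real.exp (5 / 2) * (15 * (m / N))) := by
        gcongr
        exact hlat.2.trans (by gcongr)
    _ = _ := by
      have h7 : Real.sqrt N / N = 1 / Real.sqrt N := by
        rw [div_eq_div_iff (by linarith) hsN.ne', hsN2, one_mul]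
      have h8 : 241 * Real.exp 5 * (Real.sqrt N / m) * (9 * Real.exp (5 / 2) * (15 * (m / N))) =
          241 * Real.exp 5 * (135 * Real.exp (5 / 2)) * (Real.sqrt N / N) * (m / m) := by ring
      rw [h1, h8, h7, div_self hm0.ne', mul_one, mul_one_div]

/-! ### The error estimate -/

theorem natCast_le_lam_pow {N : ℕ} [NeZero N] {n : ℕ}
    (h : Real.log (1 / planck N) / Real.log lam ≤ n) : (N : ℝ) ≤ lam ^ n := by
  have hN : (0 : ℝ) < N := by exact_mod_cast Nat.pos_of_ne_zero (NeZero.ne N)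
  have hl := Real.log_pos one_lt_lam
  unfold planck at h
  rw [one_div_one_div, div_le_iff₀ hl, ← Real.log_pow] at h
  exact (Real.log_le_log_iff hN (pow_pos (zero_lt_one.trans one_lt_lam) n)).1 h

/-- Exponential smallness beats the polynomial loss and every power of `h`. -/
theorem cube_mul_exp_neg_le {N : ℕ} [NeZero N] (k : ℕ) :
    (N : ℝ) ^ 3 * Real.exp (-(N / 8)) ≤ 8 ^ (k + 3) * (k + 3).factorial * planck N ^ k := by
  have hN : (0 : ℝ) < N := by exact_mod_cast Nat.pos_of_ne_zero (NeZero.ne N)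
  have h := Real.pow_div_factorial_le_exp ((N : ℝ) / 8) (by positivity) (k + 3)
  rw [div_pow, div_div, div_le_iff₀ (by positivity)] at h
  unfold planck
  rw [Real.exp_neg, ← div_eq_mul_inv, div_le_iff₀ (Real.exp_pos _), one_div, inv_pow,
    ← mul_le_mul_iff_left₀ (pow_pos hN k)]
  calc (N : ℝ) ^ 3 * N ^ k = N ^ (k + 3) := by ring
    _ ≤ _ := h
    _ = _ := by field_simp

theorem norm_phase (N n : ℕ) (a b q₀ p₀ : ℝ) : ‖phase N n a b q₀ p₀‖ = 1 := by
  unfold phase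
  simp only
  rw [show ∀ x : ℝ, Complex.I * Real.pi * N * (x : ℂ) = ((Real.pi * N * x : ℝ) : ℂ) * Complex.I by
    intro x; push_cast; ring]
  exact Complex.norm_exp_ofReal_mul_I _

/-- The error splits into that of the damping and that of the periodization; the length of the
Birkhoff sum is of order `λⁿ / √N`, whence the factor `√(λⁿ)` in the second. -/
theorem norm_torusInner_sub_mainTerm_le {N : ℕ} [NeZero N] [Fact (Even N)] {n : ℕ}
    (hn : Real.log (1 / planck N) / Real.log lam ≤ n) (a b : ℝ) {q₀ p₀ : ℝ}
    (hq : q₀ ∈ Set.Ico (0 : ℝ) 1) :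
    ‖torusInner N ((torusOperator N)^[n] (torusPacket N a b)) (torusPacket N q₀ p₀) -
        mainTerm N n a b q₀ p₀‖ ≤
      Real.sqrt 2 / Real.sqrt (lam ^ n) *
        (241 * Real.exp 5 * (135 * Real.exp (5 / 2)) / Real.sqrt N +
          7680 * sawConst * N ^ 3 * Real.exp (-(N / 8)) * Real.sqrt (lam ^ n)) := by
  have hN : 2 ≤ N := by
    obtain ⟨j, hj⟩ := (Fact.out : Even N)
    have := NeZero.ne N
    omega
  have hN2 : (2 : ℝ) ≤ N := by exact_mod_cast hN
  have hNm := natCast_le_lam_pow hn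
  have hm0 : 0 < lam ^ n := by linarith
  have hc := cos_theta_sq_gt
  have hc' := cos_theta_sq_lt
  rw [torusInner_eq_tsum, mainTerm, birkhoffSum_observable N hm0]
  have hph := norm_phase N n a b q₀ p₀
  set x := Int.fract (catOrbit n a b 0)
  set y := Int.fract (catOrbit n a b 1)
  have hx0 : 0 ≤ x := Int.fract_nonneg _
  have hx1 : x < 1 := Int.fract_lt_one _
  have hd : |x - q₀| ≤ 1 := by
    rw [abs_le]; constructor <;> linarith [hq.1, hq.2]
  set m := lam ^ n
  set s := y - x * Real.tan theta
  set ξ := N * s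
  set x₀ := s - (p₀ - q₀ * Real.tan theta)
  set v := N / (Real.cos theta ^ 2 * m ^ 2) with hv
  have hv0 : 0 < v := by positivity
  have hv1 : v ≤ 1 := by
    rw [hv, div_le_one (by positivity)]
    nlinarith
  have hvm : (m ^ 2)⁻¹ ≤ v := by
    rw [hv, inv_eq_one_div, div_le_div_iff₀ (by positivity) (by positivity)]
    nlinarith [sq_pos_of_pos hm0]
  -- the Gaussian weight of the sum is `exp (-π v k²)`, so that `v ^ (-1 / 4)` is the square root of
  -- its length
  set b' := v ^ (1 / 4 : ℝ) with hb'
  have hb0 : 0 < b' := Real.rpow_pos_of_pos hv0 _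
  have hb1 : b' ≤ 1 := Real.rpow_le_one hv0.le hv1 (by norm_num)
  have hb4 : b' ^ 4 = v := by
    rw [hb', ← Real.rpow_natCast, ← Real.rpow_mul hv0.le]
    norm_num
  have hsm : 0 < Real.sqrt m := Real.sqrt_pos.2 hm0
  have hbm : 1 / b' ≤ Real.sqrt m := by
    rw [div_le_iff₀ hb0]
    by_contra! hlt
    have h1 : (Real.sqrt m * b') ^ 4 < 1 := pow_lt_one₀ (by positivity) hlt (by norm_num)
    have h2 : (Real.sqrt m * b') ^ 4 = m ^ 2 * v := by
      rw [mul_pow, hb4, show Real.sqrt m ^ 4 = (Real.sqrt m ^ 2) ^ 2 by ring, Real.sq_sqrt hm0.le]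
    rw [h2] at h1
    have h3 : 1 ≤ m ^ 2 * v := by
      rw [inv_le_iff_one_le_mul₀ (by positivity)] at hvm
      linarith
    linarith
  have hI := norm_overlap_sum_sub_le hN hNm hd q₀ x₀ ξ
  have hII := norm_periodization_error_le (N := N) hb0 hb1 hq ξ x₀
  rw [hb4] at hII
  set S₁ := ∑' p : ℤ × ℤ,
        (cis (N * Real.tan theta * p.1 ^ 2 / 2 + p.1 * ξ) *
          packetProfile N q₀ (x₀ + p.1 * Real.tan theta + p.2) *
          overlapFactor N m (x - q₀) p.1 (x₀ + p.1 * Real.tan theta + p.2))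
  set S₂ := ∑' p : ℤ × ℤ, dampedPhase (N * Real.tan theta) v ξ p.1 *
        packetProfile N q₀ (x₀ + p.1 * Real.tan theta + p.2)
  set S₃ := ∑' k : ℤ, dampedPhase (N * Real.tan theta) v ξ k *
    packetProfile N q₀ (1 / 2 - Int.fract (1 / 2 - (x₀ + k * Real.tan theta)))
  set ph := phase N n a b q₀ p₀
  have hE0 : 0 < (m ^ 2)⁻¹ := by positivity
  have e : ((Real.sqrt 2 / Real.sqrt (m * (1 + (m ^ 2)⁻¹)) : ℝ) : ℂ) * ph * S₁ -
      Real.sqrt 2 * ph / Real.sqrt m * S₃ = ((Real.sqrt 2 / Real.sqrt m : ℝ) : ℂ) * ph *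
      ((((1 / Real.sqrt (1 + (m ^ 2)⁻¹) : ℝ) : ℂ) * S₁ - S₂) + (S₂ - S₃)) := by
    rw [Real.sqrt_mul hm0.le]
    push_cast
    ring
  rw [e, norm_mul, norm_mul, hph, mul_one, Complex.norm_real, Real.norm_of_nonneg (by positivity)]
  have hs0 := sawConst_nonneg
  refine mul_le_mul_of_nonneg_left ((norm_add_le _ _).trans (add_le_add hI (hII.trans ?_)))
    (by positivity)
  rw [div_eq_mul_one_div]
  gcongr

end QuantumCat

theorem mainTheorem1 :
    ∃ (C : ℝ) (D : ℕ → ℝ), ∀ (N : ℕ) [NeZero N] [Fact (Even N)] (n : ℕ),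
      Real.log (1 / QuantumCat.planck N) / Real.log QuantumCat.lam ≤ n →
      ∀ a b q₀ p₀ : ℝ, q₀ ∈ Set.Ico (0 : ℝ) 1 → p₀ ∈ Set.Ico (0 : ℝ) 1 → ∀ k : ℕ,
        ‖QuantumCat.torusInner N
              ((QuantumCat.torusOperator N)^[n] (QuantumCat.torusPacket N a b))
              (QuantumCat.torusPacket N q₀ p₀)
            - QuantumCat.mainTerm N n a b q₀ p₀‖
          ≤ D k * QuantumCat.planck N ^ k
            + C * (Real.sqrt (QuantumCat.planck N) * QuantumCat.lam ^ (-(n : ℝ) / 2)) := by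
  refine ⟨Real.sqrt 2 * (241 * Real.exp 5 * (135 * Real.exp (5 / 2))), fun k => Real.sqrt 2 *
    (7680 * QuantumCat.sawConst * (8 ^ (k + 3) * (k + 3).factorial)), ?_⟩
  intro N _ _ n hn a b q₀ p₀ hq _ k
  refine (QuantumCat.norm_torusInner_sub_mainTerm_le hn a b hq).trans ?_
  have hm0 : 0 < QuantumCat.lam := zero_lt_one.trans QuantumCat.one_lt_lam
  have h1 : QuantumCat.lam ^ (-(n : ℝ) / 2) = 1 / Real.sqrt (QuantumCat.lam ^ n) := by
    rw [Real.sqrt_eq_rpow, ← Real.rpow_natCast, ← Real.rpow_mul hm0.le, one_div, ← Real.rpow_neg hm0.le]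
    congr 1
    ring
  have h2 : Real.sqrt (QuantumCat.planck N) = 1 / Real.sqrt N := by
    unfold QuantumCat.planck
    rw [Real.sqrt_div zero_le_one, Real.sqrt_one]
  have hsm : 0 < Real.sqrt (QuantumCat.lam ^ n) := Real.sqrt_pos.2 (pow_pos hm0 n)
  have h3 := QuantumCat.cube_mul_exp_neg_le (N := N) k
  have hs0 := QuantumCat.sawConst_nonneg
  rw [h1, h2, mul_add, add_comm]
  refine add_le_add ?_ (le_of_eq (by ring))
  calc _ = Real.sqrt 2 * (7680 * QuantumCat.sawConst * ((N : ℝ) ^ 3 * Real.exp (-(N / 8)))) := by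
        field_simp
    _ ≤ Real.sqrt 2 * (7680 * QuantumCat.sawConst *
        (8 ^ (k + 3) * (k + 3).factorial * QuantumCat.planck N ^ k)) := by gcongr
    _ = _ := by ring
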